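/- Conventions. All digraphs are finite, without loops. A source (sink) is a vertex without incoming (outgoing) arcs, and a vertex is simplicial if its neighborhood in the underlying undirected graph is a clique. A digraph is peo-consistent if its vertices can be labeled $1,\dots,n$ such that for every $i\in[n]$, in the subdigraph $D_i$ induced by $1,\dots,i$ the vertex $i$ is a source or a sink and is simplicial. $D$ is skeletal if it is acyclic, the transitive reduction of every induced subgraph is an oriented forest, and for every directed path $v_1\to\cdots\to v_k$ with $v_1\to v_k$ an arc, all $v_i\to v_j$, $i<j$, are arcs. $\mathrm{AR}_D$ is the set of acyclic digraphs obtained from the acyclic digraph $D$ by reversing some arcs, ordered by containment of the sets of reversed arcs. For a congruence $\equiv$ of a lattice $L$, the quotient $L/{\equiv}$ consists of the classes, with $X\le Y$ iff $x\le y$ for some $x\in X$, $y\in Y$. Permutations. For a permutation $\pi$ of $[n-1]$, $c_i(\pi)$ inserts $n$ at position $i$. An acyclic reorientation $E$ of a peo-consistent labeled $D=([n],A)$ is encoded by $\pi_E=c_n(\pi_{E_{n-1}})$ if $n$ is a sink of $E$; else $\pi_E=c_1(\pi_{E_{n-1}})$ if $n$ is a source; else $\pi_E=c_i(\pi_{E_{n-1}})$,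 where $i$ is the position in $\pi_{E_{n-1}}$ of the unique out-neighbor of $n$ in the transitive reduction of $E$; for $n=0$ it is the empty word. Algorithm J. A right (left) jump of a value $a$ by $d>0$ steps in a permutation moves $a$ to the right (left) past the $d$ entries next to it, which must all be smaller than $a$. It is minimal with respect to a set $L$ of permutations if no jump of the same value in the same direction by fewer steps leads into $L$. Algorithm J on $L$, started at $\pi_0\in L$, visits $\pi_0$, and then repeatedly visits an unvisited permutation of $L$ obtained from the last visited one by a minimal jump of the largest possible value; it terminates if there is no such jump or if the direction of the jump is ambiguous. Representatives. Let $D=([n],A)$ be labeled as above and $\equiv$ a congruence of $\mathrm{AR}_D$. For $E\in\mathrm{AR}_{D_{n-1}}$ let the rail $r(E)$ be the set of $F\in\mathrm{AR}_D$ with $F_{n-1}=E$; let $c(E)\in r(E)$ have $n$ as source or sink as in $D$, and $\bar c(E)\in r(E)$ have $n$ as source or sink oppositely to $D$. Put $E\equiv^*F$ iff $c(E)\equiv c(F)$. For $n=0$, $R_D$ is $\mathrm{AR}_D$ (one element). For $n\ge1$, let $R_{D_{n-1}}$ be a set selected in this way for $\equiv^*$. If $c(E)\not\equiv\bar c(E)$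 for all $E\in\mathrm{AR}_{D_{n-1}}$, then $R_D$ consists of exactly one element of $X\cap r(E)$ for every $E\in R_{D_{n-1}}$ and every class $X$ meeting $r(E)$, where $c(E)$ and $\bar c(E)$ are always chosen. Otherwise $R_D$ is obtained from $R_{D_{n-1}}$ by adding the vertex $n$ as a sink to each element. Let $\Pi_D=\{\pi_E : E\in R_D\}$. Theorem. (a) Let $D=([n],A)$ be a digraph with a labeling as in the definition of peo-consistency. Then $\mathrm{AR}_D$ is a lattice. Let $\equiv$ be any lattice congruence of $\mathrm{AR}_D$. A set $R_D$ as described exists, and every such $R_D$ contains exactly one element of each class of $\equiv$. Algorithm J on $\Pi_D$, started at the identity permutation (which lies in $\Pi_D$), terminates and visits every permutation of $\Pi_D$ exactly once, in an order $\pi_{E_1},\pi_{E_2},\dots$ with $E_1,E_2,\dots\in R_D$ such that $[E_1]_\equiv,[E_2]_\equiv,\dots$ is a Hamilton path in the cover graph of $\mathrm{AR}_D/{\equiv}$; that is, every class is visited exactly once, and consecutive classes are in cover relation. (b) Consequently, for every peo-consistent digraph $D$, $\mathrm{AR}_D$ is a lattice, and for every lattice congruence $\equiv$ of $\mathrm{AR}_D$,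 the cover graph of $\mathrm{AR}_D/{\equiv}$ has a Hamilton path. (c) The same holds for every skeletal digraph $D$. -/

import Mathlib

namespace Digraph

variable {V : Type*}

/-- No directed cycles (in particular no loops and no pairs of opposite arcs). -/
def IsAcyclic (D : Digraph V) : Prop := ∀ v, ¬ Relation.TransGen D.Adj v v

def IsSource (D : Digraph V) (v : V) : Prop := ∀ u, ¬ D.Adj u v

def IsSink (D : Digraph V) (v : V) : Prop := ∀ u, ¬ D.Adj v u

/-- The neighborhood of `v` in the underlying undirected graph is a clique. -/
def IsSimplicial (D : Digraph V) (v : V) : Prop :=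
  D.toSimpleGraphInclusive.IsClique (D.toSimpleGraphInclusive.neighborSet v)

/-- The subdigraph induced by a set of vertices. -/
def induce (D : Digraph V) (s : Set V) : Digraph s where
  Adj u v := D.Adj u v

/-- Remove every arc `u → v` that is implied by transitivity, i.e. for which there is a directed
path from `u` to `v` through a further vertex (used for acyclic digraphs only). -/
def transitiveReduction (D : Digraph V) : Digraph V where
  Adj u v := D.Adj u v ∧
    ¬ ∃ w, Relation.TransGen D.Adj u w ∧ Relation.TransGen D.Adj w v

/-- An acyclic digraph is vertebrate if the transitive reduction of every induced subgraph is an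
oriented forest. -/
def IsVertebrate (D : Digraph V) : Prop :=
  D.IsAcyclic ∧
    ∀ s : Set V, (D.induce s).transitiveReduction.toSimpleGraphInclusive.IsAcyclic

/-- For every directed path from `u` to `v` such that `u → v` is an arc, all arcs from earlier to
later vertices of the path are present. -/
def IsFilled (D : Digraph V) : Prop :=
  ∀ (u v : V) (p : List V), (u :: p ++ [v]).IsChain D.Adj → D.Adj u v →
    (u :: p ++ [v]).Pairwise D.Adj

def IsSkeletal (D : Digraph V) : Prop := D.IsVertebrate ∧ D.IsFilled

/-- The digraph with its last vertex removed. The vertices of a labeled digraph are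
`0, …, n - 1`. -/
def deleteLast {n : ℕ} (D : Digraph (Fin (n + 1))) : Digraph (Fin n) where
  Adj i j := D.Adj i.castSucc j.castSucc

/-- The given labeling of the vertices by `0, …, n - 1` witnesses peo-consistency: each vertex is
a source or a sink, and simplicial, in the subdigraph induced by it and the smaller vertices. -/
def IsPeoLabeled : {n : ℕ} → Digraph (Fin n) → Prop
  | 0, _ => True
  | n + 1, D => (D.IsSource (Fin.last n) ∨ D.IsSink (Fin.last n)) ∧
      D.IsSimplicial (Fin.last n) ∧ IsPeoLabeled D.deleteLast

/-- The digraph obtained by renaming the vertices along `e`. -/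
def relabel {W : Type*} (D : Digraph V) (e : V ≃ W) : Digraph W where
  Adj i j := D.Adj (e.symm i) (e.symm j)

/-- The vertices can be labeled so that the conditions of `IsPeoLabeled` hold. -/
def IsPeoConsistent (D : Digraph V) : Prop :=
  ∃ (n : ℕ) (e : V ≃ Fin n), (D.relabel e).IsPeoLabeled

end Digraph

/-- An acyclic digraph with the same underlying undirected graph as `D`. -/
structure AcyclicReorientation {V : Type*} (D : Digraph V) where
  toDigraph : Digraph V
  acyclic : toDigraph.IsAcyclic
  sameEdges : toDigraph.toSimpleGraphInclusive = D.toSimpleGraphInclusive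

namespace AcyclicReorientation

section General

variable {V : Type*} {D : Digraph V}

/-- The set of arcs of `D` whose direction is reversed in `E`. -/
def flipped (E : AcyclicReorientation D) : Set (V × V) :=
  {a | D.Adj a.1 a.2 ∧ E.toDigraph.Adj a.2 a.1}

end General

variable {n : ℕ} {D : Digraph (Fin (n + 1))}

/-- The reorientation induced on the vertices other than the last one. -/
def deleteLast (E : AcyclicReorientation D) : AcyclicReorientation D.deleteLast where
  toDigraph := E.toDigraph.deleteLast
  acyclic v h := E.acyclic v.castSucc (h.lift Fin.castSucc fun _ _ h => h)
  sameEdges := by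
    ext i j
    have h := congrArg (fun G => G.Adj i.castSucc j.castSucc) E.sameEdges
    simpa [Digraph.toSimpleGraphInclusive, Digraph.deleteLast] using h

/-- Add the last vertex of `D` as a sink. -/
def addSink (E : AcyclicReorientation D.deleteLast) : AcyclicReorientation D where
  toDigraph :=
    { Adj := fun u v => (∃ i j, u = Fin.castSucc i ∧ v = Fin.castSucc j ∧ E.toDigraph.Adj i j) ∨
        (v = Fin.last n ∧ D.toSimpleGraphInclusive.Adj u v) }
  acyclic := by
    have key : ∀ {u v : Fin (n + 1)}, Relation.TransGen (fun u v : Fin (n + 1) =>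
        (∃ i j, u = Fin.castSucc i ∧ v = Fin.castSucc j ∧ E.toDigraph.Adj i j) ∨
        (v = Fin.last n ∧ D.toSimpleGraphInclusive.Adj u v)) u v →
        ∃ i, u = Fin.castSucc i ∧
          (v = Fin.last n ∨ ∃ j, v = Fin.castSucc j ∧ Relation.TransGen E.toDigraph.Adj i j) := by
      intro u v h
      induction h with
      | single h =>
        rcases h with ⟨i, j, rfl, rfl, h⟩ | ⟨rfl, h⟩
        · exact ⟨i, rfl, Or.inr ⟨j, rfl, .single h⟩⟩
        · obtain ⟨i, rfl⟩ := Fin.exists_castSucc_eq.2 h.ne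
          exact ⟨i, rfl, Or.inl rfl⟩
      | tail _ h ih =>
        obtain ⟨i, rfl, ih⟩ := ih
        refine ⟨i, rfl, ?_⟩
        rcases h with ⟨k, j, rfl, rfl, h⟩ | ⟨rfl, h⟩
        · rcases ih with ih | ⟨k', hk, ih⟩
          · exact absurd ih (Fin.castSucc_lt_last k).ne
          · obtain rfl := Fin.castSucc_injective _ hk
            exact Or.inr ⟨j, rfl, ih.tail h⟩
        · exact Or.inl rfl
    intro v h
    obtain ⟨i, rfl, h | ⟨j, hj, h⟩⟩ := key h
    · exact absurd h (Fin.castSucc_lt_last i).ne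
    · obtain rfl := Fin.castSucc_injective _ hj
      exact E.acyclic _ h
  sameEdges := by
    ext u v
    have h : ∀ i j, E.toDigraph.toSimpleGraphInclusive.Adj i j ↔
        D.deleteLast.toSimpleGraphInclusive.Adj i j := fun i j => by rw [E.sameEdges]
    have hl : ∀ i : Fin n, Fin.last n ≠ i.castSucc := fun i => (Fin.castSucc_lt_last i).ne'
    refine Fin.lastCases ?_ (fun i => ?_) u <;> refine Fin.lastCases ?_ (fun j => ?_) v
    · simp
    · simp [Digraph.toSimpleGraphInclusive, hl, (hl _).symm, or_comm]
    · simp [Digraph.toSimpleGraphInclusive, hl, (hl _).symm, or_comm]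
    · simpa [Digraph.toSimpleGraphInclusive, Digraph.deleteLast] using h i j

/-- Add the last vertex of `D` as a source. -/
def addSource (E : AcyclicReorientation D.deleteLast) : AcyclicReorientation D where
  toDigraph :=
    { Adj := fun u v => (∃ i j, u = Fin.castSucc i ∧ v = Fin.castSucc j ∧ E.toDigraph.Adj i j) ∨
        (u = Fin.last n ∧ D.toSimpleGraphInclusive.Adj u v) }
  acyclic := by
    have key : ∀ {u v : Fin (n + 1)}, Relation.TransGen (fun u v : Fin (n + 1) =>
        (∃ i j, u = Fin.castSucc i ∧ v = Fin.castSucc j ∧ E.toDigraph.Adj i j) ∨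
        (u = Fin.last n ∧ D.toSimpleGraphInclusive.Adj u v)) u v →
        ∃ j, v = Fin.castSucc j ∧
          (u = Fin.last n ∨ ∃ i, u = Fin.castSucc i ∧ Relation.TransGen E.toDigraph.Adj i j) := by
      intro u v h
      induction h with
      | single h =>
        rcases h with ⟨i, j, rfl, rfl, h⟩ | ⟨rfl, h⟩
        · exact ⟨j, rfl, Or.inr ⟨i, rfl, .single h⟩⟩
        · obtain ⟨j, rfl⟩ := Fin.exists_castSucc_eq.2 h.ne'
          exact ⟨j, rfl, Or.inl rfl⟩
      | tail _ h ih =>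
        obtain ⟨k, rfl, ih⟩ := ih
        rcases h with ⟨k', j, hk, rfl, h⟩ | ⟨hk, h⟩
        · obtain rfl := Fin.castSucc_injective _ hk
          rcases ih with ih | ⟨i, rfl, ih⟩
          · exact ⟨j, rfl, Or.inl ih⟩
          · exact ⟨j, rfl, Or.inr ⟨i, rfl, ih.tail h⟩⟩
        · exact absurd hk (Fin.castSucc_lt_last k).ne
    intro v h
    obtain ⟨j, rfl, h | ⟨i, hi, h⟩⟩ := key h
    · exact absurd h (Fin.castSucc_lt_last j).ne
    · obtain rfl := Fin.castSucc_injective _ hi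
      exact E.acyclic _ h
  sameEdges := by
    ext u v
    have h : ∀ i j, E.toDigraph.toSimpleGraphInclusive.Adj i j ↔
        D.deleteLast.toSimpleGraphInclusive.Adj i j := fun i j => by rw [E.sameEdges]
    have hl : ∀ i : Fin n, Fin.last n ≠ i.castSucc := fun i => (Fin.castSucc_lt_last i).ne'
    refine Fin.lastCases ?_ (fun i => ?_) u <;> refine Fin.lastCases ?_ (fun j => ?_) v
    · simp
    · simp [Digraph.toSimpleGraphInclusive, hl, (hl _).symm, or_comm]
    · simp [Digraph.toSimpleGraphInclusive, hl, (hl _).symm, or_comm]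
    · simpa [Digraph.toSimpleGraphInclusive, Digraph.deleteLast] using h i j

open Classical in
/-- Add the last vertex as a source or sink, according to how it appears in `D`. -/
noncomputable def addSame (E : AcyclicReorientation D.deleteLast) : AcyclicReorientation D :=
  if D.IsSink (Fin.last n) then E.addSink else E.addSource

open Classical in
/-- Add the last vertex as a source or sink, oppositely to how it appears in `D`. -/
noncomputable def addOpposite (E : AcyclicReorientation D.deleteLast) : AcyclicReorientation D :=
  if D.IsSink (Fin.last n) then E.addSource else E.addSink

end AcyclicReorientation

section Encoding

open Classical in
/-- The permutation of `0, …, n - 1`, in one-line notation, that encodes an acyclic digraph (whose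
underlying undirected graph is in perfect elimination order): to the word of the digraph without
its last vertex, the last vertex is added at the end if it is a sink, else at the beginning if it
is a source, else at the position of its unique out-neighbor in the transitive reduction. -/
noncomputable def Digraph.encode : {n : ℕ} → Digraph (Fin n) → List ℕ
  | 0, _ => []
  | n + 1, E =>
    if E.IsSink (Fin.last n) then E.deleteLast.encode ++ [n]
    else if E.IsSource (Fin.last n) then n :: E.deleteLast.encode
    else E.deleteLast.encode.insertIdx
      (E.deleteLast.encode.findIdx fun a => decide (∃ j : Fin n, j.val = a ∧
        E.transitiveReduction.Adj (Fin.last n) j.castSucc)) n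

/-- The permutation encoding an acyclic reorientation. -/
noncomputable def AcyclicReorientation.encode {n : ℕ} {D : Digraph (Fin n)}
    (E : AcyclicReorientation D) : List ℕ :=
  E.toDigraph.encode

end Encoding

section Representatives

variable {n : ℕ} {D : Digraph (Fin (n + 1))}

/-- The restriction of a relation to the reorientations without the last vertex. -/
def restrictRel (r : AcyclicReorientation D → AcyclicReorientation D → Prop) :
    AcyclicReorientation D.deleteLast → AcyclicReorientation D.deleteLast → Prop :=
  fun E F => r E.addSame F.addSame

/-- `R` is obtained by the recursive selection of representatives for the relation `r`, starting
from some set `R'` selected for the restriction of `r`. The rail of `E` consists of the `F` with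
`F.deleteLast = E`. If on no rail the two extreme reorientations are related, then `R` consists of
exactly one element of every class meeting the rail of `E`, for every `E ∈ R'`, always including
both extreme reorientations; otherwise the last vertex is added as a sink to every `E ∈ R'`. -/
def IsRepresentativeSelection : {n : ℕ} → {D : Digraph (Fin n)} →
    (AcyclicReorientation D → AcyclicReorientation D → Prop) → Set (AcyclicReorientation D) → Prop
  | 0, _, _, R => R = Set.univ
  | _ + 1, D, r, R => ∃ R' : Set (AcyclicReorientation D.deleteLast),
      IsRepresentativeSelection (restrictRel r) R' ∧
      (((∀ E : AcyclicReorientation D.deleteLast, ¬ r E.addSame E.addOpposite) ∧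
          (∀ F ∈ R, F.deleteLast ∈ R') ∧
          (∀ E ∈ R', E.addSame ∈ R ∧ E.addOpposite ∈ R) ∧
          (∀ F : AcyclicReorientation D, F.deleteLast ∈ R' →
            ∃! G, G ∈ R ∧ G.deleteLast = F.deleteLast ∧ r G F)) ∨
        ((¬ ∀ E : AcyclicReorientation D.deleteLast, ¬ r E.addSame E.addOpposite) ∧
          R = AcyclicReorientation.addSink '' R'))

end Representatives

section AlgorithmJ

/-- The two directions of a jump. -/
inductive JumpDirection
  | left
  | right

/-- `w'` is obtained from `w` by a jump of the value `a` by `d` steps: `a` moves past `d > 0`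
consecutive smaller entries, all of them next to it. -/
def IsJump (w w' : List ℕ) (a : ℕ) : JumpDirection → ℕ → Prop
  | .right, d => 0 < d ∧ ∃ x s y : List ℕ, s.length = d ∧ (∀ b ∈ s, b < a) ∧
      w = x ++ a :: s ++ y ∧ w' = x ++ s ++ a :: y
  | .left, d => 0 < d ∧ ∃ x s y : List ℕ, s.length = d ∧ (∀ b ∈ s, b < a) ∧
      w = x ++ s ++ a :: y ∧ w' = x ++ a :: s ++ y

/-- A jump leading to `L` such that all jumps of the same value in the same direction by fewer
steps lead outside `L`. -/
def IsMinimalJump (L : Set (List ℕ)) (w w' : List ℕ) (a : ℕ) (δ : JumpDirection) : Prop :=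
  w' ∈ L ∧ ∃ d, IsJump w w' a δ d ∧ ∀ d' < d, ∀ w'', IsJump w w'' a δ d' → w'' ∉ L

/-- `w'` is an unvisited permutation that can be reached from `w` by a minimal jump of `a`. -/
def IsCandidate (L : Set (List ℕ)) (visited : List (List ℕ)) (w w' : List ℕ) (a : ℕ)
    (δ : JumpDirection) : Prop :=
  IsMinimalJump L w w' a δ ∧ w' ∉ visited

/-- One jump step of the greedy algorithm from the most recently visited permutation `w`: a
minimal jump of the largest possible value to an unvisited permutation, with unambiguous
direction. -/
def IsGreedyStep (L : Set (List ℕ)) (visited : List (List ℕ)) (w w' : List ℕ) : Prop :=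
  ∃ a δ, IsCandidate L visited w w' a δ ∧
    (∀ a' δ' w'', IsCandidate L visited w w'' a' δ' → a' ≤ a) ∧
    (∀ δ' w'', IsCandidate L visited w w'' a δ' → δ' = δ)

/-- The lists of visited permutations, in order, that arise while the algorithm runs on `L` from
the initial permutation `w₀`. -/
inductive AlgorithmJ.Visits (L : Set (List ℕ)) (w₀ : List ℕ) : List (List ℕ) → Prop
  | init : Visits L w₀ [w₀]
  | step {l : List (List ℕ)} {w w' : List ℕ} (h : Visits L w₀ (l ++ [w]))
      (h' : IsGreedyStep L (l ++ [w]) w w') : Visits L w₀ (l ++ [w, w'])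

/-- The algorithm, run on `L` from the initial permutation `w₀ ∈ L`, terminates having visited
precisely the permutations in the list `out`, in this order. -/
def AlgorithmJ (L : Set (List ℕ)) (w₀ : List ℕ) (out : List (List ℕ)) : Prop :=
  w₀ ∈ L ∧ AlgorithmJ.Visits L w₀ out ∧
    ∀ l w w', out = l ++ [w] → ¬ IsGreedyStep L out w w'

end AlgorithmJ

section Quotient

variable {α : Type*} [Lattice α]

/-- The equivalence classes of a lattice congruence. -/
def LatticeCon.Classes (c : LatticeCon α) : Type _ := Quotient c.toSetoid

/-- The equivalence class of an element. -/
def LatticeCon.classOf (c : LatticeCon α) (x : α) : c.Classes := Quotient.mk c.toSetoid x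

/-- The order of the lattice quotient: `X ≤ Y` if `x ≤ y` for some `x ∈ X` and `y ∈ Y`. -/
instance LatticeCon.instPartialOrderClasses (c : LatticeCon α) : PartialOrder c.Classes where
  le X Y := ∃ x y, c.classOf x = X ∧ c.classOf y = Y ∧ x ≤ y
  le_refl X := by
    obtain ⟨x, rfl⟩ := Quotient.exists_rep X
    exact ⟨x, x, rfl, rfl, le_rfl⟩
  le_trans := by
    rintro _ _ _ ⟨x, y, rfl, rfl, h⟩ ⟨y', z, hy, rfl, h'⟩
    refine ⟨x, y ⊔ z, rfl, Quotient.sound ?_, h.trans le_sup_left⟩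
    have := c.sup (c.symm (Quotient.exact hy)) (c.refl z)
    rwa [sup_eq_right.2 h'] at this
  le_antisymm := by
    rintro _ _ ⟨x, y, rfl, rfl, h⟩ ⟨y', x', hy, hx, h'⟩
    refine Quotient.sound ?_
    have := c.sup (Quotient.exact hx) (Quotient.exact hy)
    rw [sup_eq_right.2 h, sup_eq_left.2 h'] at this
    exact c.trans (c.symm (Quotient.exact hx)) this

/-- The cover graph of the lattice quotient. -/
def LatticeCon.coverGraph (c : LatticeCon α) : SimpleGraph c.Classes :=
  SimpleGraph.hasse c.Classes

end Quotient

open Classical in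
/-- The list `l` enumerates the vertices of `G` along a Hamilton path. -/
def SimpleGraph.IsHamiltonPath {V : Type*} (G : SimpleGraph V) (l : List V) : Prop :=
  ∃ (a b : V) (p : G.Walk a b), p.IsHamiltonian ∧ p.support = l

/-! The proof is by induction on the number of vertices, deleting the last vertex `n`. The
reorientations with a given restriction form a rail. As `n` is simplicial, every acyclic orientation
of the remaining edges orders its neighbors linearly, and a member of the rail amounts to an up-set
of this order (the neighbors whose edge to `n` is flipped); so rails are chains. The join of two
reorientations is the join of their restrictions together with the up-set generated by both flip
sets (`exists_isLUB_of_deleteLast`), and reversing all arcs turns joins into meets. Deletion of `n`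
is then a lattice homomorphism whose left and right adjoints add `n` as in `D` or oppositely
(`isRail`).

This structure, isolated as `IsRail`, controls a congruence. If the ends of one rail are equivalent,
so are those of every rail (`rel_lo_hi`). A class can be followed from one rail to any rail with
equivalent base (`exists_rel_of_restrict`). Both sections preserve covers of classes. Hence, if the
rails collapse, the quotient has the same classes and covers as the restricted one. Otherwise the
classes on each chosen rail form a path in the cover graph. A Hamilton path arises by running
through the chosen rails in the order of a Hamilton path for the smaller digraph, alternately in the
two directions, and changing rails with `n` fixed at a common end.

The encoding turns this into Algorithm J. The word of a reorientation is a topological order, so it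
determines the reorientation, and moving along a rail means moving the largest value `n` within a
fixed word. While the rail is not exhausted, `n` is the largest value that can jump, in one
direction only. Once it is exhausted, `n` stands at an end of the word, no smaller value can cross
it, and the next step is the one of the algorithm for the smaller digraph (`zigzag_isRun`). Steps
are deterministic on words without repetition, so every complete execution is this one.

For a skeletal digraph, a labeling is obtained by repeatedly removing a simplicial vertex that is a
source or a sink. Such a vertex is found as in Dirac's theorem on chordal graphs
(`exists_isPeoVertex_not_adj`): long induced cycles would survive in a transitive reduction, which
is a forest, and the argument descends to a clique, where the source or the sink can be taken. -/

/-! ### Order and covers in the quotient by a lattice congruence. -/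

namespace LatticeCon

variable {α β : Type*} [Lattice α] [Lattice β] (c : LatticeCon α)

theorem classOf_eq_iff {x y : α} : c.classOf x = c.classOf y ↔ c.r x y :=
  ⟨Quotient.exact, fun h => Quotient.sound h⟩

theorem classOf_surjective (X : c.Classes) : ∃ x, c.classOf x = X :=
  Quotient.exists_rep X

theorem classOf_mono {x y : α} (h : x ≤ y) : c.classOf x ≤ c.classOf y :=
  ⟨x, y, rfl, rfl, h⟩

theorem classOf_le_iff {x y : α} : c.classOf x ≤ c.classOf y ↔ c.r (x ⊓ y) x := by
  constructor
  · rintro ⟨x', y', hx, hy, h⟩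
    have := c.inf ((c.classOf_eq_iff).1 hx) ((c.classOf_eq_iff).1 hy)
    rw [inf_eq_left.2 h] at this
    exact c.trans (c.symm this) ((c.classOf_eq_iff).1 hx)
  · intro h
    rw [← (c.classOf_eq_iff).2 h]
    exact c.classOf_mono inf_le_right

theorem classOf_le_iff_sup {x y : α} : c.classOf x ≤ c.classOf y ↔ c.r (x ⊔ y) y := by
  rw [classOf_le_iff]
  constructor
  · intro h
    have := c.sup h (c.refl y)
    rw [inf_comm, sup_comm, sup_inf_self] at this
    exact c.symm this
  · intro h
    have := c.inf (c.refl x) h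
    rw [inf_sup_self] at this
    exact c.symm this

/-- If every element between `x` and `y` is related to `x` or to `y`, then the class of `y`
covers the class of `x`. -/
theorem classOf_covBy {x y : α} (hxy : x ≤ y) (hne : ¬ c.r x y)
    (h : ∀ z, x ≤ z → z ≤ y → c.r z x ∨ c.r z y) : c.classOf x ⋖ c.classOf y := by
  refine ⟨lt_of_le_of_ne (c.classOf_mono hxy) fun h => hne (c.classOf_eq_iff.1 h), ?_⟩
  intro Z h1 h2
  obtain ⟨z, rfl⟩ := c.classOf_surjective Z
  -- A class between those of `x` and `y` has a representative in the interval from `x` to `y`: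
  -- clamp `z` to `(x ⊔ z) ⊓ y`.
  have e1 := c.classOf_le_iff_sup.1 h1.le
  have e2 := c.inf e1 (c.refl y)
  have e3 : c.r ((x ⊔ z) ⊓ y) z := c.trans e2 (c.classOf_le_iff.1 h2.le)
  rcases h ((x ⊔ z) ⊓ y) (le_inf le_sup_left hxy) inf_le_right with h | h
  · exact h1.ne (c.classOf_eq_iff.2 (c.trans (c.symm h) e3))
  · exact h2.ne (c.classOf_eq_iff.2 (c.trans (c.symm e3) h))

theorem coverGraph_adj {X Y : c.Classes} : c.coverGraph.Adj X Y ↔ X ⋖ Y ∨ Y ⋖ X :=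
  SimpleGraph.hasse_adj

end LatticeCon

/-! ### Congruences and a homomorphism with two adjoint sections. -/

/-- A lattice `α` with a homomorphism `p` to a lattice `β` and two sections `lo` and `hi` of `p`
whose images are an ideal and a filter. -/
structure IsRail {α β : Type*} [Lattice α] [Lattice β] (p : α → β) (lo hi : β → α) (t b : α) :
    Prop where
  map_sup : ∀ x y, p (x ⊔ y) = p x ⊔ p y
  map_inf : ∀ x y, p (x ⊓ y) = p x ⊓ p y
  map_lo : ∀ a, p (lo a) = a
  map_hi : ∀ a, p (hi a) = a
  lo_map : ∀ x, lo (p x) = x ⊓ t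
  hi_map : ∀ x, hi (p x) = x ⊔ b

namespace IsRail

variable {α β : Type*} [Lattice α] [Lattice β] {p : α → β} {lo hi : β → α} {t b : α}

theorem dual (h : IsRail p lo hi t b) :
    IsRail (α := αᵒᵈ) (β := βᵒᵈ) p hi lo b t where
  map_sup := h.map_inf
  map_inf := h.map_sup
  map_lo := h.map_hi
  map_hi := h.map_lo
  lo_map := h.hi_map
  hi_map := h.lo_map

theorem lo_le (h : IsRail p lo hi t b) (x : α) : lo (p x) ≤ x := by
  rw [h.lo_map]; exact inf_le_left

theorem le_hi (h : IsRail p lo hi t b) (x : α) : x ≤ hi (p x) := by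
  rw [h.hi_map]; exact le_sup_left

theorem lo_le_t (h : IsRail p lo hi t b) (a : β) : lo a ≤ t := by
  rw [← h.map_lo a, h.lo_map]; exact inf_le_right

theorem lo_eq (h : IsRail p lo hi t b) (a : β) : lo a = hi a ⊓ t := by
  rw [← h.lo_map, h.map_hi]

theorem hi_eq (h : IsRail p lo hi t b) (a : β) : hi a = lo a ⊔ b := by
  rw [← h.hi_map, h.map_lo]

theorem lo_inf (h : IsRail p lo hi t b) (a a' : β) : lo (a ⊓ a') = lo a ⊓ lo a' := by
  have := h.lo_map (lo a ⊓ lo a')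
  rwa [h.map_inf, h.map_lo, h.map_lo,
    inf_eq_left.2 (inf_le_left.trans (h.lo_le_t a))] at this

theorem lo_sup (h : IsRail p lo hi t b) (a a' : β) : lo (a ⊔ a') = lo a ⊔ lo a' := by
  have := h.lo_map (lo a ⊔ lo a')
  rwa [h.map_sup, h.map_lo, h.map_lo,
    inf_eq_left.2 (sup_le (h.lo_le_t a) (h.lo_le_t a'))] at this

theorem hi_sup (h : IsRail p lo hi t b) (a a' : β) : hi (a ⊔ a') = hi a ⊔ hi a' :=
  h.dual.lo_inf a a'

/-- The restriction of a congruence along the section `lo`. -/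
def restrict (h : IsRail p lo hi t b) (c : LatticeCon α) : LatticeCon β where
  r a a' := c.r (lo a) (lo a')
  iseqv := ⟨fun _ => c.refl _, fun h => c.symm h, fun h h' => c.trans h h'⟩
  inf h1 h2 := by rw [h.lo_inf, h.lo_inf]; exact c.inf h1 h2
  sup h1 h2 := by rw [h.lo_sup, h.lo_sup]; exact c.sup h1 h2

variable (h : IsRail p lo hi t b) (c : LatticeCon α)
include h

theorem restrict_map {x y : α} (hxy : c.r x y) : (h.restrict c).r (p x) (p y) := by
  change c.r _ _
  rw [h.lo_map, h.lo_map]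
  exact c.inf hxy (c.refl t)

theorem rel_lo_iff_hi {a a' : β} : c.r (lo a) (lo a') ↔ c.r (hi a) (hi a') := by
  constructor
  · intro hr
    rw [h.hi_eq, h.hi_eq]
    exact c.sup hr (c.refl b)
  · intro hr
    rw [h.lo_eq, h.lo_eq]
    exact c.inf hr (c.refl t)

/-- The rail over `a` projects down to the rail over `a ⊓ a'` by a meet with `hi (a ⊓ a')`, and from
there up to the rail over `a'` by a join with `lo a'`. A congruence respects both projections, so
one collapsed rail collapses all. -/
theorem rel_lo_hi {a : β} (ha : c.r (lo a) (hi a)) (a' : β) : c.r (lo a') (hi a') := by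
  have h1 := c.inf ha (c.refl (hi (a ⊓ a')))
  have h2 := c.sup h1 (c.refl (lo a'))
  have e1 : lo a ⊓ hi (a ⊓ a') ≤ lo a' := by
    have := h.lo_map (lo a ⊓ hi (a ⊓ a'))
    rw [inf_eq_left.2 (inf_le_left.trans (h.lo_le_t a)), h.map_inf, h.map_lo, h.map_hi] at this
    rw [← this, h.lo_inf, h.lo_inf]
    exact inf_le_right.trans inf_le_right
  have e2 : hi a ⊓ hi (a ⊓ a') ⊔ lo a' = hi a' := by
    have : hi a ⊓ hi (a ⊓ a') = hi (a ⊓ a') := by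
      rw [inf_eq_right, ← sup_eq_left, ← h.hi_sup, sup_inf_self]
    rw [this, h.hi_eq (a ⊓ a'), h.hi_eq a', sup_right_comm, ← h.lo_sup, inf_comm, sup_comm a' _ |>.symm.trans ?_]
    exact sup_inf_self
  rwa [sup_eq_right.2 e1, e2] at h2

/-- The element `x` is first pushed up to the rail over `p x ⊔ e`, then down to the rail over `e`.
Neither move leaves its class, since `lo (p x ⊔ e)` is related to `lo (p x)` and `hi e` to `hi (p x
⊔ e)`. -/
theorem exists_rel_of_restrict {x : α} {e : β} (he : (h.restrict c).r (p x) e) :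
    ∃ y, p y = e ∧ c.r y x := by
  change c.r (lo (p x)) (lo e) at he
  refine ⟨(x ⊔ lo (p x ⊔ e)) ⊓ hi e, ?_, ?_⟩
  · rw [h.map_inf, h.map_sup, h.map_lo, h.map_hi, ← sup_assoc, sup_idem, inf_comm, sup_comm,
      inf_sup_self]
  · have h1 : c.r (lo (p x ⊔ e)) (lo (p x)) := by
      have := c.sup (c.refl (lo (p x))) (c.symm he)
      rwa [sup_idem, ← h.lo_sup] at this
    have h2 : c.r (x ⊔ lo (p x ⊔ e)) x := by
      have := c.sup (c.refl x) h1
      rwa [sup_eq_left.2 (h.lo_le x)] at this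
    have h3 : c.r (hi e) (hi (p x ⊔ e)) :=
      (h.rel_lo_iff_hi c).1 (c.symm (c.trans h1 he))
    have h4 := c.inf (c.refl (x ⊔ lo (p x ⊔ e))) h3
    have h5 : x ⊔ lo (p x ⊔ e) ≤ hi (p x ⊔ e) := by
      have := h.le_hi (x ⊔ lo (p x ⊔ e))
      rwa [h.map_sup, h.map_lo, ← sup_assoc, sup_idem] at this
    rw [inf_eq_left.2 h5] at h4
    exact c.trans h4 h2

theorem classOf_lo_le_iff {a a' : β} : c.classOf (lo a) ≤ c.classOf (lo a') ↔
    (h.restrict c).classOf a ≤ (h.restrict c).classOf a' := by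
  rw [LatticeCon.classOf_le_iff, LatticeCon.classOf_le_iff, ← h.lo_inf]; rfl

theorem classOf_hi_le_iff {a a' : β} : c.classOf (hi a) ≤ c.classOf (hi a') ↔
    (h.restrict c).classOf a ≤ (h.restrict c).classOf a' := by
  rw [LatticeCon.classOf_le_iff_sup, LatticeCon.classOf_le_iff_sup, ← h.hi_sup,
    ← h.rel_lo_iff_hi]; rfl

/-- The image of `lo` is an ideal. A class below that of `lo a'` therefore has a representative of
the form `lo _`, and nothing new can appear between two such classes. The statement for `hi` is
dual. -/
theorem classOf_lo_covBy {a a' : β}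
    (ha : (h.restrict c).classOf a ⋖ (h.restrict c).classOf a') :
    c.classOf (lo a) ⋖ c.classOf (lo a') := by
  refine ⟨lt_of_le_not_ge ((h.classOf_lo_le_iff c).2 ha.1.le) fun h' =>
    ha.1.not_ge ((h.classOf_lo_le_iff c).1 h'), ?_⟩
  intro Z h1 h2
  obtain ⟨z, rfl⟩ := c.classOf_surjective Z
  have e : c.classOf (lo (p (z ⊓ lo a'))) = c.classOf z := by
    rw [h.lo_map, inf_eq_left.2 (inf_le_right.trans (h.lo_le_t a')), c.classOf_eq_iff]
    exact c.classOf_le_iff.1 h2.le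
  rw [← e, lt_iff_le_not_ge, h.classOf_lo_le_iff, h.classOf_lo_le_iff, ← lt_iff_le_not_ge] at h1 h2
  exact ha.2 h1 h2

theorem classOf_hi_covBy {a a' : β}
    (ha : (h.restrict c).classOf a ⋖ (h.restrict c).classOf a') :
    c.classOf (hi a) ⋖ c.classOf (hi a') := by
  refine ⟨lt_of_le_not_ge ((h.classOf_hi_le_iff c).2 ha.1.le) fun h' =>
    ha.1.not_ge ((h.classOf_hi_le_iff c).1 h'), ?_⟩
  intro Z h1 h2
  obtain ⟨z, rfl⟩ := c.classOf_surjective Z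
  have hb : b ≤ hi a := by rw [h.hi_eq]; exact le_sup_right
  have e : c.classOf (hi (p (hi a ⊔ z))) = c.classOf z := by
    rw [h.hi_map, sup_eq_left.2 (hb.trans le_sup_left), c.classOf_eq_iff]
    exact c.classOf_le_iff_sup.1 h1.le
  rw [← e, lt_iff_le_not_ge, h.classOf_hi_le_iff, h.classOf_hi_le_iff, ← lt_iff_le_not_ge] at h1 h2
  exact ha.2 h1 h2

theorem coverGraph_lo_adj {a a' : β}
    (ha : (h.restrict c).coverGraph.Adj ((h.restrict c).classOf a) ((h.restrict c).classOf a')) :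
    c.coverGraph.Adj (c.classOf (lo a)) (c.classOf (lo a')) := by
  rw [LatticeCon.coverGraph_adj] at *
  exact ha.imp (h.classOf_lo_covBy c) (h.classOf_lo_covBy c)

theorem coverGraph_hi_adj {a a' : β}
    (ha : (h.restrict c).coverGraph.Adj ((h.restrict c).classOf a) ((h.restrict c).classOf a')) :
    c.coverGraph.Adj (c.classOf (hi a)) (c.classOf (hi a')) := by
  rw [LatticeCon.coverGraph_adj] at *
  exact ha.imp (h.classOf_hi_covBy c) (h.classOf_hi_covBy c)

theorem map_mono {x y : α} (hxy : x ≤ y) : p x ≤ p y := by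
  rw [← sup_eq_right, ← h.map_sup, sup_eq_right.2 hxy]

end IsRail

/-! ### Acyclic digraphs and removal of the last vertex. -/

namespace Digraph

variable {V : Type*} {D : Digraph V}

theorem IsAcyclic.asymm (h : D.IsAcyclic) {u v : V} (huv : D.Adj u v) : ¬ D.Adj v u :=
  fun hvu => h u (.tail (.single huv) hvu)

theorem IsAcyclic.irrefl (h : D.IsAcyclic) {u : V} : ¬ D.Adj u u :=
  fun hu => h u (.single hu)

theorem IsAcyclic.ne (h : D.IsAcyclic) {u v : V} (huv : D.Adj u v) : u ≠ v := by
  rintro rfl; exact h.irrefl huv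

theorem toSimpleGraphInclusive_adj {u v : V} :
    D.toSimpleGraphInclusive.Adj u v ↔ u ≠ v ∧ (D.Adj u v ∨ D.Adj v u) :=
  Iff.rfl

theorem IsAcyclic.toSimpleGraphInclusive_adj (h : D.IsAcyclic) {u v : V} :
    D.toSimpleGraphInclusive.Adj u v ↔ D.Adj u v ∨ D.Adj v u := by
  rw [Digraph.toSimpleGraphInclusive_adj, and_iff_right_iff_imp]
  rintro (h' | h')
  · exact h.ne h'
  · exact (h.ne h').symm

theorem IsAcyclic.deleteLast {n : ℕ} {D : Digraph (Fin (n + 1))} (h : D.IsAcyclic) :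
    D.deleteLast.IsAcyclic :=
  fun v hv => h v.castSucc (hv.lift Fin.castSucc fun _ _ h => h)

theorem isAcyclic_of_deleteLast {n : ℕ} {D : Digraph (Fin (n + 1))} (h : D.deleteLast.IsAcyclic)
    (hl : D.IsSource (Fin.last n) ∨ D.IsSink (Fin.last n)) : D.IsAcyclic := by
  intro v hv
  have key : ∀ y, Relation.TransGen D.Adj v y → v ≠ Fin.last n → y ≠ Fin.last n →
      ∃ i j, v = Fin.castSucc i ∧ y = Fin.castSucc j ∧ Relation.TransGen D.deleteLast.Adj i j := by
    intro y hy hv hy'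
    obtain ⟨i, rfl⟩ := Fin.exists_castSucc_eq.2 hv
    induction hy with
    | single h =>
      obtain ⟨j, rfl⟩ := Fin.exists_castSucc_eq.2 hy'
      exact ⟨i, j, rfl, rfl, .single h⟩
    | @tail b c _ h ih =>
      obtain ⟨j, rfl⟩ := Fin.exists_castSucc_eq.2 hy'
      have hb : b ≠ Fin.last n := by
        rintro rfl
        rcases hl with hl | hl
        · rename_i h1
          cases h1 with
          | single h1 => exact hl _ h1
          | tail _ h1 => exact hl _ h1
        · exact hl _ h
      obtain ⟨i', k, hi', rfl, hk⟩ := ih hb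
      obtain rfl := Fin.castSucc_injective _ hi'
      exact ⟨i, j, rfl, rfl, hk.tail h⟩
  by_cases hvl : v = Fin.last n
  · subst hvl
    rcases hl with hl | hl
    · cases hv with
      | single h1 => exact hl _ h1
      | tail _ h1 => exact hl _ h1
    · obtain ⟨b, hb, _⟩ := Relation.TransGen.head'_iff.1 hv
      exact hl _ hb
  · obtain ⟨i, j, h1, h2, h3⟩ := key v hv hvl hvl
    rw [h1] at h2
    obtain rfl := Fin.castSucc_injective _ h2
    exact h i h3

theorem IsPeoLabeled.isAcyclic : ∀ {n : ℕ} {D : Digraph (Fin n)}, D.IsPeoLabeled → D.IsAcyclic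
  | 0, _, _ => fun v => v.elim0
  | _ + 1, _, h => isAcyclic_of_deleteLast h.2.2.isAcyclic h.1

/-- With `Fact`, the order and the lattice structure on reorientations, and those after deleting the
last vertex, are found by instance search throughout the induction. -/
instance {n : ℕ} {D : Digraph (Fin n)} [h : Fact D.IsPeoLabeled] : Fact D.IsAcyclic :=
  ⟨h.1.isAcyclic⟩

instance {n : ℕ} {D : Digraph (Fin (n + 1))} [h : Fact D.IsAcyclic] : Fact D.deleteLast.IsAcyclic :=
  ⟨h.1.deleteLast⟩

instance {n : ℕ} {D : Digraph (Fin (n + 1))} [h : Fact D.IsPeoLabeled] :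
    Fact D.deleteLast.IsPeoLabeled :=
  ⟨h.1.2.2⟩

/-- Reverse all arcs. -/
def reverse (D : Digraph V) : Digraph V where
  Adj u v := D.Adj v u

theorem IsAcyclic.reverse (h : D.IsAcyclic) : D.reverse.IsAcyclic :=
  fun v hv => h v (Relation.transGen_swap.1 hv)

end Digraph

/-! ### The poset of acyclic reorientations. -/

namespace AcyclicReorientation

section General

variable {V : Type*} {D : Digraph V}

theorem ext' {E F : AcyclicReorientation D}
    (h : ∀ u v, E.toDigraph.Adj u v ↔ F.toDigraph.Adj u v) : E = F := by
  obtain ⟨E, _, _⟩ := E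
  obtain ⟨F, _, _⟩ := F
  have : E = F := by
    ext u v
    exact h u v
  subst this
  rfl

theorem toGraph_adj_iff (E : AcyclicReorientation D) {u v : V} :
    D.toSimpleGraphInclusive.Adj u v ↔ E.toDigraph.Adj u v ∨ E.toDigraph.Adj v u := by
  rw [← E.sameEdges, E.acyclic.toSimpleGraphInclusive_adj]

theorem adj_or_adj (E : AcyclicReorientation D) (hD : D.IsAcyclic) {u v : V} (h : D.Adj u v) :
    E.toDigraph.Adj u v ∨ E.toDigraph.Adj v u :=
  E.toGraph_adj_iff.1 (hD.toSimpleGraphInclusive_adj.2 (.inl h))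

theorem adj_of_flipped_subset (hD : D.IsAcyclic) {E F : AcyclicReorientation D}
    (h : E.flipped ⊆ F.flipped) {u v : V} (huv : D.Adj u v) (hF : F.toDigraph.Adj u v) :
    E.toDigraph.Adj u v := by
  refine (E.adj_or_adj hD huv).resolve_right fun hE => ?_
  exact F.acyclic.asymm hF (h (a := (u, v)) ⟨huv, hE⟩).2

theorem eq_of_flipped_eq (hD : D.IsAcyclic) {E F : AcyclicReorientation D}
    (h : E.flipped = F.flipped) : E = F := by
  have key : ∀ {E F : AcyclicReorientation D}, E.flipped = F.flipped → ∀ u v,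
      E.toDigraph.Adj u v → F.toDigraph.Adj u v := by
    intro E F h u v huv
    rcases hD.toSimpleGraphInclusive_adj.1 (E.toGraph_adj_iff.2 (.inl huv)) with h' | h'
    · exact adj_of_flipped_subset hD h.ge h' huv
    · exact (h.subset (show (v, u) ∈ E.flipped from ⟨h', huv⟩)).2
  exact ext' fun u v => ⟨key h u v, key h.symm u v⟩

instance [hD : Fact D.IsAcyclic] : PartialOrder (AcyclicReorientation D) where
  le E F := E.flipped ⊆ F.flipped
  le_refl E := subset_rfl
  le_trans _ _ _ := subset_trans
  le_antisymm _ _ h h' := eq_of_flipped_eq hD.1 (h.antisymm h')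

/-- Arcs in which two reorientations `G ≤ H` differ are not reversed below `G`. -/
theorem adj_of_le_of_le [hD : Fact D.IsAcyclic] {E G H : AcyclicReorientation D} (hEG : E ≤ G)
    (hGH : G ≤ H) {u v : V} (hG : G.toDigraph.Adj u v) (hH : H.toDigraph.Adj v u) :
    E.toDigraph.Adj u v := by
  rcases hD.1.toSimpleGraphInclusive_adj.1 (G.toGraph_adj_iff.2 (.inl hG)) with h | h
  · exact adj_of_flipped_subset hD.1 hEG h hG
  · exact absurd hH (H.acyclic.asymm (hGH (a := (v, u)) ⟨h, hG⟩).2)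

/-- Reverse all arcs. -/
def reverse (E : AcyclicReorientation D) : AcyclicReorientation D where
  toDigraph := E.toDigraph.reverse
  acyclic := E.acyclic.reverse
  sameEdges := by
    rw [← E.sameEdges]
    ext u v
    simp [Digraph.toSimpleGraphInclusive, Digraph.reverse, or_comm]

@[simp]
theorem reverse_reverse (E : AcyclicReorientation D) : E.reverse.reverse = E := rfl

theorem reverse_le_reverse [hD : Fact D.IsAcyclic] {E F : AcyclicReorientation D} (h : E ≤ F) :
    F.reverse ≤ E.reverse := by
  rintro ⟨u, v⟩ ⟨huv, h'⟩
  exact ⟨huv, adj_of_flipped_subset hD.1 h huv h'⟩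

theorem reverse_le_iff [Fact D.IsAcyclic] {E F : AcyclicReorientation D} :
    E.reverse ≤ F ↔ F.reverse ≤ E :=
  ⟨fun h => reverse_le_reverse h, fun h => reverse_le_reverse h⟩

/-- Reversing all arcs is an order-reversing involution, so a meet is the reversal of a join of
reversals, and only joins have to be constructed. -/
theorem exists_isGLB [Fact D.IsAcyclic]
    (h : ∀ E F : AcyclicReorientation D, ∃ G, IsLUB {E, F} G) (E F : AcyclicReorientation D) :
    ∃ G, IsGLB {E, F} G := by
  obtain ⟨G, h1, h2⟩ := h E.reverse F.reverse
  refine ⟨G.reverse, ?_, ?_⟩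
  · rintro _ (rfl | rfl)
    · exact reverse_le_iff.1 (h1 (Or.inl rfl))
    · exact reverse_le_iff.1 (h1 (Or.inr rfl))
  · intro K hK
    have := h2 (a := K.reverse) (by
      rintro _ (rfl | rfl)
      · exact reverse_le_reverse (hK (Or.inl rfl))
      · exact reverse_le_reverse (hK (Or.inr rfl)))
    exact reverse_le_reverse this

open Classical in
/-- The lattice structure given by least upper bounds. -/
@[reducible]
noncomputable def latticeOfLUB [Fact D.IsAcyclic]
    (h : ∀ E F : AcyclicReorientation D, ∃ G, IsLUB {E, F} G) :
    Lattice (AcyclicReorientation D) where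
  sup E F := (h E F).choose
  inf E F := (exists_isGLB h E F).choose
  le_sup_left E F := (h E F).choose_spec.1 (Or.inl rfl)
  le_sup_right E F := (h E F).choose_spec.1 (Or.inr rfl)
  sup_le E F G h1 h2 := (h E F).choose_spec.2 (by
    rintro _ (rfl | rfl) <;> assumption)
  inf_le_left E F := (exists_isGLB h E F).choose_spec.1 (Or.inl rfl)
  inf_le_right E F := (exists_isGLB h E F).choose_spec.1 (Or.inr rfl)
  le_inf G E F h1 h2 := (exists_isGLB h E F).choose_spec.2 (by
    rintro _ (rfl | rfl) <;> assumption)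

end General

/-! ### Rails as families of up-sets of the neighbors of the last vertex. -/

section Last

variable {n : ℕ} {D : Digraph (Fin (n + 1))}

/-- The vertices whose edge to the last vertex is reversed. -/
def lastFlip (E : AcyclicReorientation D) : Set (Fin n) :=
  {v | (v.castSucc, Fin.last n) ∈ E.flipped ∨ (Fin.last n, v.castSucc) ∈ E.flipped}

variable (D) in
/-- The neighbors of the last vertex. -/
def lastNbr : Set (Fin n) := {v | D.toSimpleGraphInclusive.Adj v.castSucc (Fin.last n)}

open Classical in
/-- The arcs, reversed if the last vertex is not a sink in `D`. -/
def dirAdj (E : AcyclicReorientation D.deleteLast) (u v : Fin n) : Prop :=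
  if D.IsSink (Fin.last n) then E.toDigraph.Adj u v else E.toDigraph.Adj v u

theorem lastFlip_subset (E : AcyclicReorientation D) : E.lastFlip ⊆ lastNbr D := by
  rintro v (h | h)
  · exact ⟨(Fin.castSucc_lt_last v).ne, .inl h.1⟩
  · exact ⟨(Fin.castSucc_lt_last v).ne, .inr h.1⟩

theorem lastFlip_of_isSink (h : D.IsSink (Fin.last n)) (E : AcyclicReorientation D) :
    E.lastFlip = {v | E.toDigraph.Adj (Fin.last n) v.castSucc} := by
  ext v
  constructor
  · rintro (h' | h')
    · exact h'.2
    · exact absurd h'.1 (h _)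
  · intro h'
    have := (E.toGraph_adj_iff.2 (.inl h')).2
    exact Or.inl ⟨this.resolve_left (h _), h'⟩

theorem lastFlip_of_isSource (h : D.IsSource (Fin.last n)) (E : AcyclicReorientation D) :
    E.lastFlip = {v | E.toDigraph.Adj v.castSucc (Fin.last n)} := by
  ext v
  constructor
  · rintro (h' | h')
    · exact absurd h'.1 (h _)
    · exact h'.2
  · intro h'
    have := (E.toGraph_adj_iff.2 (.inl h')).2
    exact Or.inr ⟨this.resolve_left (h _), h'⟩

theorem le_iff [hD : Fact D.IsAcyclic] {E F : AcyclicReorientation D} :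
    E ≤ F ↔ E.deleteLast ≤ F.deleteLast ∧ E.lastFlip ⊆ F.lastFlip := by
  constructor
  · intro h
    refine ⟨?_, ?_⟩
    · rintro ⟨u, v⟩ h'
      exact h (a := (u.castSucc, v.castSucc)) h'
    · exact fun v => Or.imp (@h _) (@h _)
  · rintro ⟨h1, h2⟩ ⟨u, v⟩ h'
    by_cases hu : u = Fin.last n
    · subst hu
      obtain ⟨v, rfl⟩ := Fin.exists_castSucc_eq.2 (hD.1.ne h'.1).symm
      exact (h2 (Or.inr h')).resolve_left fun h'' => hD.1.asymm h'.1 h''.1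
    · obtain ⟨u, rfl⟩ := Fin.exists_castSucc_eq.2 hu
      by_cases hv : v = Fin.last n
      · subst hv
        exact (h2 (Or.inl h')).resolve_right fun h'' => hD.1.asymm h'.1 h''.1
      · obtain ⟨v, rfl⟩ := Fin.exists_castSucc_eq.2 hv
        exact h1 (a := (u, v)) h'

theorem eq_of_lastFlip [hD : Fact D.IsAcyclic] {E F : AcyclicReorientation D}
    (h : E.deleteLast = F.deleteLast) (h' : E.lastFlip = F.lastFlip) : E = F :=
  le_antisymm (le_iff.2 ⟨h.le, h'.le⟩) (le_iff.2 ⟨h.ge, h'.ge⟩)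

/-- Add the last vertex, with arcs to its neighbors in `O` and from its other neighbors. -/
def extendAdj (E : AcyclicReorientation D.deleteLast) (O : Set (Fin n)) :
    Digraph (Fin (n + 1)) where
  Adj u v := Fin.lastCases (motive := fun _ => Prop)
    (Fin.lastCases (motive := fun _ => Prop) False (fun j => j ∈ O ∧ j ∈ lastNbr D) v)
    (fun i => Fin.lastCases (motive := fun _ => Prop) (i ∉ O ∧ i ∈ lastNbr D)
      (fun j => E.toDigraph.Adj i j) v) u

section

variable (E : AcyclicReorientation D.deleteLast) (O : Set (Fin n)) (i j : Fin n)

@[simp]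
theorem extendAdj_last_last : ¬ (E.extendAdj O).Adj (Fin.last n) (Fin.last n) := by
  simp [extendAdj]

@[simp]
theorem extendAdj_last_castSucc :
    (E.extendAdj O).Adj (Fin.last n) j.castSucc ↔ j ∈ O ∧ j ∈ lastNbr D := by
  simp [extendAdj]

@[simp]
theorem extendAdj_castSucc_last :
    (E.extendAdj O).Adj i.castSucc (Fin.last n) ↔ i ∉ O ∧ i ∈ lastNbr D := by
  simp [extendAdj]

@[simp]
theorem extendAdj_castSucc_castSucc :
    (E.extendAdj O).Adj i.castSucc j.castSucc ↔ E.toDigraph.Adj i j := by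
  simp [extendAdj]

end

theorem adj_of_mem_lastNbr (hs : D.IsSimplicial (Fin.last n))
    (E : AcyclicReorientation D.deleteLast) {i j : Fin n} (hi : i ∈ lastNbr D)
    (hj : j ∈ lastNbr D) (hij : i ≠ j) : E.toDigraph.Adj i j ∨ E.toDigraph.Adj j i := by
  have : D.toSimpleGraphInclusive.Adj i.castSucc j.castSucc :=
    hs (D.toSimpleGraphInclusive.adj_symm hi) (D.toSimpleGraphInclusive.adj_symm hj)
      fun h => hij (Fin.castSucc_injective _ h)
  exact E.toGraph_adj_iff.1 ⟨hij, this.2⟩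

/-- A passage through the last vertex enters from a neighbor `k ∉ O` and leaves to a neighbor `j ∈
O`. These are adjacent by simpliciality, and `j → k` would force `k ∈ O`, so `k → j` is an arc of
`E` that shortcuts the passage. A directed cycle would thus yield one in `E`. -/
theorem extendAdj_isAcyclic (hs : D.IsSimplicial (Fin.last n))
    (E : AcyclicReorientation D.deleteLast) {O : Set (Fin n)}
    (hO : ∀ i ∈ O, i ∈ lastNbr D → ∀ j ∈ lastNbr D, E.toDigraph.Adj i j → j ∈ O) :
    (E.extendAdj O).IsAcyclic := by
  have key : ∀ i y, Relation.TransGen (E.extendAdj O).Adj (Fin.castSucc i) y →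
      (∀ j, y = Fin.castSucc j → Relation.TransGen E.toDigraph.Adj i j) ∧
      (y = Fin.last n → ∃ k, k ∉ O ∧ k ∈ lastNbr D ∧
        Relation.ReflTransGen E.toDigraph.Adj i k) := by
    intro i y hy
    induction hy with
    | @single b h =>
      refine ⟨?_, ?_⟩
      · rintro j rfl
        exact .single (by simpa using h)
      · rintro rfl
        have h := (extendAdj_castSucc_last E O i).1 h
        exact ⟨i, h.1, h.2, .refl⟩
    | @tail b c _ h ih =>
      induction b using Fin.lastCases with
      | last =>
        obtain ⟨k, hk, hkN, hik⟩ := ih.2 rfl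
        refine ⟨?_, ?_⟩
        · rintro j rfl
          have h := (extendAdj_last_castSucc E O j).1 h
          have hkj : k ≠ j := by rintro rfl; exact hk h.1
          exact Relation.TransGen.tail' hik
            ((E.adj_of_mem_lastNbr hs hkN h.2 hkj).resolve_right fun h' =>
              hk (hO j h.1 h.2 k hkN h'))
        · rintro rfl
          simp at h
      | cast b =>
        have hib := ih.1 b rfl
        refine ⟨?_, ?_⟩
        · rintro j rfl
          exact hib.tail (by simpa using h)
        · rintro rfl
          have h := (extendAdj_castSucc_last E O b).1 h
          exact ⟨b, h.1, h.2, hib.to_reflTransGen⟩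
  intro v hv
  induction v using Fin.lastCases with
  | last =>
    obtain ⟨b, hb, hb'⟩ := Relation.TransGen.head'_iff.1 hv
    induction b using Fin.lastCases with
    | last => simp at hb
    | cast j =>
      have hb := (extendAdj_last_castSucc E O j).1 hb
      rcases Relation.reflTransGen_iff_eq_or_transGen.1 hb' with h | h
      · exact absurd h (Fin.castSucc_lt_last j).ne'
      · obtain ⟨k, hk, hkN, hik⟩ := (key j _ h).2 rfl
        have hkj : k ≠ j := by rintro rfl; exact hk hb.1
        have := (E.adj_of_mem_lastNbr hs hkN hb.2 hkj).resolve_right fun h' =>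
              hk (hO j hb.1 hb.2 k hkN h')
        exact E.acyclic j (Relation.TransGen.tail' hik this)
  | cast i => exact E.acyclic i ((key i _ hv).1 i rfl)

/-- Add the last vertex, with arcs to its neighbors in `O` and from its other neighbors. -/
def extend (hs : D.IsSimplicial (Fin.last n))
    (E : AcyclicReorientation D.deleteLast) {O : Set (Fin n)}
    (hO : ∀ i ∈ O, i ∈ lastNbr D → ∀ j ∈ lastNbr D, E.toDigraph.Adj i j → j ∈ O) :
    AcyclicReorientation D where
  toDigraph := E.extendAdj O
  acyclic := E.extendAdj_isAcyclic hs hO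
  sameEdges := by
    ext u v
    rw [(E.extendAdj_isAcyclic hs hO).toSimpleGraphInclusive_adj]
    induction u using Fin.lastCases with
    | last =>
      induction v using Fin.lastCases with
      | last => simp
      | cast j =>
        rw [D.toSimpleGraphInclusive.adj_comm]
        simp only [extendAdj_last_castSucc, extendAdj_castSucc_last, ← or_and_right, em, true_and]
        rfl
    | cast i =>
      induction v using Fin.lastCases with
      | last =>
        simp only [extendAdj_last_castSucc, extendAdj_castSucc_last, ← or_and_right, em', true_and]
        rfl
      | cast j =>
        simp only [extendAdj_castSucc_castSucc]
        rw [← E.toGraph_adj_iff]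
        simp [Digraph.toSimpleGraphInclusive, Digraph.deleteLast]

end Last

end AcyclicReorientation

namespace AcyclicReorientation

section Last

variable {n : ℕ} {D : Digraph (Fin (n + 1))}

@[simp]
theorem extend_deleteLast (hs : D.IsSimplicial (Fin.last n))
    (E : AcyclicReorientation D.deleteLast) {O : Set (Fin n)}
    (hO : ∀ i ∈ O, i ∈ lastNbr D → ∀ j ∈ lastNbr D, E.toDigraph.Adj i j → j ∈ O) :
    (E.extend hs hO).deleteLast = E :=
  ext' fun u v => E.extendAdj_castSucc_castSucc O u v

@[simp]
theorem addSink_deleteLast (E : AcyclicReorientation D.deleteLast) : E.addSink.deleteLast = E := by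
  refine ext' fun u v => ?_
  change (_ ∨ _) ↔ _
  constructor
  · rintro (⟨i, j, hi, hj, h⟩ | ⟨h, _⟩)
    · rwa [Fin.castSucc_injective _ hi, Fin.castSucc_injective _ hj]
    · exact absurd h (Fin.castSucc_lt_last _).ne
  · exact fun h => .inl ⟨u, v, rfl, rfl, h⟩

@[simp]
theorem addSource_deleteLast (E : AcyclicReorientation D.deleteLast) :
    E.addSource.deleteLast = E := by
  refine ext' fun u v => ?_
  change (_ ∨ _) ↔ _
  constructor
  · rintro (⟨i, j, hi, hj, h⟩ | ⟨h, _⟩)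
    · rwa [Fin.castSucc_injective _ hi, Fin.castSucc_injective _ hj]
    · exact absurd h (Fin.castSucc_lt_last _).ne
  · exact fun h => .inl ⟨u, v, rfl, rfl, h⟩

theorem addSink_isSink (E : AcyclicReorientation D.deleteLast) :
    E.addSink.toDigraph.IsSink (Fin.last n) := by
  rintro v (⟨i, j, hi, -, -⟩ | ⟨rfl, h⟩)
  · exact (Fin.castSucc_lt_last i).ne' hi
  · exact h.ne rfl

theorem addSource_isSource (E : AcyclicReorientation D.deleteLast) :
    E.addSource.toDigraph.IsSource (Fin.last n) := by
  rintro v (⟨i, j, -, hi, -⟩ | ⟨rfl, h⟩)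
  · exact (Fin.castSucc_lt_last j).ne' hi
  · exact h.ne rfl

@[simp]
theorem addSame_deleteLast (E : AcyclicReorientation D.deleteLast) : E.addSame.deleteLast = E := by
  rw [addSame]; split_ifs <;> simp

@[simp]
theorem addOpposite_deleteLast (E : AcyclicReorientation D.deleteLast) :
    E.addOpposite.deleteLast = E := by
  rw [addOpposite]; split_ifs <;> simp

variable [hD : Fact D.IsPeoLabeled]

theorem lastFlip_addSame (E : AcyclicReorientation D.deleteLast) : E.addSame.lastFlip = ∅ := by
  ext v
  by_cases h : D.IsSink (Fin.last n)
  · rw [addSame, if_pos h, lastFlip_of_isSink h]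
    exact iff_of_false (E.addSink_isSink _) id
  · rw [addSame, if_neg h, lastFlip_of_isSource (hD.1.1.resolve_right h)]
    exact iff_of_false (E.addSource_isSource _) id

theorem lastFlip_addOpposite (E : AcyclicReorientation D.deleteLast) :
    E.addOpposite.lastFlip = lastNbr D := by
  ext v
  by_cases h : D.IsSink (Fin.last n)
  · rw [addOpposite, if_pos h, lastFlip_of_isSink h, lastNbr, Set.mem_ofPred, Set.mem_ofPred,
      E.addSource.toGraph_adj_iff]
    exact (or_iff_right (E.addSource_isSource _)).symm
  · rw [addOpposite, if_neg h, lastFlip_of_isSource (hD.1.1.resolve_right h), lastNbr,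
      Set.mem_ofPred, Set.mem_ofPred, E.addSink.toGraph_adj_iff]
    exact (or_iff_left (E.addSink_isSink _)).symm

/-- If `n` is a sink of `D`, then `i → j → n → i` would be a directed cycle; the other case is the
same with all arcs turned around. With `exists_of_lastFlip`, the rail over a reorientation is
exactly the family of sets of neighbors that are up-closed under `dirAdj`. -/
theorem mem_lastFlip_of_dirAdj (E : AcyclicReorientation D) {i j : Fin n} (hi : i ∈ E.lastFlip)
    (hj : j ∈ lastNbr D) (hij : E.deleteLast.dirAdj i j) : j ∈ E.lastFlip := by
  by_cases h : D.IsSink (Fin.last n)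
  · rw [dirAdj, if_pos h] at hij
    rw [lastFlip_of_isSink h] at hi ⊢
    refine (E.toGraph_adj_iff.1 hj).resolve_left fun h' => ?_
    exact E.acyclic i.castSucc (.tail (.tail (.single hij) h') hi)
  · rw [dirAdj, if_neg h] at hij
    rw [lastFlip_of_isSource (hD.1.1.resolve_right h)] at hi ⊢
    refine (E.toGraph_adj_iff.1 hj).resolve_right fun h' => ?_
    exact E.acyclic i.castSucc (.tail (.tail (.single hi) h') hij)

theorem exists_of_lastFlip (E : AcyclicReorientation D.deleteLast) {U : Set (Fin n)}
    (hU : U ⊆ lastNbr D) (h : ∀ i ∈ U, ∀ j ∈ lastNbr D, E.dirAdj i j → j ∈ U) :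
    ∃ F : AcyclicReorientation D, F.deleteLast = E ∧ F.lastFlip = U := by
  have hs := hD.1.2.1
  by_cases hD' : D.IsSink (Fin.last n)
  · have h' : ∀ i ∈ U, i ∈ lastNbr D → ∀ j ∈ lastNbr D, E.toDigraph.Adj i j → j ∈ U := by
      intro i hi _ j hj hij
      refine h i hi j hj ?_
      rwa [dirAdj, if_pos hD']
    refine ⟨E.extend hs h', by simp, ?_⟩
    rw [lastFlip_of_isSink hD']
    ext v
    exact (E.extendAdj_last_castSucc U v).trans (and_iff_left_of_imp (@hU v))
  -- If `n` is a source of `D`, the flipped edges are those entering `n`, so the out-neighbors of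
  -- `n` form the complement of `U`.
  · have h' : ∀ i ∈ Uᶜ, i ∈ lastNbr D → ∀ j ∈ lastNbr D, E.toDigraph.Adj i j → j ∈ Uᶜ := by
      intro i hi hi' j hj hij hjU
      refine hi (h j hjU i hi' ?_)
      rwa [dirAdj, if_neg hD']
    refine ⟨E.extend hs h', by simp, ?_⟩
    rw [lastFlip_of_isSource (hD.1.1.resolve_right hD')]
    ext v
    refine (E.extendAdj_castSucc_last Uᶜ v).trans ?_
    rw [Set.mem_compl_iff, not_not]
    exact and_iff_left_of_imp (@hU v)

/-- Together with `dirAdj_trans`: an acyclic orientation of a clique is a linear order. This makes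
the up-sets a chain. -/
theorem dirAdj_or {E : AcyclicReorientation D.deleteLast} {i j : Fin n} (hi : i ∈ lastNbr D)
    (hj : j ∈ lastNbr D) (hij : i ≠ j) : E.dirAdj i j ∨ E.dirAdj j i := by
  have := E.adj_of_mem_lastNbr hD.1.2.1 hi hj hij
  unfold dirAdj
  split_ifs
  · exact this
  · exact this.symm

theorem dirAdj_trans {E : AcyclicReorientation D.deleteLast} {i j k : Fin n} (hi : i ∈ lastNbr D)
    (hk : k ∈ lastNbr D) (hij : E.dirAdj i j) (hjk : E.dirAdj j k) : E.dirAdj i k := by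
  have key : ∀ i j k, i ∈ lastNbr D → k ∈ lastNbr D → E.toDigraph.Adj i j → E.toDigraph.Adj j k →
      E.toDigraph.Adj i k := by
    intro i j k hi hk hij hjk
    have hne : i ≠ k := by rintro rfl; exact E.acyclic.asymm hij hjk
    refine (E.adj_of_mem_lastNbr hD.1.2.1 hi hk hne).resolve_right fun h => ?_
    exact E.acyclic i (.tail (.tail (.single hij) hjk) h)
  unfold dirAdj at *
  split_ifs at *
  · exact key i j k hi hk hij hjk
  · exact key k j i hk hi hjk hij

theorem dirAdj_of_le_of_le {E G H : AcyclicReorientation D.deleteLast} (hEG : E ≤ G)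
    (hGH : G ≤ H) {u v : Fin n} (hG : G.dirAdj u v) (hH : H.dirAdj v u) : E.dirAdj u v := by
  unfold dirAdj at *
  split_ifs at *
  · exact adj_of_le_of_le hEG hGH hG hH
  · exact adj_of_le_of_le hEG hGH hG hH

/-- Over `G`, the smallest admissible flip set is the up-closure `U` of both flip sets. It stays
inside the flip set of any upper bound `H`: if `s` precedes `w` in `G` and in `H`, up-closedness in
`H` applies. If their order changes between `G` and `H`, then it is still that of `G` in `E` and
`F`, and `w` is already flipped in one of these. -/
theorem exists_isLUB_of_deleteLast (E F : AcyclicReorientation D)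
    {G : AcyclicReorientation D.deleteLast} (hG : IsLUB {E.deleteLast, F.deleteLast} G) :
    ∃ K, IsLUB {E, F} K := by
  have hE : E.deleteLast ≤ G := hG.1 (Or.inl rfl)
  have hF : F.deleteLast ≤ G := hG.1 (Or.inr rfl)
  let U : Set (Fin n) := {w | w ∈ lastNbr D ∧ ∃ s, (s ∈ E.lastFlip ∨ s ∈ F.lastFlip) ∧
    (s = w ∨ G.dirAdj s w)}
  have hST : ∀ s, s ∈ E.lastFlip ∨ s ∈ F.lastFlip → s ∈ lastNbr D := fun s hs =>
    hs.elim (@lastFlip_subset _ _ E s) (@lastFlip_subset _ _ F s)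
  obtain ⟨K, hK, hKU⟩ := G.exists_of_lastFlip (U := U) (fun _ h => h.1) (by
    rintro i ⟨hi, s, hs, rfl | hsi⟩ j hj hij
    · exact ⟨hj, s, hs, .inr hij⟩
    · exact ⟨hj, s, hs, .inr (dirAdj_trans (hST s hs) hj hsi hij)⟩)
  refine ⟨K, ?_, ?_⟩
  · rintro _ (rfl | rfl)
    · exact le_iff.2 ⟨hK ▸ hE, hKU ▸ fun s hs => ⟨hST s (.inl hs), s, .inl hs, .inl rfl⟩⟩
    · exact le_iff.2 ⟨hK ▸ hF, hKU ▸ fun s hs => ⟨hST s (.inr hs), s, .inr hs, .inl rfl⟩⟩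
  · intro H hH
    have h1 := le_iff.1 (hH (Or.inl rfl))
    have h2 := le_iff.1 (hH (Or.inr rfl))
    have hGH : G ≤ H.deleteLast := hG.2 (by rintro _ (rfl | rfl); exacts [h1.1, h2.1])
    refine le_iff.2 ⟨hK ▸ hGH, ?_⟩
    rw [hKU]
    rintro w ⟨hw, s, hs, rfl | hsw⟩
    · exact hs.elim (@h1.2 _) (@h2.2 _)
    · by_cases hws : H.deleteLast.dirAdj s w
      · exact H.mem_lastFlip_of_dirAdj (hs.elim (@h1.2 _) (@h2.2 _)) hw hws
      · have hne : s ≠ w := by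
          rintro rfl
          unfold dirAdj at hsw
          split_ifs at hsw <;> exact G.acyclic.irrefl hsw
        have hws := (dirAdj_or (hST s hs) hw hne).resolve_left hws
        rcases hs with hs | hs
        · exact h1.2 (E.mem_lastFlip_of_dirAdj hs hw (dirAdj_of_le_of_le hE hGH hsw hws))
        · exact h2.2 (F.mem_lastFlip_of_dirAdj hs hw (dirAdj_of_le_of_le hF hGH hsw hws))

end Last

theorem exists_isLUB : ∀ {n : ℕ} {D : Digraph (Fin n)} [Fact D.IsPeoLabeled]
    (E F : AcyclicReorientation D), ∃ G, IsLUB {E, F} G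
  | 0, _, _, E, _ => ⟨E, fun _ _ a => a.1.elim0, fun _ _ a => a.1.elim0⟩
  | _ + 1, _, _, E, F =>
    let ⟨_, hG⟩ := exists_isLUB E.deleteLast F.deleteLast
    exists_isLUB_of_deleteLast E F hG

noncomputable instance {n : ℕ} {D : Digraph (Fin n)} [Fact D.IsPeoLabeled] :
    Lattice (AcyclicReorientation D) :=
  latticeOfLUB exists_isLUB

/-- All arcs reversed. -/
def opposite {V : Type*} (D : Digraph V) [hD : Fact D.IsAcyclic] : AcyclicReorientation D :=
  reverse ⟨D, hD.1, rfl⟩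

theorem le_opposite {V : Type*} {D : Digraph V} [hD : Fact D.IsAcyclic]
    (E : AcyclicReorientation D) : E ≤ opposite D :=
  fun _ h => ⟨h.1, h.1⟩

theorem reverse_opposite_le {V : Type*} {D : Digraph V} [hD : Fact D.IsAcyclic]
    (E : AcyclicReorientation D) : (opposite D).reverse ≤ E :=
  fun _ h => absurd h.2 (hD.1.asymm h.1)

section Last

variable {n : ℕ} {D : Digraph (Fin (n + 1))} [hD : Fact D.IsPeoLabeled]

/-- `addSame` is left adjoint and `addOpposite` right adjoint to `deleteLast`, which therefore
preserves meets and joins. The bound `t` is the greatest reorientation without flips at `n`, and `b`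
is the least one with all edges at `n` flipped; here `(opposite _).reverse` is the unreversed
digraph. -/
theorem isRail : IsRail (deleteLast : AcyclicReorientation D → _) addSame addOpposite
    (addSame (opposite _)) (addOpposite (opposite _).reverse) := by
  have h1 : GaloisConnection (addSame : _ → AcyclicReorientation D) deleteLast := fun E F => by
    rw [le_iff, lastFlip_addSame, addSame_deleteLast]
    exact and_iff_left (Set.empty_subset _)
  have h2 : GaloisConnection (deleteLast : AcyclicReorientation D → _) addOpposite := fun E F => by
    rw [le_iff (E := E), lastFlip_addOpposite, addOpposite_deleteLast]
    exact (and_iff_left (lastFlip_subset _)).symm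
  have hsup : ∀ x y : AcyclicReorientation D, (x ⊔ y).deleteLast = x.deleteLast ⊔ y.deleteLast :=
    fun _ _ => h2.l_sup
  have hinf : ∀ x y : AcyclicReorientation D, (x ⊓ y).deleteLast = x.deleteLast ⊓ y.deleteLast :=
    fun _ _ => h1.u_inf
  refine ⟨hsup, hinf, addSame_deleteLast, addOpposite_deleteLast, fun x => ?_, fun x => ?_⟩
  · refine eq_of_lastFlip ?_ ?_
    · rw [addSame_deleteLast, hinf, addSame_deleteLast, inf_eq_left.2 (le_opposite _)]
    · rw [lastFlip_addSame]
      refine (Set.subset_empty_iff.1 ?_).symm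
      exact (le_iff.1 (inf_le_right (a := x) (b := addSame (opposite _)))).2.trans
        (lastFlip_addSame _).subset
  · refine eq_of_lastFlip ?_ ?_
    · rw [addOpposite_deleteLast, hsup, addOpposite_deleteLast,
        sup_eq_left.2 (reverse_opposite_le _)]
    · rw [lastFlip_addOpposite]
      refine (lastFlip_subset _).antisymm' ?_
      exact (lastFlip_addOpposite _).superset.trans
        (le_iff.1 (le_sup_right (a := x) (b := addOpposite (opposite _).reverse))).2

end Last

end AcyclicReorientation

/-! ### Jumps in words, and insertion of a largest value. -/

section Jumps

theorem IsJump.mem {w w' : List ℕ} {a d : ℕ} {δ : JumpDirection} (h : IsJump w w' a δ d) :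
    a ∈ w := by
  cases δ <;> obtain ⟨_, x, s, y, _, _, rfl, rfl⟩ := h <;> simp

theorem isJump_left_iff {w w' : List ℕ} {a d : ℕ} :
    IsJump w w' a .left d ↔ IsJump w' w a .right d := by
  constructor <;> rintro ⟨hd, x, s, y, h1, h2, h3, h4⟩ <;> exact ⟨hd, x, s, y, h1, h2, h4, h3⟩

theorem IsJump.reverse {w w' : List ℕ} {a d : ℕ} (h : IsJump w w' a .right d) :
    IsJump w.reverse w'.reverse a .left d := by
  obtain ⟨hd, x, s, y, h1, h2, rfl, rfl⟩ := h
  exact ⟨hd, y.reverse, s.reverse, x.reverse, by simpa, by simpa, by simp, by simp⟩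

theorem IsJump.reverse' {w w' : List ℕ} {a d : ℕ} (h : IsJump w w' a .left d) :
    IsJump w.reverse w'.reverse a .right d :=
  isJump_left_iff.1 (isJump_left_iff.1 h).reverse

/-- Jumps pass only smaller entries, so a larger value at an end of the word is never moved or
crossed. -/
theorem isJump_cons_iff {m a d : ℕ} (ham : a < m) {v w' : List ℕ} {δ : JumpDirection} :
    IsJump (m :: v) w' a δ d ↔ ∃ v', w' = m :: v' ∧ IsJump v v' a δ d := by
  constructor
  · cases δ with
    | right =>
      rintro ⟨hd, x, s, y, h1, h2, h3, rfl⟩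
      cases x with
      | nil => simp at h3; omega
      | cons b x =>
        simp only [List.cons_append, List.cons.injEq] at h3
        obtain ⟨rfl, rfl⟩ := h3
        exact ⟨_, by simp, hd, x, s, y, h1, h2, rfl, rfl⟩
    | left =>
      rintro ⟨hd, x, s, y, h1, h2, h3, rfl⟩
      cases x with
      | nil =>
        cases s with
        | nil => simp at h1; omega
        | cons b s =>
          simp only [List.nil_append, List.cons_append, List.cons.injEq] at h3
          have := h2 b (by simp)
          omega
      | cons b x =>
        simp only [List.cons_append, List.cons.injEq] at h3
        obtain ⟨rfl, rfl⟩ := h3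
        exact ⟨_, by simp, hd, x, s, y, h1, h2, rfl, rfl⟩
  · rintro ⟨v', rfl, h⟩
    cases δ <;> obtain ⟨hd, x, s, y, h1, h2, rfl, rfl⟩ := h <;>
      exact ⟨hd, m :: x, s, y, h1, h2, by simp, by simp⟩

theorem isJump_concat_iff {m a d : ℕ} (ham : a < m) {v w' : List ℕ} {δ : JumpDirection} :
    IsJump (v ++ [m]) w' a δ d ↔ ∃ v', w' = v' ++ [m] ∧ IsJump v v' a δ d := by
  have key : ∀ {v' : List ℕ}, w'.reverse = m :: v' → w' = v'.reverse ++ [m] := fun h => by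
    rw [← List.reverse_reverse w', h]; simp
  constructor
  · intro h
    cases δ with
    | right =>
      have h := h.reverse
      rw [List.reverse_append, List.reverse_singleton, List.singleton_append,
        isJump_cons_iff ham] at h
      obtain ⟨v', h1, h2⟩ := h
      exact ⟨v'.reverse, key h1, by simpa using h2.reverse'⟩
    | left =>
      have h := h.reverse'
      rw [List.reverse_append, List.reverse_singleton, List.singleton_append,
        isJump_cons_iff ham] at h
      obtain ⟨v', h1, h2⟩ := h
      exact ⟨v'.reverse, key h1, by simpa using h2.reverse⟩
  · rintro ⟨v', rfl, h⟩
    cases δ <;> obtain ⟨hd, x, s, y, h1, h2, rfl, rfl⟩ := h <;>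
      exact ⟨hd, x, s, y ++ [m], h1, h2, by simp, by simp⟩

/-- Insert the value `m` at position `q` of the word `v`. -/
def ins (m : ℕ) (v : List ℕ) (q : ℕ) : List ℕ := v.take q ++ m :: v.drop q

@[simp]
theorem ins_zero (m : ℕ) (v : List ℕ) : ins m v 0 = m :: v := by simp [ins]

@[simp]
theorem ins_length (m : ℕ) (v : List ℕ) : ins m v v.length = v ++ [m] := by simp [ins]

theorem ins_inj {m q q' : ℕ} {v v' : List ℕ} (hv : ∀ b ∈ v, b < m) (hv' : ∀ b ∈ v', b < m)
    (hq : q ≤ v.length) (hq' : q' ≤ v'.length) (h : ins m v q = ins m v' q') :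
    v = v' ∧ q = q' := by
  have hm : m ∉ v := fun h => lt_irrefl _ (hv m h)
  have hm' : m ∉ v' := fun h => lt_irrefl _ (hv' m h)
  obtain ⟨h1, -, h2⟩ := (List.append_cons_inj_of_notMem (fun h => hm (List.mem_of_mem_take h))
    (fun h => hm (List.mem_of_mem_drop h))).1 h
  refine ⟨?_, ?_⟩
  · rw [← List.take_append_drop q v, h1, h2, List.take_append_drop]
  · have := congrArg List.length h1
    simpa [hq, hq'] using this

theorem isJump_ins_right_iff {m q d : ℕ} {v w' : List ℕ} (hv : ∀ b ∈ v, b < m)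
    (hq : q ≤ v.length) :
    IsJump (ins m v q) w' m .right d ↔ 0 < d ∧ q + d ≤ v.length ∧ w' = ins m v (q + d) := by
  have hm : m ∉ v := fun h => lt_irrefl _ (hv m h)
  constructor
  · rintro ⟨hd, x, s, y, h1, h2, h3, rfl⟩
    rw [ins, List.append_assoc, List.cons_append,
      List.append_cons_inj_of_notMem (fun h => hm (List.mem_of_mem_take h))
      (fun h => hm (List.mem_of_mem_drop h))] at h3
    obtain ⟨rfl, -, h3⟩ := h3
    have hlen := congrArg List.length h3
    rw [List.length_drop, List.length_append] at hlen
    have hv' : v = v.take q ++ s ++ y := by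
      rw [List.append_assoc, ← h3, List.take_append_drop]
    have hl : (v.take q ++ s).length = q + d := by simp [hq, h1]
    refine ⟨hd, by omega, ?_⟩
    rw [ins]
    congr 1
    · conv_rhs => rw [hv', ← hl, List.take_left]
    · conv_rhs => rw [hv', ← hl, List.drop_left]
  · rintro ⟨hd, hqd, rfl⟩
    refine ⟨hd, v.take q, (v.drop q).take d, v.drop (q + d), ?_, ?_, ?_, ?_⟩
    · simp; omega
    · exact fun b hb => hv b (List.mem_of_mem_drop (List.mem_of_mem_take hb))
    · rw [ins, List.append_assoc, List.cons_append, ← List.drop_drop, List.take_append_drop]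
    · rw [ins, List.take_add]

theorem isJump_ins_left_iff {m q d : ℕ} {v w' : List ℕ} (hv : ∀ b ∈ v, b < m)
    (hq : q ≤ v.length) :
    IsJump (ins m v q) w' m .left d ↔ 0 < d ∧ d ≤ q ∧ w' = ins m v (q - d) := by
  have hm : m ∉ v := fun h => lt_irrefl _ (hv m h)
  constructor
  · rintro ⟨hd, x, s, y, h1, h2, h3, rfl⟩
    rw [ins, List.append_cons_inj_of_notMem (fun h => hm (List.mem_of_mem_take h))
      (fun h => hm (List.mem_of_mem_drop h))] at h3
    obtain ⟨h3, -, rfl⟩ := h3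
    have hlen := congrArg List.length h3
    rw [List.length_take, List.length_append, min_eq_left hq] at hlen
    have hv' : v = x ++ (s ++ v.drop q) := by
      rw [← List.append_assoc, ← h3, List.take_append_drop]
    have hl : x.length = q - d := by omega
    refine ⟨hd, by omega, ?_⟩
    rw [ins, List.append_assoc, List.cons_append]
    congr 1
    · conv_rhs => rw [hv', ← hl, List.take_left]
    · congr 1
      conv_rhs => rw [hv', ← hl, List.drop_left]
  · rintro ⟨hd, hqd, rfl⟩
    rw [isJump_left_iff, isJump_ins_right_iff hv (by omega)]
    exact ⟨hd, by omega, by congr 1; omega⟩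

end Jumps

/-! ### Greedy steps of the largest value, and of smaller values when it stands at an end. -/

section Greedy

variable {L L' : Set (List ℕ)} {m : ℕ}

/-- Maximality of the jumping value is automatic for `m`, the largest entry. The direction is
unambiguous because everything reachable to the left has been visited. -/
theorem isGreedyStep_right {vis : List (List ℕ)} {v : List ℕ} {q q' : ℕ} (hv : ∀ b ∈ v, b < m)
    (hqq' : q < q') (hq' : q' ≤ v.length) (hL : ins m v q' ∈ L)
    (hmin : ∀ p, q < p → p < q' → ins m v p ∉ L) (hvis : ins m v q' ∉ vis)
    (hprev : ∀ p < q, ins m v p ∈ L → ins m v p ∈ vis) :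
    IsGreedyStep L vis (ins m v q) (ins m v q') := by
  have hq : q ≤ v.length := by omega
  refine ⟨m, .right, ⟨⟨hL, q' - q, ?_, ?_⟩, hvis⟩, ?_, ?_⟩
  · rw [isJump_ins_right_iff hv hq]
    exact ⟨by omega, by omega, by congr 1; omega⟩
  · intro d' hd' w'' hw
    obtain ⟨h1, h2, rfl⟩ := (isJump_ins_right_iff hv hq).1 hw
    exact hmin _ (by omega) (by omega)
  · rintro a δ w'' ⟨⟨-, d, hd, -⟩, -⟩
    have := hd.mem
    simp only [ins, List.mem_append, List.mem_cons] at this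
    rcases this with h | h | h
    · exact (hv _ (List.mem_of_mem_take h)).le
    · exact h.le
    · exact (hv _ (List.mem_of_mem_drop h)).le
  · rintro (_ | _) w'' ⟨⟨h, d, hd, -⟩, h'⟩
    · obtain ⟨h1, h2, rfl⟩ := (isJump_ins_left_iff hv hq).1 hd
      exact absurd (hprev _ (by omega) h) h'
    · rfl

theorem isGreedyStep_left {vis : List (List ℕ)} {v : List ℕ} {q q' : ℕ} (hv : ∀ b ∈ v, b < m)
    (hqq' : q' < q) (hq : q ≤ v.length) (hL : ins m v q' ∈ L)
    (hmin : ∀ p, q' < p → p < q → ins m v p ∉ L) (hvis : ins m v q' ∉ vis)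
    (hprev : ∀ p, q < p → p ≤ v.length → ins m v p ∈ L → ins m v p ∈ vis) :
    IsGreedyStep L vis (ins m v q) (ins m v q') := by
  refine ⟨m, .left, ⟨⟨hL, q - q', ?_, ?_⟩, hvis⟩, ?_, ?_⟩
  · rw [isJump_ins_left_iff hv hq]
    exact ⟨by omega, by omega, by congr 1; omega⟩
  · intro d' hd' w'' hw
    obtain ⟨h1, h2, rfl⟩ := (isJump_ins_left_iff hv hq).1 hw
    exact hmin _ (by omega) (by omega)
  · rintro a δ w'' ⟨⟨-, d, hd, -⟩, -⟩
    have := hd.mem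
    simp only [ins, List.mem_append, List.mem_cons] at this
    rcases this with h | h | h
    · exact (hv _ (List.mem_of_mem_take h)).le
    · exact h.le
    · exact (hv _ (List.mem_of_mem_drop h)).le
  · rintro (_ | _) w'' ⟨⟨h, d, hd, -⟩, h'⟩
    · rfl
    · obtain ⟨h1, h2, rfl⟩ := (isJump_ins_right_iff hv hq).1 hd
      exact absurd (hprev _ (by omega) h2 h) h'

/-- Add `m` at the front (`true`) or at the end (`false`). -/
def addEnd (m : ℕ) : Bool → List ℕ → List ℕ
  | true, v => m :: v
  | false, v => v ++ [m]

theorem addEnd_injective (b : Bool) : Function.Injective (addEnd m b) := by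
  intro v v' h
  cases b <;> simpa [addEnd] using h

theorem addEnd_eq_ins (b : Bool) (v : List ℕ) :
    addEnd m b v = ins m v (if b then 0 else v.length) := by
  cases b <;> simp [addEnd]

theorem isJump_addEnd_iff {a d : ℕ} (ham : a < m) {b : Bool} {v w' : List ℕ} {δ : JumpDirection} :
    IsJump (addEnd m b v) w' a δ d ↔ ∃ v', w' = addEnd m b v' ∧ IsJump v v' a δ d := by
  cases b
  · exact isJump_concat_iff ham
  · exact isJump_cons_iff ham

/-- By `hm` all admissible positions of `m` are already visited, so `m` cannot be the jumping value;
smaller values do not interact with `m` at the end of the word. -/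
theorem isCandidate_addEnd_iff {b : Bool} {vis vis' : List (List ℕ)} {v : List ℕ}
    (hv : ∀ b ∈ v, b < m) (hL : ∀ u, addEnd m b u ∈ L ↔ u ∈ L')
    (hvis : ∀ u ∈ L', addEnd m b u ∈ vis ↔ u ∈ vis')
    (hm : ∀ p ≤ v.length, ins m v p ∈ L → ins m v p ∈ vis) {w' : List ℕ} {a : ℕ}
    {δ : JumpDirection} :
    IsCandidate L vis (addEnd m b v) w' a δ ↔
      ∃ v', w' = addEnd m b v' ∧ IsCandidate L' vis' v v' a δ := by
  rcases lt_or_ge a m with ham | ham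
  · constructor
    · rintro ⟨⟨h1, d, h2, h3⟩, h4⟩
      obtain ⟨v', rfl, h5⟩ := (isJump_addEnd_iff ham).1 h2
      rw [hL] at h1
      refine ⟨v', rfl, ⟨h1, d, h5, fun d' hd' w'' hw hwL => ?_⟩, fun h => h4 ((hvis v' h1).2 h)⟩
      exact h3 d' hd' _ ((isJump_addEnd_iff ham).2 ⟨w'', rfl, hw⟩) ((hL _).2 hwL)
    · rintro ⟨v', rfl, ⟨h1, d, h2, h3⟩, h4⟩
      refine ⟨⟨(hL _).2 h1, d, (isJump_addEnd_iff ham).2 ⟨v', rfl, h2⟩,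
        fun d' hd' w'' hw hwL => ?_⟩, fun h => h4 ((hvis v' h1).1 h)⟩
      obtain ⟨v'', rfl, hw'⟩ := (isJump_addEnd_iff ham).1 hw
      exact h3 d' hd' _ hw' ((hL _).1 hwL)
  · refine iff_of_false ?_ ?_
    · rintro ⟨⟨h1, d, h2, -⟩, h4⟩
      have hq : (if b then 0 else v.length) ≤ v.length := by split_ifs <;> omega
      rw [addEnd_eq_ins] at h2
      have ha := h2.mem
      obtain rfl : a = m := by
        simp only [ins, List.mem_append, List.mem_cons] at ha
        rcases ha with h | h | h
        · have := hv _ (List.mem_of_mem_take h)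
          omega
        · exact h
        · have := hv _ (List.mem_of_mem_drop h)
          omega
      cases δ with
      | right =>
        obtain ⟨-, h, rfl⟩ := (isJump_ins_right_iff hv hq).1 h2
        exact h4 (hm _ h h1)
      | left =>
        obtain ⟨-, h, rfl⟩ := (isJump_ins_left_iff hv hq).1 h2
        exact h4 (hm _ (by omega) h1)
    · rintro ⟨v', -, ⟨-, d, h2, -⟩, -⟩
      have := hv _ h2.mem
      omega

theorem isGreedyStep_addEnd_iff {b : Bool} {vis vis' : List (List ℕ)} {v : List ℕ}
    (hv : ∀ b ∈ v, b < m) (hL : ∀ u, addEnd m b u ∈ L ↔ u ∈ L')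
    (hvis : ∀ u ∈ L', addEnd m b u ∈ vis ↔ u ∈ vis')
    (hm : ∀ p ≤ v.length, ins m v p ∈ L → ins m v p ∈ vis) {w' : List ℕ} :
    IsGreedyStep L vis (addEnd m b v) w' ↔
      ∃ v', w' = addEnd m b v' ∧ IsGreedyStep L' vis' v v' := by
  have key := fun w' a δ => isCandidate_addEnd_iff hv hL hvis hm (w' := w') (a := a) (δ := δ)
  constructor
  · rintro ⟨a, δ, h1, h2, h3⟩
    obtain ⟨v', rfl, h4⟩ := (key _ _ _).1 h1
    exact ⟨v', rfl, a, δ, h4, fun a' δ' v'' h => h2 a' δ' _ ((key _ _ _).2 ⟨v'', rfl, h⟩),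
      fun δ' v'' h => h3 δ' _ ((key _ _ _).2 ⟨v'', rfl, h⟩)⟩
  · rintro ⟨v', rfl, a, δ, h1, h2, h3⟩
    refine ⟨a, δ, (key _ _ _).2 ⟨v', rfl, h1⟩, fun a' δ' v'' h => ?_, fun δ' v'' h => ?_⟩
    · obtain ⟨v'', rfl, h'⟩ := (key _ _ _).1 h
      exact h2 _ _ _ h'
    · obtain ⟨v'', rfl, h'⟩ := (key _ _ _).1 h
      exact h3 _ _ h'

end Greedy

/-! ### Lifting a run to the zigzag through the rails. -/

section Run

variable {L L' : Set (List ℕ)} {m : ℕ}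

/-- After having visited `vis`, the greedy algorithm can visit the words of the second list, in
this order, and then gets stuck. -/
def IsRun (L : Set (List ℕ)) : List (List ℕ) → List (List ℕ) → Prop
  | _, [] => True
  | vis, [w] => ∀ w', ¬ IsGreedyStep L (vis ++ [w]) w w'
  | vis, w :: w' :: t => IsGreedyStep L (vis ++ [w]) w w' ∧ IsRun L (vis ++ [w]) (w' :: t)

theorem isRun_append {r : List (List ℕ)} : ∀ {vis : List (List ℕ)} {e : List ℕ}
    {todo : List (List ℕ)},
    (∀ l₁ a b l₂, r ++ [e] = l₁ ++ a :: b :: l₂ → IsGreedyStep L (vis ++ l₁ ++ [a]) a b) →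
    IsRun L (vis ++ r) (e :: todo) → IsRun L vis (r ++ e :: todo) := by
  induction r with
  | nil =>
    intro vis e todo _ h
    simpa using h
  | cons a r ih =>
    intro vis e todo h1 h2
    have h3 : IsRun L (vis ++ [a]) (r ++ e :: todo) := by
      refine ih (fun l₁ b c l₂ h => ?_) (by simpa using h2)
      have := h1 (a :: l₁) b c l₂ (by simp [h])
      simpa using this
    cases r with
    | nil =>
      have := h1 [] a e [] (by simp)
      exact ⟨by simpa using this, h3⟩
    | cons b r =>
      have := h1 [] a b (r ++ [e]) (by simp)
      exact ⟨by simpa using this, h3⟩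

open Classical in
/-- The positions at which `m` can be inserted into `v` to obtain an element of `L`. -/
noncomputable def positions (L : Set (List ℕ)) (m : ℕ) (v : List ℕ) : List ℕ :=
  (List.range (v.length + 1)).filter fun q => ins m v q ∈ L

theorem mem_positions {v : List ℕ} {q : ℕ} :
    q ∈ positions L m v ↔ q ≤ v.length ∧ ins m v q ∈ L := by
  simp [positions]

theorem positions_pairwise (v : List ℕ) : (positions L m v).Pairwise (· < ·) :=
  List.pairwise_lt_range.filter _

theorem positions_eq_concat {v : List ℕ} (h : v ++ [m] ∈ L) :
    ∃ r, positions L m v = r ++ [v.length] :=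
  ⟨_, by
    rw [positions, List.range_succ, List.filter_append,
      List.filter_cons_of_pos (by simpa using h), List.filter_nil]⟩

theorem positions_eq_cons {v : List ℕ} (h : m :: v ∈ L) :
    ∃ r, positions L m v = 0 :: r :=
  ⟨_, by rw [positions, List.range_succ_eq_map, List.filter_cons_of_pos (by simpa using h)]⟩

/-- The elements of `L` obtained from `v` by inserting `m`, by decreasing (`true`) or increasing
(`false`) position. -/
noncomputable def rail (L : Set (List ℕ)) (m : ℕ) : Bool → List ℕ → List (List ℕ)
  | true, v => ((positions L m v).map (ins m v)).reverse
  | false, v => (positions L m v).map (ins m v)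

theorem mem_rail {b : Bool} {v w : List ℕ} :
    w ∈ rail L m b v ↔ ∃ q ≤ v.length, w = ins m v q ∧ w ∈ L := by
  have : w ∈ (positions L m v).map (ins m v) ↔ ∃ q ≤ v.length, w = ins m v q ∧ w ∈ L := by
    simp only [List.mem_map, mem_positions]
    constructor
    · rintro ⟨q, ⟨h1, h2⟩, rfl⟩
      exact ⟨q, h1, rfl, h2⟩
    · rintro ⟨q, h1, rfl, h2⟩
      exact ⟨q, ⟨h1, h2⟩, rfl⟩
  cases b
  · exact this
  · rw [← this]; exact List.mem_reverse

theorem rail_nodup {b : Bool} {v : List ℕ} (hv : ∀ b ∈ v, b < m) : (rail L m b v).Nodup := by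
  have : ((positions L m v).map (ins m v)).Nodup := by
    refine List.Nodup.map_on ?_ (positions_pairwise v).nodup
    intro x hx y hy h
    exact (ins_inj hv hv (mem_positions.1 hx).1 (mem_positions.1 hy).1 h).2
  cases b
  · exact this
  · exact List.nodup_reverse.2 this

theorem rail_eq_concat {b : Bool} {v : List ℕ} (h : ∀ b, addEnd m b v ∈ L) :
    ∃ r, rail L m b v = r ++ [addEnd m b v] := by
  cases b
  · obtain ⟨r, hr⟩ := positions_eq_concat (h false)
    exact ⟨r.map (ins m v), by simp [rail, hr, addEnd]⟩
  · obtain ⟨r, hr⟩ := positions_eq_cons (h true)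
    exact ⟨(r.map (ins m v)).reverse, by simp [rail, hr, addEnd]⟩

theorem rail_eq_cons {b : Bool} {v : List ℕ} (h : ∀ b, addEnd m b v ∈ L) :
    ∃ r, rail L m b v = addEnd m (!b) v :: r := by
  cases b
  · obtain ⟨r, hr⟩ := positions_eq_cons (h true)
    exact ⟨r.map (ins m v), by simp [rail, hr, addEnd]⟩
  · obtain ⟨r, hr⟩ := positions_eq_concat (h false)
    exact ⟨(r.map (ins m v)).reverse, by simp [rail, hr, addEnd]⟩

/-- Consecutive elements of a rail. -/
theorem rail_split {b : Bool} {v x y : List ℕ} {l₁ l₂ : List (List ℕ)}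
    (h : rail L m b v = l₁ ++ x :: y :: l₂) :
    ∃ q q', x = ins m v q ∧ y = ins m v q' ∧ q ≤ v.length ∧ q' ≤ v.length ∧
      ins m v q ∈ L ∧ ins m v q' ∈ L ∧
      (b = false → q < q' ∧ (∀ p, q < p → p < q' → ins m v p ∉ L) ∧
        ∀ p < q, ins m v p ∈ L → ins m v p ∈ l₁) ∧
      (b = true → q' < q ∧ (∀ p, q' < p → p < q → ins m v p ∉ L) ∧
        ∀ p, q < p → p ≤ v.length → ins m v p ∈ L → ins m v p ∈ l₁) := by
  have key : ∀ {l₁ l₂ : List (List ℕ)} {x y : List ℕ},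
      (positions L m v).map (ins m v) = l₁ ++ x :: y :: l₂ →
      ∃ q q', x = ins m v q ∧ y = ins m v q' ∧ q < q' ∧ q' ≤ v.length ∧
      ins m v q ∈ L ∧ ins m v q' ∈ L ∧ (∀ p, q < p → p < q' → ins m v p ∉ L) ∧
      (∀ p < q, ins m v p ∈ L → ins m v p ∈ l₁) ∧
      ∀ p, q' < p → p ≤ v.length → ins m v p ∈ L → ins m v p ∈ l₂ := by
    intro l₁ l₂ x y h
    obtain ⟨a, c, hac, rfl, hc⟩ := List.map_eq_append_iff.1 h
    obtain ⟨q, c', rfl, rfl, hc'⟩ := List.map_eq_cons_iff.1 hc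
    obtain ⟨q', c'', rfl, rfl, rfl⟩ := List.map_eq_cons_iff.1 hc'
    have hp := positions_pairwise (L := L) (m := m) v
    rw [hac, List.pairwise_append, List.pairwise_cons, List.pairwise_cons] at hp
    obtain ⟨-, ⟨h1, h2, -⟩, h3⟩ := hp
    have hm : ∀ p, p ∈ a ++ q :: q' :: c'' ↔ p ≤ v.length ∧ ins m v p ∈ L := fun p => by
      rw [← hac, mem_positions]
    have hqq' := h1 q' (by simp)
    have hq := (hm q).1 (by simp)
    have hq' := (hm q').1 (by simp)
    have h3' := fun p (hp : p ∈ a) => h3 p hp q (by simp)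
    refine ⟨q, q', rfl, rfl, hqq', hq'.1, hq.2, hq'.2, ?_, ?_, ?_⟩
    · intro p hp1 hp2 hp
      have := (hm p).2 ⟨by omega, hp⟩
      simp only [List.mem_append, List.mem_cons] at this
      rcases this with h | h | h | h
      · have := h3' p h; omega
      · omega
      · omega
      · have := h2 p h; omega
    · intro p hp1 hp
      have := (hm p).2 ⟨by omega, hp⟩
      simp only [List.mem_append, List.mem_cons] at this
      rcases this with h | h | h | h
      · exact List.mem_map_of_mem h
      · omega
      · omega
      · have := h2 p h; omega
    · intro p hp1 hp2 hp
      have := (hm p).2 ⟨by omega, hp⟩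
      simp only [List.mem_append, List.mem_cons] at this
      rcases this with h | h | h | h
      · have := h3' p h; omega
      · omega
      · omega
      · exact List.mem_map_of_mem h
  cases b with
  | false =>
    obtain ⟨q, q', h1, h2, h3, h4, h5, h6, h7, h8, -⟩ := key h
    exact ⟨q, q', h1, h2, by omega, h4, h5, h6, fun _ => ⟨h3, h7, h8⟩, fun h => by simp at h⟩
  | true =>
    have h := congrArg List.reverse h
    rw [rail, List.reverse_reverse] at h
    have h : (positions L m v).map (ins m v) = l₂.reverse ++ y :: x :: l₁.reverse := by
      simpa using h
    obtain ⟨q, q', h1, h2, h3, h4, h5, h6, h7, -, h8⟩ := key h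
    exact ⟨q', q, h2, h1, h4, by omega, h6, h5, fun h => by simp at h,
      fun _ => ⟨h3, h7, fun p hp1 hp2 hp => List.mem_reverse.1 (h8 p hp1 hp2 hp)⟩⟩

/-- The concatenation of the rails of the words of a list, in alternating directions. -/
noncomputable def zigzag (L : Set (List ℕ)) (m : ℕ) : Bool → List (List ℕ) → List (List ℕ)
  | _, [] => []
  | b, v :: t => rail L m b v ++ zigzag L m (!b) t

theorem mem_zigzag : ∀ {t : List (List ℕ)} {b : Bool} {w : List ℕ},
    w ∈ zigzag L m b t ↔ ∃ v ∈ t, ∃ q ≤ v.length, w = ins m v q ∧ w ∈ L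
  | [], _, _ => by simp [zigzag]
  | v :: t, b, w => by
    rw [zigzag, List.mem_append, mem_rail, mem_zigzag]
    simp

theorem zigzag_nodup : ∀ {t : List (List ℕ)} {b : Bool}, (∀ v ∈ t, ∀ b ∈ v, b < m) → t.Nodup →
    (zigzag L m b t).Nodup
  | [], _, _, _ => List.nodup_nil
  | v :: t, b, hm, ht => by
    rw [zigzag, List.nodup_append]
    rw [List.nodup_cons] at ht
    refine ⟨rail_nodup (hm v (by simp)),
      zigzag_nodup (fun u hu => hm u (List.mem_cons_of_mem _ hu)) ht.2, ?_⟩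
    rintro w hw w' hw' rfl
    obtain ⟨q, hq, rfl, -⟩ := mem_rail.1 hw
    obtain ⟨u, hu, q', hq', h, -⟩ := mem_zigzag.1 hw'
    obtain rfl := (ins_inj (hm v (by simp)) (hm u (List.mem_cons_of_mem _ hu)) hq hq' h).1
    exact ht.1 hu

theorem zigzag_eq_cons {b : Bool} {v : List ℕ} {t : List (List ℕ)} (h : ∀ b, addEnd m b v ∈ L) :
    ∃ r, zigzag L m b (v :: t) = addEnd m (!b) v :: r := by
  obtain ⟨r, hr⟩ := rail_eq_cons (b := b) h
  exact ⟨_, by rw [zigzag, hr, List.cons_append]⟩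

/-- The rail with flag `b` finishes with `m` at the end of the word given by `b`, and the next rail,
with flag `!b`, starts with `m` at the same end. The transition between rails is thus a move from
`v` to `v'` with `m` in place. -/
theorem zigzag_isChain {S S' : List ℕ → List ℕ → Prop} : ∀ {t : List (List ℕ)} {b : Bool},
    (∀ v ∈ t, ∀ b, addEnd m b v ∈ L) →
    (∀ v ∈ t, ∀ v' ∈ t, S' v v' → ∀ b, S (addEnd m b v) (addEnd m b v')) →
    (∀ v ∈ t, ∀ q q', q < q' → q' ≤ v.length → ins m v q ∈ L → ins m v q' ∈ L →
      (∀ p, q < p → p < q' → ins m v p ∉ L) →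
      S (ins m v q) (ins m v q') ∧ S (ins m v q') (ins m v q)) →
    t.IsChain S' → (zigzag L m b t).IsChain S
  | [], _, _, _, _, _ => List.isChain_nil
  | v :: t, b, h1, h2, h3, h4 => by
    rw [zigzag, List.isChain_append]
    refine ⟨?_, zigzag_isChain (fun u hu => h1 u (List.mem_cons_of_mem _ hu))
      (fun u hu u' hu' => h2 u (List.mem_cons_of_mem _ hu) u' (List.mem_cons_of_mem _ hu'))
      (fun u hu => h3 u (List.mem_cons_of_mem _ hu)) h4.tail, ?_⟩
    · rw [List.isChain_iff_forall_rel_of_append_cons_cons]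
      intro x y l₁ l₂ h
      obtain ⟨q, q', rfl, rfl, hq, hq', hqL, hqL', hf, ht⟩ := rail_split h
      cases b with
      | false =>
        obtain ⟨hlt, hmin, -⟩ := hf rfl
        exact (h3 v (by simp) q q' hlt hq' hqL hqL' hmin).1
      | true =>
        obtain ⟨hlt, hmin, -⟩ := ht rfl
        exact (h3 v (by simp) q' q hlt hq hqL' hqL hmin).2
    · obtain ⟨r, hr⟩ := rail_eq_concat (b := b) (h1 v (by simp))
      cases t with
      | nil => simp [zigzag]
      | cons v' t =>
        obtain ⟨r', hr'⟩ := zigzag_eq_cons (b := !b) (t := t) (h1 v' (by simp))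
        rw [hr, hr']
        have := h2 v (by simp) v' (by simp) (List.isChain_cons_cons.1 h4).1 b
        simpa using this

/-- Inside a rail the positions of `m` already swept are visited and the next admissible one is not,
so each step is forced. -/
theorem isRun_rail {b : Bool} {v e : List ℕ} {r todo vis : List (List ℕ)}
    (hv : ∀ b ∈ v, b < m) (hr : rail L m b v = r ++ [e])
    (hvis : ∀ q ≤ v.length, ins m v q ∉ vis) (h : IsRun L (vis ++ r) (e :: todo)) :
    IsRun L vis (rail L m b v ++ todo) := by
  rw [hr, List.append_assoc, List.singleton_append]
  refine isRun_append (fun l₁ x y l₂ h' => ?_) h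
  have hnd := rail_nodup (L := L) (b := b) hv
  rw [hr, h'] at hnd
  obtain ⟨q, q', rfl, rfl, hq, hq', hqL, hqL', hf, ht⟩ := rail_split (hr.trans h')
  have hy : ins m v q' ∉ vis ++ l₁ ++ [ins m v q] := by
    rw [List.append_assoc, List.mem_append]
    rintro (hy | hy)
    · exact hvis q' hq' hy
    · rw [List.append_cons] at hnd
      exact (List.nodup_append.1 hnd).2.2 _ hy _ (by simp) rfl
  cases b with
  | false =>
    obtain ⟨hlt, hmin, hprev⟩ := hf rfl
    refine isGreedyStep_right hv hlt hq' hqL' hmin hy fun p hp hpL => ?_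
    simp [hprev p hp hpL]
  | true =>
    obtain ⟨hlt, hmin, hprev⟩ := ht rfl
    refine isGreedyStep_left hv hlt hq hqL' hmin hy fun p hp hp' hpL => ?_
    simp [hprev p hp hp' hpL]

theorem mem_append_rail {vis vis' : List (List ℕ)} {v : List ℕ} {b : Bool}
    (hvis : ∀ w, w ∈ vis ↔ w ∈ L ∧ ∃ u ∈ vis', ∃ q ≤ u.length, w = ins m u q) (w : List ℕ) :
    w ∈ vis ++ rail L m b v ↔ w ∈ L ∧ ∃ u ∈ vis' ++ [v], ∃ q ≤ u.length, w = ins m u q := by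
  rw [List.mem_append, hvis, mem_rail]
  constructor
  · rintro (⟨h, u, hu, q, hq, rfl⟩ | ⟨q, hq, rfl, h⟩)
    · exact ⟨h, u, by simp [hu], q, hq, rfl⟩
    · exact ⟨h, v, by simp, q, hq, rfl⟩
  · rintro ⟨h, u, hu, q, hq, rfl⟩
    rw [List.mem_append, List.mem_singleton] at hu
    rcases hu with hu | rfl
    · exact .inl ⟨h, u, hu, q, hq, rfl⟩
    · exact .inr ⟨q, hq, rfl, h⟩

theorem addEnd_eq_ins_iff {b : Bool} {u v : List ℕ} {q : ℕ} (hu : ∀ b ∈ u, b < m)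
    (hv : ∀ b ∈ v, b < m) (hq : q ≤ v.length) (h : addEnd m b u = ins m v q) : u = v := by
  rw [addEnd_eq_ins] at h
  exact (ins_inj hu hv (by split_ifs <;> omega) hq h).1

theorem isGreedyStep_append_rail_iff {vis vis' : List (List ℕ)} {v : List ℕ} {b : Bool}
    (hw : ∀ v ∈ L', ∀ b ∈ v, b < m) (hL : ∀ b v, addEnd m b v ∈ L ↔ v ∈ L') (hv : v ∈ L')
    (hvis' : ∀ u ∈ vis', u ∈ L')
    (hvis : ∀ w, w ∈ vis ↔ w ∈ L ∧ ∃ u ∈ vis', ∃ q ≤ u.length, w = ins m u q) {w' : List ℕ} :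
    IsGreedyStep L (vis ++ rail L m b v) (addEnd m b v) w' ↔
      ∃ v', w' = addEnd m b v' ∧ IsGreedyStep L' (vis' ++ [v]) v v' := by
  refine isGreedyStep_addEnd_iff (hw v hv) (hL b) (fun u hu => ?_) (fun p hp h => ?_)
  · rw [mem_append_rail hvis]
    constructor
    · rintro ⟨-, u', hu', q, hq, h⟩
      have hu'' : u' ∈ L' := by
        rw [List.mem_append, List.mem_singleton] at hu'
        rcases hu' with hu' | rfl
        · exact hvis' _ hu'
        · exact hv
      rwa [addEnd_eq_ins_iff (hw u hu) (hw u' hu'') hq h]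
    · intro hu'
      exact ⟨(hL b u).2 hu, u, hu', _, by split_ifs <;> omega, addEnd_eq_ins b u⟩
  · exact List.mem_append_right _ (mem_rail.2 ⟨p, hp, rfl, h⟩)

/-- Invariant: on entering the rail of `v`, the visited words are exactly the words of `L` on the
rails of `vis'`. At the far end of the rail, `m` has nowhere left to go, and the greedy steps
correspond to those of the run on `L'` at `v`. This also transfers the fact that the algorithm gets
stuck after the last rail. -/
theorem zigzag_isRun (hw : ∀ v ∈ L', ∀ b ∈ v, b < m) (hL : ∀ b v, addEnd m b v ∈ L ↔ v ∈ L') :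
    ∀ {t : List (List ℕ)} {v : List ℕ} {b : Bool} {vis vis' : List (List ℕ)},
    IsRun L' vis' (v :: t) → (∀ u ∈ v :: t, u ∈ L') → (∀ u ∈ vis', u ∈ L') →
    (∀ w, w ∈ vis ↔ w ∈ L ∧ ∃ u ∈ vis', ∃ q ≤ u.length, w = ins m u q) →
    (vis' ++ v :: t).Nodup → IsRun L vis (zigzag L m b (v :: t)) := by
  intro t
  induction t with
  | nil =>
    intro v b vis vis' hrun ht hvis' hvis hnd
    have hv := ht v (by simp)
    obtain ⟨r, hr⟩ := rail_eq_concat (m := m) (b := b) fun b => (hL b v).2 hv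
    refine isRun_rail (hw v hv) hr (fun q hq h => ?_) fun w' h => ?_
    · obtain ⟨-, u, hu, q', hq', h⟩ := (hvis _).1 h
      obtain rfl := (ins_inj (hw v hv) (hw u (hvis' u hu)) hq hq' h).1
      exact (List.nodup_append.1 hnd).2.2 _ hu _ (by simp) rfl
    · rw [List.append_assoc, ← hr, isGreedyStep_append_rail_iff hw hL hv hvis' hvis] at h
      obtain ⟨v', -, h⟩ := h
      exact hrun v' h
  | cons v' t ih =>
    intro v b vis vis' hrun ht hvis' hvis hnd
    have hv := ht v (by simp)
    obtain ⟨r, hr⟩ := rail_eq_concat (m := m) (b := b) fun b => (hL b v).2 hv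
    obtain ⟨r', hr'⟩ := zigzag_eq_cons (L := L) (m := m) (b := !b) (t := t)
      fun b => (hL b v').2 (ht v' (by simp))
    rw [zigzag]
    refine isRun_rail (hw v hv) hr (fun q hq h => ?_) ?_
    · obtain ⟨-, u, hu, q', hq', h⟩ := (hvis _).1 h
      obtain rfl := (ins_inj (hw v hv) (hw u (hvis' u hu)) hq hq' h).1
      exact (List.nodup_append.1 hnd).2.2 _ hu _ (by simp) rfl
    · have := ih (b := !b) (vis := vis ++ rail L m b v) (vis' := vis' ++ [v]) hrun.2
        (fun u hu => ht u (List.mem_cons_of_mem _ hu)) (fun u hu => by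
          rw [List.mem_append, List.mem_singleton] at hu
          rcases hu with hu | rfl
          · exact hvis' u hu
          · exact hv)
        (mem_append_rail hvis) (by simpa using hnd)
      rw [hr', Bool.not_not] at this ⊢
      refine ⟨?_, by rwa [List.append_assoc, ← hr]⟩
      rw [List.append_assoc, ← hr, isGreedyStep_append_rail_iff hw hL hv hvis' hvis]
      exact ⟨v', rfl, hrun.1⟩

/-- If `m` is added at the end of every word, then the greedy algorithm runs as before. -/
theorem isRun_map_addEnd (hw : ∀ v ∈ L', ∀ b ∈ v, b < m) :
    ∀ {t vis : List (List ℕ)}, (∀ u ∈ t, u ∈ L') → IsRun L' vis t →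
    IsRun (addEnd m false '' L') (vis.map (addEnd m false)) (t.map (addEnd m false)) := by
  have key : ∀ {v : List ℕ} {vis : List (List ℕ)} {w' : List ℕ}, v ∈ L' →
      (IsGreedyStep (addEnd m false '' L') (vis.map (addEnd m false) ++ [addEnd m false v])
        (addEnd m false v) w' ↔
      ∃ v', w' = addEnd m false v' ∧ IsGreedyStep L' (vis ++ [v]) v v') := by
    intro v vis w' hv
    have e : vis.map (addEnd m false) ++ [addEnd m false v] =
      (vis ++ [v]).map (addEnd m false) := by simp
    rw [e]
    refine isGreedyStep_addEnd_iff (hw v hv)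
      (fun u => (addEnd_injective false).mem_set_image)
      (fun u _ => List.mem_map_of_injective (addEnd_injective false)) ?_
    -- The only word of the image that arises from `v` by inserting `m` is the current one, so `m`
    -- never jumps.
    rintro p hp ⟨u, hu, h⟩
    obtain rfl := addEnd_eq_ins_iff (hw u hu) (hw v hv) hp h
    rw [← h]
    exact List.mem_map_of_mem (by simp)
  intro t
  induction t with
  | nil => intros; trivial
  | cons v t ih =>
    intro vis ht hrun
    have hv := ht v (by simp)
    cases t with
    | nil =>
      intro w' h
      obtain ⟨v', -, h⟩ := (key hv).1 h
      exact hrun v' h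
    | cons v' t =>
      refine ⟨(key hv).2 ⟨v', rfl, hrun.1⟩, ?_⟩
      have := ih (vis := vis ++ [v]) (fun u hu => ht u (List.mem_cons_of_mem _ hu)) hrun.2
      simpa using this

end Run

/-! ### Determinism of the algorithm. -/

section Output

variable {L : Set (List ℕ)}

theorem IsJump.eq_of_nodup {w w₁ w₂ : List ℕ} {a d : ℕ} {δ : JumpDirection} (hw : w.Nodup)
    (h₁ : IsJump w w₁ a δ d) (h₂ : IsJump w w₂ a δ d) : w₁ = w₂ := by
  have key : ∀ {x y x' y' : List ℕ}, w = x ++ a :: y → x ++ a :: y = x' ++ a :: y' →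
      x = x' ∧ y = y' := by
    intro x y x' y' h h'
    rw [h, List.nodup_middle, List.nodup_cons, List.mem_append, not_or] at hw
    obtain ⟨h1, -, h2⟩ := (List.append_cons_inj_of_notMem hw.1.1 hw.1.2).1 h'
    exact ⟨h1, h2⟩
  cases δ with
  | right =>
    obtain ⟨_, x, s, y, hs, -, h, rfl⟩ := h₁
    obtain ⟨_, x', s', y', hs', -, h', rfl⟩ := h₂
    rw [List.append_assoc, List.cons_append] at h h'
    obtain ⟨rfl, h''⟩ := key h (h ▸ h')
    obtain ⟨rfl, rfl⟩ := List.append_inj h'' (hs.trans hs'.symm)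
    rfl
  | left =>
    obtain ⟨_, x, s, y, hs, -, h, rfl⟩ := h₁
    obtain ⟨_, x', s', y', hs', -, h', rfl⟩ := h₂
    obtain ⟨h'', rfl⟩ := key h (h ▸ h')
    obtain ⟨rfl, rfl⟩ := List.append_inj' h'' (hs.trans hs'.symm)
    rfl

/-- Value and direction agree by maximality and unambiguity, the step counts by minimality, and in a
word without repetition these data determine the jump. -/
theorem IsGreedyStep.eq_of_nodup {vis : List (List ℕ)} {w w₁ w₂ : List ℕ} (hw : w.Nodup)
    (h₁ : IsGreedyStep L vis w w₁) (h₂ : IsGreedyStep L vis w w₂) : w₁ = w₂ := by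
  obtain ⟨a, δ, hc, hmax, huniq⟩ := h₁
  obtain ⟨a', δ', hc', hmax', -⟩ := h₂
  obtain rfl : a' = a := le_antisymm (hmax _ _ _ hc') (hmax' _ _ _ hc)
  obtain rfl := huniq _ _ hc'
  obtain ⟨⟨hL, d, hd, hmin⟩, -⟩ := hc
  obtain ⟨⟨hL', d', hd', hmin'⟩, -⟩ := hc'
  obtain rfl : d = d' := by
    by_contra hne
    rcases lt_or_gt_of_ne hne with h | h
    · exact hmin' _ h _ hd hL
    · exact hmin _ h _ hd' hL'
  exact hd.eq_of_nodup hw hd'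

theorem IsRun.visits {w₀ : List ℕ} : ∀ {t vis : List (List ℕ)} {w : List ℕ},
    IsRun L vis (w :: t) → AlgorithmJ.Visits L w₀ (vis ++ [w]) →
    AlgorithmJ.Visits L w₀ (vis ++ w :: t) ∧
      ∀ l u w', vis ++ w :: t = l ++ [u] → ¬ IsGreedyStep L (vis ++ w :: t) u w'
  | [], vis, w, h, hv => by
    refine ⟨hv, fun l u w' h' => ?_⟩
    obtain ⟨-, h'⟩ := List.append_inj' h' rfl
    obtain rfl := List.singleton_inj.1 h'
    exact h w'
  | w' :: t, vis, w, h, hv => by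
    have := IsRun.visits (t := t) h.2 (by simpa using hv.step h.1)
    simpa using this

theorem IsRun.algorithmJ {w₀ : List ℕ} {t : List (List ℕ)} (h : IsRun L [] (w₀ :: t))
    (h₀ : w₀ ∈ L) : AlgorithmJ L w₀ (w₀ :: t) := by
  have := h.visits (w₀ := w₀) .init
  exact ⟨h₀, this.1, this.2⟩

theorem IsRun.split : ∀ {l vis : List (List ℕ)} {w : List ℕ} {r : List (List ℕ)},
    IsRun L vis (l ++ w :: r) → IsRun L (vis ++ l) (w :: r)
  | [], _, _, _, h => by simpa using h
  | [a], vis, w, r, h => h.2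
  | a :: b :: l, vis, w, r, h => by
    have := IsRun.split (l := b :: l) (vis := vis ++ [a]) h.2
    simpa using this

theorem IsRun.prefix_of_visits {w₀ : List ℕ} {t l : List (List ℕ)} (h : IsRun L [] (w₀ :: t))
    (hn : ∀ w ∈ w₀ :: t, w.Nodup) (hl : AlgorithmJ.Visits L w₀ l) : l <+: w₀ :: t := by
  induction hl with
  | init => exact ⟨t, rfl⟩
  | @step l w w' _ hs ih =>
    obtain ⟨r, hr⟩ := ih
    rw [List.append_assoc, List.singleton_append] at hr
    rw [← hr] at h
    have h' := h.split
    cases r with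
    | nil => exact absurd hs (h' w')
    | cons u r =>
      obtain rfl := hs.eq_of_nodup (hn w (by rw [← hr]; simp)) h'.1
      exact ⟨r, by rw [← hr]; simp⟩

/-- By determinism any execution is an initial segment of the run, and a proper initial segment
still admits a greedy step, so it is not terminated. -/
theorem IsRun.algorithmJ_unique {w₀ : List ℕ} {t out : List (List ℕ)}
    (h : IsRun L [] (w₀ :: t)) (hn : ∀ w ∈ w₀ :: t, w.Nodup) (hout : AlgorithmJ L w₀ out) :
    out = w₀ :: t := by
  obtain ⟨-, hv, hs⟩ := hout
  obtain ⟨r, hr⟩ := h.prefix_of_visits hn hv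
  have : ∃ l w, out = l ++ [w] := by
    cases hv with
    | init => exact ⟨[], _, rfl⟩
    | @step l w w' _ _ => exact ⟨l ++ [w], w', by simp⟩
  obtain ⟨l, w, rfl⟩ := this
  cases r with
  | nil => rw [← hr, List.append_nil]
  | cons w' r =>
    rw [← hr, List.append_assoc, List.singleton_append] at h
    exact absurd h.split.1 (hs l w w' rfl)

end Output

/-! ### Hamilton paths from lists of vertices. -/

section HamiltonPath

variable {V : Type*} {G : SimpleGraph V}

theorem SimpleGraph.exists_walk_of_isChain : ∀ {l : List V} {a : V}, (a :: l).IsChain G.Adj →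
    ∃ (b : V) (p : G.Walk a b), p.support = a :: l
  | [], a, _ => ⟨a, .nil, rfl⟩
  | c :: l, a, h => by
    rw [List.isChain_cons_cons] at h
    obtain ⟨b, p, hp⟩ := exists_walk_of_isChain h.2
    exact ⟨b, .cons h.1 p, by rw [Walk.support_cons, hp]⟩

theorem SimpleGraph.isHamiltonPath_of_isChain {l : List V} (hne : l ≠ []) (hn : l.Nodup)
    (hl : ∀ v, v ∈ l) (h : l.IsChain G.Adj) : G.IsHamiltonPath l := by
  cases l with
  | nil => exact absurd rfl hne
  | cons a l =>
    obtain ⟨b, p, hp⟩ := exists_walk_of_isChain h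
    refine ⟨a, b, p, fun v => ?_, hp⟩
    classical
    rw [hp]
    exact List.count_eq_one_of_mem hn (hl v)

end HamiltonPath

/-! ### The encoding by topological orders. -/

theorem ins_eq_imp {m q q' : ℕ} {v v' : List ℕ} (hv' : ∀ b ∈ v', b < m)
    (h : ins m v q = ins m v' q') : v = v' := by
  have hm' : m ∉ v' := fun h => lt_irrefl _ (hv' m h)
  obtain ⟨h1, -, h2⟩ := (List.append_cons_inj_of_notMem (fun h => hm' (List.mem_of_mem_take h))
    (fun h => hm' (List.mem_of_mem_drop h))).1 h.symm
  rw [← List.take_append_drop q v, ← h1, ← h2, List.take_append_drop]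

theorem ins_perm {m q : ℕ} {v : List ℕ} (hv : v.Perm (List.range m)) :
    (ins m v q).Perm (List.range (m + 1)) := by
  rw [ins, List.range_succ]
  refine List.perm_middle.trans ?_
  rw [List.take_append_drop]
  exact (hv.cons m).trans (List.perm_append_singleton _ _).symm

theorem insertIdx_eq_ins {m : ℕ} : ∀ {v : List ℕ} {q : ℕ}, q ≤ v.length →
    v.insertIdx q m = ins m v q
  | _, 0, _ => by simp
  | [], q + 1, h => by simp at h
  | a :: v, q + 1, h => by
    rw [List.insertIdx_succ_cons, insertIdx_eq_ins (by simpa using h)]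
    simp [ins]

namespace Digraph

/-- The word `w` lists the vertices in an order in which all arcs go forward. -/
def IsTopological {n : ℕ} (E : Digraph (Fin n)) (w : List ℕ) : Prop :=
  w.Pairwise fun a b => ∀ i j : Fin n, i.val = a → j.val = b → ¬ E.Adj j i

/-- Take an out-neighbor of `u` that no other out-neighbor of `u` reaches. A path from `u` to it
through a further vertex would start with such an out-neighbor. -/
theorem exists_transitiveReduction_adj {V : Type*} [Finite V] {E : Digraph V} (hE : E.IsAcyclic)
    {u v : V} (h : E.Adj u v) : ∃ w, E.transitiveReduction.Adj u w := by
  have hirr : Std.Irrefl (Relation.TransGen E.Adj) := ⟨hE⟩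
  have hwf := Finite.wellFounded_of_trans_of_irrefl (Relation.TransGen E.Adj)
  obtain ⟨w, hw, hmin⟩ := hwf.has_min {x | E.Adj u x} ⟨v, h⟩
  refine ⟨w, hw, ?_⟩
  rintro ⟨x, h1, h2⟩
  obtain ⟨y, hy, hyx⟩ := Relation.TransGen.head'_iff.1 h1
  exact hmin y hy (Relation.TransGen.trans_right hyx h2)

end Digraph

namespace AcyclicReorientation

section

variable {n : ℕ} {D : Digraph (Fin (n + 1))}

theorem encode_addSink (E : AcyclicReorientation D.deleteLast) :
    E.addSink.encode = addEnd n false E.encode := by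
  rw [encode, Digraph.encode, if_pos E.addSink_isSink]
  change E.addSink.deleteLast.encode ++ [n] = _
  rw [addSink_deleteLast]; rfl

/-- An isolated vertex is both a source and a sink and is encoded as a sink, at the end of the word;
hence the hypothesis `hN`. -/
theorem encode_addSource (hN : (lastNbr D).Nonempty) (E : AcyclicReorientation D.deleteLast) :
    E.addSource.encode = addEnd n true E.encode := by
  obtain ⟨i, hi⟩ := hN
  have h : ¬ E.addSource.toDigraph.IsSink (Fin.last n) := by
    intro h
    rcases E.addSource.toGraph_adj_iff.1 hi with h' | h'
    · exact E.addSource_isSource _ h'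
    · exact h _ h'
  rw [encode, Digraph.encode, if_neg h, if_pos E.addSource_isSource]
  change n :: E.addSource.deleteLast.encode = _
  rw [addSource_deleteLast]; rfl

end

/-- The value `n` is placed so that the word remains a topological order. In the mixed case let `j`
be the out-neighbor found in the transitive reduction. An out-neighbor `i` to the left of `j` would
satisfy `i → j`, making `n → j` transitive; an in-neighbor `i` to the right of `j` would give the
cycle `j → i → n → j`. The hypotheses concern only the shorter word, as needed for the induction
that follows. -/
theorem exists_encode_eq {n : ℕ} {D : Digraph (Fin (n + 1))} [hD : Fact D.IsPeoLabeled]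
    (E : AcyclicReorientation D) (hp : E.deleteLast.encode.Perm (List.range n))
    (ht : E.deleteLast.toDigraph.IsTopological E.deleteLast.encode) :
    ∃ q ≤ n, E.encode = ins n E.deleteLast.encode q ∧
      (∀ i : Fin n, i.val ∈ E.deleteLast.encode.take q →
        ¬ E.toDigraph.Adj (Fin.last n) i.castSucc) ∧
      ∀ i : Fin n, i.val ∈ E.deleteLast.encode.drop q →
        ¬ E.toDigraph.Adj i.castSucc (Fin.last n) := by
  have hl : E.deleteLast.encode.length = n := by simpa using hp.length_eq
  by_cases h1 : E.toDigraph.IsSink (Fin.last n)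
  · refine ⟨n, le_rfl, ?_, fun i _ => h1 _, fun i hi => ?_⟩
    · rw [encode, Digraph.encode, if_pos h1, ins, List.take_of_length_le hl.le,
        List.drop_of_length_le hl.le]
      rfl
    · rw [List.drop_eq_nil_of_le hl.le] at hi
      simp at hi
  by_cases h2 : E.toDigraph.IsSource (Fin.last n)
  · refine ⟨0, Nat.zero_le _, ?_, fun i hi => ?_, fun i _ => h2 _⟩
    · rw [encode, Digraph.encode, if_neg h1, if_pos h2, ins_zero]; rfl
    · simp at hi
  classical
  set w := E.deleteLast.encode with hw
  set P : ℕ → Bool := fun a => decide (∃ j : Fin n, j.val = a ∧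
        E.toDigraph.transitiveReduction.Adj (Fin.last n) j.castSucc) with hP
  -- `findIdx` defaults to the length of the list if nothing matches, so a match has to be
  -- exhibited.
  have hex : w.findIdx P < w.length := by
    rw [List.findIdx_lt_length]
    obtain ⟨v, hv⟩ := not_forall_not.1 h1
    obtain ⟨j, hj⟩ := Digraph.exists_transitiveReduction_adj E.acyclic hv
    obtain ⟨j, rfl⟩ := Fin.exists_castSucc_eq.2 (E.acyclic.ne hj.1).symm
    refine ⟨j, hp.mem_iff.2 (by simp), ?_⟩
    rw [hP]
    exact decide_eq_true ⟨j, rfl, hj⟩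
  obtain ⟨j, hj, hjr⟩ := of_decide_eq_true (List.findIdx_getElem (w := hex))
  set q := w.findIdx P with hq
  refine ⟨q, by omega, ?_, ?_⟩
  · rw [encode, Digraph.encode, if_neg h1, if_neg h2, ← insertIdx_eq_ins hex.le]; rfl
  have hs := hD.1.2.1
  have hjN : j ∈ lastNbr D := E.toGraph_adj_iff.2 (.inr hjr.1)
  have hsplit : w = w.take q ++ j.val :: w.drop (q + 1) := by
    rw [hj, List.getElem_cons_drop, List.take_append_drop]
  have ht' := ht
  rw [Digraph.IsTopological, hsplit, List.pairwise_append, List.pairwise_cons] at ht'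
  obtain ⟨-, ⟨hafter, -⟩, hbefore⟩ := ht'
  refine ⟨fun i hi hout => ?_, fun i hi hin => ?_⟩
  · have hiN : i ∈ lastNbr D := E.toGraph_adj_iff.2 (.inr hout)
    have hji := hbefore _ hi _ List.mem_cons_self i j rfl rfl
    have hne : i ≠ j := by
      rintro rfl
      have hnd : w.Nodup := hp.nodup_iff.2 List.nodup_range
      rw [hsplit] at hnd
      exact (List.nodup_append.1 hnd).2.2 _ hi _ List.mem_cons_self rfl
    have hij := (E.deleteLast.adj_of_mem_lastNbr hs hiN hjN hne).resolve_right hji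
    exact hjr.2 ⟨i.castSucc, .single hout, .single hij⟩
  · have hiN : i ∈ lastNbr D := E.toGraph_adj_iff.2 (.inl hin)
    rw [List.drop_eq_getElem_cons hex, List.mem_cons, ← hj] at hi
    rcases hi with hi | hi
    · obtain rfl : i = j := Fin.ext hi
      exact E.acyclic.asymm hin hjr.1
    · have hij := hafter _ hi j i rfl rfl
      have hne : i ≠ j := by
        rintro rfl
        exact E.acyclic.asymm hin hjr.1
      have hji := (E.deleteLast.adj_of_mem_lastNbr hs hiN hjN hne).resolve_left hij
      exact E.acyclic j.castSucc (.tail (.tail (.single hji) hin) hjr.1)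

theorem encode_perm_and_isTopological : ∀ {n : ℕ} {D : Digraph (Fin n)} [Fact D.IsPeoLabeled]
    (E : AcyclicReorientation D),
    E.encode.Perm (List.range n) ∧ E.toDigraph.IsTopological E.encode
  | 0, _, _, E => by
    have : E.encode = [] := rfl
    rw [this]
    exact ⟨.refl _, List.Pairwise.nil⟩
  | n + 1, D, hD, E => by
    obtain ⟨hp, ht⟩ := encode_perm_and_isTopological E.deleteLast
    obtain ⟨q, hq, he, h1, h2⟩ := E.exists_encode_eq hp ht
    rw [he]
    refine ⟨ins_perm hp, ?_⟩
    have hlt : ∀ a ∈ E.deleteLast.encode, a < n := fun a ha => by simpa using hp.mem_iff.1 ha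
    have ht' : E.deleteLast.encode.Pairwise
        fun a b => ∀ i j : Fin (n + 1), i.val = a → j.val = b → ¬ E.toDigraph.Adj j i := by
      refine ht.imp_of_mem fun {a b} ha hb h i j hi hj => ?_
      have hi' : i.val < n := hi ▸ hlt a ha
      have hj' : j.val < n := hj ▸ hlt b hb
      exact h ⟨i, hi'⟩ ⟨j, hj'⟩ hi hj
    rw [← List.take_append_drop q E.deleteLast.encode, List.pairwise_append] at ht'
    rw [Digraph.IsTopological, ins, List.pairwise_append, List.pairwise_cons]
    refine ⟨ht'.1, ⟨fun b hb i j hi hj => ?_, ht'.2.1⟩, fun a ha b hb => ?_⟩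
    · have hj' : j.val < n := hj ▸ hlt b (List.mem_of_mem_drop hb)
      obtain rfl : i = Fin.last n := Fin.ext hi
      exact h2 ⟨j, hj'⟩ (by rwa [← hj] at hb)
    · rw [List.mem_cons] at hb
      rcases hb with rfl | hb
      · intro i j hi hj
        have hi' : i.val < b := hi ▸ hlt a (List.mem_of_mem_take ha)
        obtain rfl : j = Fin.last b := Fin.ext hj
        exact h1 ⟨i, hi'⟩ (by rwa [← hi] at ha)
      · exact ht'.2.2 a ha b hb

section

variable {n : ℕ} {D : Digraph (Fin n)} [Fact D.IsPeoLabeled]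

theorem encode_perm (E : AcyclicReorientation D) : E.encode.Perm (List.range n) :=
  E.encode_perm_and_isTopological.1

theorem encode_isTopological (E : AcyclicReorientation D) : E.toDigraph.IsTopological E.encode :=
  E.encode_perm_and_isTopological.2

theorem encode_lt (E : AcyclicReorientation D) : ∀ a ∈ E.encode, a < n :=
  fun a ha => by simpa using E.encode_perm.mem_iff.1 ha

theorem encode_length (E : AcyclicReorientation D) : E.encode.length = n := by
  simpa using E.encode_perm.length_eq

theorem encode_nodup (E : AcyclicReorientation D) : E.encode.Nodup :=
  E.encode_perm.nodup_iff.2 List.nodup_range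

/-- The direction of each edge can be read off from the word, since all arcs go forward in it. -/
theorem encode_injective : Function.Injective (encode : AcyclicReorientation D → List ℕ) := by
  intro E F h
  have hE := E.encode_isTopological
  have hF := F.encode_isTopological
  rw [← h] at hF
  have key : ∀ u v : Fin n, u.val ≠ v.val → ¬ (E.toDigraph.Adj u v ∧ F.toDigraph.Adj v u) := by
    have hS := (hE.and hF).imp (S := fun a b => ∀ i j : Fin n, i.val = a → j.val = b →
      ¬ (E.toDigraph.Adj i j ∧ F.toDigraph.Adj j i) ∧
      ¬ (E.toDigraph.Adj j i ∧ F.toDigraph.Adj i j)) (fun h i j hi hj =>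
        ⟨fun h' => h.2 i j hi hj h'.2, fun h' => h.1 i j hi hj h'.1⟩)
    have hsymm : Std.Symm (fun a b => ∀ i j : Fin n, i.val = a → j.val = b →
      ¬ (E.toDigraph.Adj i j ∧ F.toDigraph.Adj j i) ∧
      ¬ (E.toDigraph.Adj j i ∧ F.toDigraph.Adj i j)) := ⟨fun a b h i j hi hj => (h j i hj hi).symm⟩
    intro u v huv
    exact (hS.forall (E.encode_perm.mem_iff.2 (by simp)) (E.encode_perm.mem_iff.2 (by simp)) huv
      u v rfl rfl).1
  refine ext' fun u v => ⟨fun huv => ?_, fun huv => ?_⟩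
  · refine (F.toGraph_adj_iff.1 (E.toGraph_adj_iff.2 (.inl huv))).resolve_right fun hvu => ?_
    exact key u v (fun h' => E.acyclic.ne huv (Fin.ext h')) ⟨huv, hvu⟩
  · refine (E.toGraph_adj_iff.1 (F.toGraph_adj_iff.2 (.inl huv))).resolve_right fun hvu => ?_
    exact key v u (fun h' => E.acyclic.ne hvu (Fin.ext h')) ⟨hvu, huv⟩

end

section Last

variable {n : ℕ} {D : Digraph (Fin (n + 1))} [hD : Fact D.IsPeoLabeled]

theorem exists_encode_eq_ins (E : AcyclicReorientation D) :
    ∃ q ≤ n, E.encode = ins n E.deleteLast.encode q ∧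
      (∀ i : Fin n, i.val ∈ E.deleteLast.encode.take q →
        ¬ E.toDigraph.Adj (Fin.last n) i.castSucc) ∧
      ∀ i : Fin n, i.val ∈ E.deleteLast.encode.drop q →
        ¬ E.toDigraph.Adj i.castSucc (Fin.last n) :=
  E.exists_encode_eq E.deleteLast.encode_perm E.deleteLast.encode_isTopological

theorem deleteLast_encode_of_eq_ins {E : AcyclicReorientation D} {v : List ℕ} {q : ℕ}
    (h : E.encode = ins n v q) : E.deleteLast.encode = v := by
  obtain ⟨q', -, he, -⟩ := E.exists_encode_eq_ins
  exact (ins_eq_imp E.deleteLast.encode_lt (h.symm.trans he)).symm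

/-- On a rail, the order is given by the position of the last vertex. -/
theorem le_of_position_le {E F : AcyclicReorientation D} (hEF : E.deleteLast = F.deleteLast)
    {q q' : ℕ} (hqq' : q ≤ q') (hq' : q' ≤ n) (hE : E.encode = ins n E.deleteLast.encode q)
    (hF : F.encode = ins n F.deleteLast.encode q') :
    (D.IsSink (Fin.last n) → F ≤ E) ∧ (¬ D.IsSink (Fin.last n) → E ≤ F) := by
  obtain ⟨p, hp, he, -, h2⟩ := E.exists_encode_eq_ins
  obtain ⟨p', hp', he', h1', -⟩ := F.exists_encode_eq_ins
  have hl := E.deleteLast.encode_length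
  have hl' := F.deleteLast.encode_length
  obtain rfl := (ins_inj E.deleteLast.encode_lt E.deleteLast.encode_lt (by omega) (by omega)
    (hE.symm.trans he)).2
  obtain rfl := (ins_inj F.deleteLast.encode_lt F.deleteLast.encode_lt (by omega) (by omega)
    (hF.symm.trans he')).2
  -- An out-neighbor of `n` in `F` stands right of position `q'`, hence right of `q`, where `E` has
  -- no in-neighbors of `n`.
  have key : ∀ i : Fin n, F.toDigraph.Adj (Fin.last n) i.castSucc →
      ¬ E.toDigraph.Adj i.castSucc (Fin.last n) := by
    intro i hi
    refine h2 i ?_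
    have hmem : i.val ∈ F.deleteLast.encode := F.deleteLast.encode_perm.mem_iff.2 (by simp)
    rw [← List.take_append_drop q' F.deleteLast.encode, List.mem_append] at hmem
    have := hmem.resolve_left fun h => h1' i h hi
    rw [← hEF] at this
    rw [show q' = q + (q' - q) by omega, ← List.drop_drop] at this
    exact List.mem_of_mem_drop this
  refine ⟨fun hs => le_iff.2 ⟨hEF.ge, ?_⟩, fun hs => le_iff.2 ⟨hEF.le, ?_⟩⟩
  · rw [lastFlip_of_isSink hs, lastFlip_of_isSink hs]
    intro i hi
    exact (E.toGraph_adj_iff.1 (F.toGraph_adj_iff.2 (.inl hi))).resolve_right (key i hi)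
  · rw [lastFlip_of_isSource (hD.1.1.resolve_right hs),
      lastFlip_of_isSource (hD.1.1.resolve_right hs)]
    intro i hi
    exact (F.toGraph_adj_iff.1 (E.toGraph_adj_iff.2 (.inl hi))).resolve_right
      fun h => key i h hi

end Last

end AcyclicReorientation

/-! ### Existence of representatives. -/

theorem restrictRel_equivalence {n : ℕ} {D : Digraph (Fin (n + 1))}
    {r : AcyclicReorientation D → AcyclicReorientation D → Prop} (hr : Equivalence r) :
    Equivalence (restrictRel r) :=
  ⟨fun _ => hr.refl _, fun h => hr.symm h, fun h h' => hr.trans h h'⟩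

open Classical in
theorem exists_isRepresentativeSelection : ∀ {n : ℕ} {D : Digraph (Fin n)}
    {r : AcyclicReorientation D → AcyclicReorientation D → Prop}, Equivalence r →
    ∃ R, IsRepresentativeSelection r R
  | 0, _, _, _ => ⟨Set.univ, rfl⟩
  | n + 1, D, r, hr => by
    obtain ⟨R', hR'⟩ := exists_isRepresentativeSelection (restrictRel_equivalence hr)
    by_cases hA : ∀ E : AcyclicReorientation D.deleteLast, ¬ r E.addSame E.addOpposite
    · let s : Setoid (AcyclicReorientation D) :=
        { r := fun F G => F.deleteLast = G.deleteLast ∧ r F G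
          iseqv := ⟨fun F => ⟨rfl, hr.refl F⟩, fun h => ⟨h.1.symm, hr.symm h.2⟩,
            fun h h' => ⟨h.1.trans h'.1, hr.trans h.2 h'.2⟩⟩ }
      -- A canonical representative of each class on a rail that prefers the two extremes. By `hA`
      -- these lie in different classes, so both are chosen.
      let canon : AcyclicReorientation D → AcyclicReorientation D := fun F =>
        if r F F.deleteLast.addSame then F.deleteLast.addSame
        else if r F F.deleteLast.addOpposite then F.deleteLast.addOpposite
        else (Quotient.mk s F).out
      have h1 : ∀ F, s.r (canon F) F := by
        intro F
        by_cases h : r F F.deleteLast.addSame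
        · simp only [canon, if_pos h]
          exact ⟨by simp, hr.symm h⟩
        by_cases h' : r F F.deleteLast.addOpposite
        · simp only [canon, if_neg h, if_pos h']
          exact ⟨by simp, hr.symm h'⟩
        · simp only [canon, if_neg h, if_neg h']
          exact Quotient.mk_out (s := s) F
      have h2 : ∀ F G, s.r F G → canon F = canon G := by
        rintro F G ⟨h, h'⟩
        have e : ∀ K, r F K ↔ r G K := fun K =>
          ⟨fun h => hr.trans (hr.symm h') h, fun h => hr.trans h' h⟩
        have e' : Quotient.mk s F = Quotient.mk s G := Quotient.sound ⟨h, h'⟩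
        simp only [canon, h, e, e']
      refine ⟨{F | F.deleteLast ∈ R' ∧ canon F = F}, R', hR', .inl ⟨hA, fun F hF => hF.1,
        fun E hE => ⟨⟨by simpa, ?_⟩, by simpa, ?_⟩, fun F hF => ?_⟩⟩
      · simp [canon, hr.refl]
      · have : ¬ r E.addOpposite E.addSame := fun h => hA E (hr.symm h)
        simp [canon, this, hr.refl]
      · refine ⟨canon F, ⟨⟨(h1 F).1 ▸ hF, h2 _ _ (h1 F)⟩, h1 F⟩, ?_⟩
        rintro G ⟨⟨-, hG⟩, hGF⟩
        rw [← hG, h2 _ _ hGF]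
    · exact ⟨_, R', hR', .inr ⟨hA, rfl⟩⟩

/-! ### The induction step: representatives, covers and runs. -/

namespace AcyclicReorientation

theorem addSame_eq_addSink_or {n : ℕ} {D : Digraph (Fin (n + 1))} (E : AcyclicReorientation D.deleteLast) :
    (E.addSame = E.addSink ∧ E.addOpposite = E.addSource) ∨
      (E.addSame = E.addSource ∧ E.addOpposite = E.addSink) := by
  unfold addSame addOpposite
  split_ifs <;> simp

section Step

variable {n : ℕ} {D : Digraph (Fin (n + 1))} [hD : Fact D.IsPeoLabeled]
  (c : LatticeCon (AcyclicReorientation D))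

theorem coverGraph_addEnds_adj {E F : AcyclicReorientation D.deleteLast}
    (h : (isRail.restrict c).coverGraph.Adj ((isRail.restrict c).classOf E)
      ((isRail.restrict c).classOf F)) :
    c.coverGraph.Adj (c.classOf E.addSink) (c.classOf F.addSink) ∧
      c.coverGraph.Adj (c.classOf E.addSource) (c.classOf F.addSource) := by
  have h1 := isRail.coverGraph_lo_adj c h
  have h2 := isRail.coverGraph_hi_adj c h
  unfold addSame at h1
  unfold addOpposite at h2
  split_ifs at h1 h2
  · exact ⟨h1, h2⟩
  · exact ⟨h2, h1⟩

theorem rel_of_between {α : Type*} [Lattice α] (c : LatticeCon α) {x y z : α} (hxy : x ≤ y)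
    (hyz : y ≤ z) (h : c.r z x) : c.r y x := by
  have := c.inf h (c.refl y)
  rwa [inf_eq_right.2 hyz, inf_eq_left.2 hxy] at this

theorem rel_of_between' {α : Type*} [Lattice α] (c : LatticeCon α) {x y z : α} (hxy : x ≤ y)
    (hyz : y ≤ z) (h : c.r x z) : c.r y z :=
  c.trans (rel_of_between c hxy hyz (c.symm h)) h

/-- Consecutive representatives on a rail. -/
theorem coverGraph_rail_adj {R : Set (AcyclicReorientation D)}
    {E F : AcyclicReorientation D} (hR : ∀ z : AcyclicReorientation D,
      z.deleteLast = E.deleteLast → ∃ G ∈ R, G.deleteLast = z.deleteLast ∧ c.r G z)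
    (hne : ¬ c.r E F)
    (hEF : E.deleteLast = F.deleteLast) {q q' : ℕ} (hqq' : q < q') (hq' : q' ≤ n)
    (hE : E.encode = ins n E.deleteLast.encode q)
    (hF : F.encode = ins n F.deleteLast.encode q')
    (hmin : ∀ p, q < p → p < q' → ins n E.deleteLast.encode p ∉ encode '' R) :
    c.coverGraph.Adj (c.classOf E) (c.classOf F) := by
  -- Each `z` on the rail is related to a representative `G`, which by `hmin` is not strictly
  -- between `E` and `F`. It lies beyond `E` or beyond `F`, so convexity of classes puts every `z`
  -- between them in the class of `E` or of `F`. Whether the order rises or falls with the position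
  -- depends on the role of the last vertex in `D`.
  have hpos : ∀ z : AcyclicReorientation D, z.deleteLast = E.deleteLast →
      ∃ G, c.r G z ∧ ((D.IsSink (Fin.last n) → E ≤ G) ∧ (¬ D.IsSink (Fin.last n) → G ≤ E) ∨
        (D.IsSink (Fin.last n) → G ≤ F) ∧ (¬ D.IsSink (Fin.last n) → F ≤ G)) := by
    intro z hz
    obtain ⟨G, hGR, hGz, hr⟩ := hR z hz
    obtain ⟨p, hp, he, -⟩ := G.exists_encode_eq_ins
    refine ⟨G, hr, ?_⟩
    rcases le_or_gt p q with h | h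
    · exact .inl (le_of_position_le (hGz.trans hz) h (by omega) he hE)
    rcases le_or_gt q' p with h' | h'
    · exact .inr (le_of_position_le (hEF.symm.trans (hGz.trans hz).symm) h' hp hF he)
    · exact absurd ⟨G, hGR, he.trans (by rw [hGz, hz])⟩ (hmin p h h')
  obtain ⟨hs, hs'⟩ := le_of_position_le hEF hqq'.le hq' hE hF
  rw [LatticeCon.coverGraph_adj]
  by_cases h : D.IsSink (Fin.last n)
  · right
    refine c.classOf_covBy (hs h) (fun h => hne (c.symm h)) fun z hz hz' => ?_
    have : z.deleteLast = E.deleteLast :=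
      le_antisymm (isRail.map_mono hz') (hEF.trans_le (isRail.map_mono hz))
    obtain ⟨G, hG, h' | h'⟩ := hpos z this
    · exact .inr (c.symm (rel_of_between c hz' (h'.1 h) hG))
    · exact .inl (c.symm (rel_of_between' c (h'.1 h) hz hG))
  · left
    refine c.classOf_covBy (hs' h) hne fun z hz hz' => ?_
    have : z.deleteLast = E.deleteLast :=
      le_antisymm ((isRail.map_mono hz').trans_eq hEF.symm) (isRail.map_mono hz)
    obtain ⟨G, hG, h' | h'⟩ := hpos z this
    · exact .inl (c.symm (rel_of_between' c (h'.2 h) hz hG))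
    · exact .inr (c.symm (rel_of_between c hz' (h'.2 h) hG))

/-- Existence: the class of `x` is followed to the rail over the representative of its restriction.
Uniqueness: related elements have related restrictions, so two representatives in one class lie over
the same element of `R'`, on one rail. -/
theorem existsUnique_of_rails {R : Set (AcyclicReorientation D)}
    {R' : Set (AcyclicReorientation D.deleteLast)}
    (hR' : ∀ X : (isRail.restrict c).Classes, ∃! E, E ∈ R' ∧ (isRail.restrict c).classOf E = X)
    (h1 : ∀ F ∈ R, F.deleteLast ∈ R')
    (h2 : ∀ F : AcyclicReorientation D, F.deleteLast ∈ R' →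
      ∃! G, G ∈ R ∧ G.deleteLast = F.deleteLast ∧ c.r G F) (X : c.Classes) :
    ∃! E, E ∈ R ∧ c.classOf E = X := by
  obtain ⟨x, rfl⟩ := c.classOf_surjective X
  obtain ⟨e, ⟨he, hex⟩, -⟩ := hR' ((isRail.restrict c).classOf x.deleteLast)
  obtain ⟨y, rfl, hyx⟩ := isRail.exists_rel_of_restrict c
    ((LatticeCon.classOf_eq_iff _).1 hex.symm)
  obtain ⟨G, ⟨hG, hGy, hr⟩, -⟩ := h2 y he
  refine ⟨G, ⟨hG, c.classOf_eq_iff.2 (c.trans hr hyx)⟩, ?_⟩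
  rintro K ⟨hK, hKx⟩
  have hKG : c.r K G :=
    c.trans (c.classOf_eq_iff.1 hKx) (c.symm (c.trans hr hyx))
  have hd : K.deleteLast = G.deleteLast :=
    (hR' ((isRail.restrict c).classOf G.deleteLast)).unique
      ⟨h1 K hK, (LatticeCon.classOf_eq_iff _).2 (isRail.restrict_map c hKG)⟩ ⟨h1 G hG, rfl⟩
  exact (h2 G (h1 G hG)).unique ⟨hK, hd, hKG⟩ ⟨hG, rfl, c.refl G⟩

theorem existsUnique_of_trivial_rails {R' : Set (AcyclicReorientation D.deleteLast)}
    (hR' : ∀ X : (isRail.restrict c).Classes, ∃! E, E ∈ R' ∧ (isRail.restrict c).classOf E = X)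
    (h : ∀ E F : AcyclicReorientation D, E.deleteLast = F.deleteLast → c.r E F)
    (X : c.Classes) : ∃! E, E ∈ addSink '' R' ∧ c.classOf E = X := by
  obtain ⟨x, rfl⟩ := c.classOf_surjective X
  obtain ⟨e, ⟨he, hex⟩, huniq⟩ := hR' ((isRail.restrict c).classOf x.deleteLast)
  refine ⟨e.addSink, ⟨⟨e, he, rfl⟩, ?_⟩, ?_⟩
  · obtain ⟨y, hy, hyx⟩ := isRail.exists_rel_of_restrict c
      ((LatticeCon.classOf_eq_iff _).1 hex.symm)
    exact c.classOf_eq_iff.2 (c.trans (h _ _ (by rw [hy, addSink_deleteLast])) hyx)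
  · rintro _ ⟨⟨e', he', rfl⟩, hx⟩
    have := isRail.restrict_map c (c.classOf_eq_iff.1 hx)
    rw [addSink_deleteLast] at this
    rw [huniq e' ⟨he', (LatticeCon.classOf_eq_iff _).2 this⟩]

end Step

/-- Words of reorientations in classes that are adjacent in the cover graph. -/
def WordAdj {n : ℕ} {D : Digraph (Fin n)} [Fact D.IsPeoLabeled]
    (c : LatticeCon (AcyclicReorientation D)) (w w' : List ℕ) : Prop :=
  ∀ E F : AcyclicReorientation D, E.encode = w → F.encode = w' →
    c.coverGraph.Adj (c.classOf E) (c.classOf F)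

/-- A successful run of the greedy algorithm on the words of `R`. -/
def HasRun {n : ℕ} {D : Digraph (Fin n)} [Fact D.IsPeoLabeled]
    (c : LatticeCon (AcyclicReorientation D)) (R : Set (AcyclicReorientation D)) : Prop :=
  ∃ t, (∀ w, w ∈ List.range n :: t ↔ w ∈ encode '' R) ∧ (List.range n :: t).Nodup ∧
    IsRun (encode '' R) [] (List.range n :: t) ∧ (List.range n :: t).IsChain (WordAdj c)

section Step

variable {n : ℕ} {D : Digraph (Fin (n + 1))} [hD : Fact D.IsPeoLabeled]
  (c : LatticeCon (AcyclicReorientation D))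

theorem hasRun_of_trivial_rails {R' : Set (AcyclicReorientation D.deleteLast)}
    (h : HasRun (isRail.restrict c) R') : HasRun c (addSink '' R') := by
  obtain ⟨t, hmem, hnd, hrun, hch⟩ := h
  have him : encode '' (addSink '' R' : Set (AcyclicReorientation D)) =
      addEnd n false '' (encode '' R') := by
    rw [Set.image_image, Set.image_image]
    exact Set.image_congr fun E _ => E.encode_addSink
  have hlist : List.range (n + 1) :: t.map (addEnd n false) =
      (List.range n :: t).map (addEnd n false) := by
    rw [List.map_cons, List.range_succ]; rfl
  refine ⟨t.map (addEnd n false), ?_, ?_, ?_, ?_⟩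
  · intro w
    rw [hlist, him, List.mem_map]
    simp only [hmem]; rfl
  · rw [hlist]
    exact hnd.map (addEnd_injective false)
  · rw [hlist, him]
    refine isRun_map_addEnd (vis := []) ?_ (fun u hu => (hmem u).1 hu) hrun
    rintro _ ⟨E, -, rfl⟩
    exact E.encode_lt
  · rw [hlist, List.isChain_map]
    refine hch.imp_of_mem_imp fun v v' hv hv' hadj => ?_
    obtain ⟨E, -, rfl⟩ := (hmem v).1 hv
    obtain ⟨F, -, rfl⟩ := (hmem v').1 hv'
    rw [← encode_addSink, ← encode_addSink]
    intro E' F' hE' hF'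
    rw [encode_injective hE', encode_injective hF']
    exact (coverGraph_addEnds_adj c (hadj E F rfl rfl)).1

/-- The run is the zigzag over the run for `R'`. Steps inside a rail are covers by
`coverGraph_rail_adj`, and steps between rails are covers because both sections preserve covers. -/
theorem hasRun_of_rails {R : Set (AcyclicReorientation D)}
    {R' : Set (AcyclicReorientation D.deleteLast)} (h : HasRun (isRail.restrict c) R')
    (h0 : ∀ E : AcyclicReorientation D.deleteLast, ¬ c.r E.addSame E.addOpposite)
    (h1 : ∀ F ∈ R, F.deleteLast ∈ R')
    (h2 : ∀ E ∈ R', E.addSame ∈ R ∧ E.addOpposite ∈ R)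
    (h3 : ∀ F : AcyclicReorientation D, F.deleteLast ∈ R' →
      ∃! G, G ∈ R ∧ G.deleteLast = F.deleteLast ∧ c.r G F) : HasRun c R := by
  obtain ⟨t, hmem, hnd, hrun, hch⟩ := h
  have h2' : ∀ E ∈ R', E.addSink ∈ R ∧ E.addSource ∈ R := by
    intro E hE
    rcases E.addSame_eq_addSink_or with h | h <;> rw [← h.1, ← h.2]
    · exact h2 E hE
    · exact (h2 E hE).symm
  -- Without neighbors of `n` the two extremes of a rail would coincide, against `h0`.
  have hN : (lastNbr D).Nonempty := by
    by_contra hN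
    have h : addSame (opposite D.deleteLast) = addOpposite (opposite D.deleteLast) :=
      eq_of_lastFlip (by simp) (by
        rw [lastFlip_addSame, lastFlip_addOpposite, Set.not_nonempty_iff_eq_empty.1 hN])
    refine h0 (opposite _) ?_
    rw [← h]
  have henc : ∀ (E : AcyclicReorientation D.deleteLast) (b : Bool),
      ∃ F : AcyclicReorientation D, F.encode = addEnd n b E.encode ∧ F.deleteLast = E ∧
        (E ∈ R' → F ∈ R) := by
    rintro E (_ | _)
    · exact ⟨_, E.encode_addSink, addSink_deleteLast E, fun hE => (h2' E hE).1⟩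
    · exact ⟨_, E.encode_addSource hN, addSource_deleteLast E, fun hE => (h2' E hE).2⟩
  have hw : ∀ v ∈ encode '' R', ∀ b ∈ v, b < n := by
    rintro _ ⟨E, -, rfl⟩
    exact E.encode_lt
  have hL : ∀ b v, addEnd n b v ∈ encode '' R ↔ v ∈ encode '' R' := by
    intro b v
    constructor
    · rintro ⟨F, hF, h⟩
      rw [addEnd_eq_ins] at h
      exact ⟨_, h1 F hF, deleteLast_encode_of_eq_ins h⟩
    · rintro ⟨E, hE, rfl⟩
      obtain ⟨F, h, -, hF⟩ := henc E b
      exact ⟨F, hF hE, h⟩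
  have hmem' : ∀ v ∈ List.range n :: t, v ∈ encode '' R' := fun v => (hmem v).1
  -- The flag `true` makes the first rail start with `n` at the end of the word, that is, at the
  -- identity.
  have hlist : ∃ s, zigzag (encode '' R) n true (List.range n :: t) = List.range (n + 1) :: s := by
    obtain ⟨s, hs⟩ := zigzag_eq_cons (b := true) (t := t)
      fun b => (hL b (List.range n)).2 (hmem' _ List.mem_cons_self)
    exact ⟨s, by rw [hs, List.range_succ]; rfl⟩
  obtain ⟨s, hs⟩ := hlist
  refine ⟨s, ?_, ?_, ?_, ?_⟩
  · intro w
    rw [← hs, mem_zigzag]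
    constructor
    · rintro ⟨-, -, -, -, -, h⟩
      exact h
    · rintro ⟨F, hF, rfl⟩
      obtain ⟨q, hq, he, -⟩ := F.exists_encode_eq_ins
      exact ⟨_, (hmem _).2 ⟨_, h1 F hF, rfl⟩, q, by rwa [encode_length], he, F, hF, rfl⟩
  · rw [← hs]
    exact zigzag_nodup (fun v hv => hw v (hmem' v hv)) hnd
  · rw [← hs]
    exact zigzag_isRun hw hL (vis' := []) hrun hmem' (by simp) (by simp) (by simpa using hnd)
  · rw [← hs]
    refine zigzag_isChain (fun v hv b => (hL b v).2 (hmem' v hv)) ?_ ?_ hch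
    · intro v hv v' hv' hadj b
      obtain ⟨E, -, rfl⟩ := hmem' v hv
      obtain ⟨F, -, rfl⟩ := hmem' v' hv'
      have h := coverGraph_addEnds_adj c (hadj E F rfl rfl)
      cases b with
      | false =>
        rw [← encode_addSink, ← encode_addSink]
        intro E' F' hE' hF'
        rw [encode_injective hE', encode_injective hF']
        exact h.1
      | true =>
        rw [← encode_addSource hN, ← encode_addSource hN]
        intro E' F' hE' hF'
        rw [encode_injective hE', encode_injective hF']
        exact h.2
    · intro v hv q q' hqq' hq' hqR hqR' hmin
      obtain ⟨E₀, hE₀, rfl⟩ := hmem' v hv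
      obtain ⟨E, hE, hEe⟩ := hqR
      obtain ⟨F, hF, hFe⟩ := hqR'
      have hEd := encode_injective (deleteLast_encode_of_eq_ins hEe)
      have hFd := encode_injective (deleteLast_encode_of_eq_ins hFe)
      rw [encode_length] at hq'
      have key : c.coverGraph.Adj (c.classOf E) (c.classOf F) := by
        refine coverGraph_rail_adj c (R := R) (fun z hz => ?_) (fun hr => ?_) (hEd.trans hFd.symm)
          hqq' hq' (by rw [hEd]; exact hEe) (by rw [hFd]; exact hFe) (by rwa [hEd])
        · obtain ⟨G, ⟨hG, hGz, hr⟩, -⟩ := h3 z (by rwa [hz, hEd])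
          exact ⟨G, hG, hGz, hr⟩
        · have hEF := (h3 F (h1 F hF)).unique ⟨hE, hEd.trans hFd.symm, hr⟩ ⟨hF, rfl, c.refl F⟩
          rw [hEF, hFe] at hEe
          have := (ins_inj E₀.encode_lt E₀.encode_lt (by rwa [encode_length])
            (by rw [encode_length]; omega) hEe).2
          omega
      constructor
      · intro E' F' hE' hF'
        rw [encode_injective (hE'.trans hEe.symm), encode_injective (hF'.trans hFe.symm)]
        exact key
      · intro F' E' hF' hE'
        rw [encode_injective (hE'.trans hEe.symm), encode_injective (hF'.trans hFe.symm)]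
        exact key.symm

end Step

theorem existsUnique_and_hasRun : ∀ {n : ℕ} {D : Digraph (Fin n)} [Fact D.IsPeoLabeled]
    (c : LatticeCon (AcyclicReorientation D)) {R : Set (AcyclicReorientation D)},
    IsRepresentativeSelection c.r R →
    (∀ X : c.Classes, ∃! E, E ∈ R ∧ c.classOf E = X) ∧ HasRun c R
  | 0, D, _, c, R, hR => by
    have hR : R = Set.univ := hR
    subst hR
    have hs : ∀ E F : AcyclicReorientation D, E = F := fun E F => ext' fun u => u.elim0
    constructor
    · intro X
      obtain ⟨x, rfl⟩ := c.classOf_surjective X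
      exact ⟨x, ⟨trivial, rfl⟩, fun _ _ => hs _ _⟩
    · have him : encode '' (Set.univ : Set (AcyclicReorientation D)) = {[]} := by
        ext w
        constructor
        · rintro ⟨E, -, rfl⟩
          rfl
        · rintro rfl
          exact ⟨opposite D, trivial, rfl⟩
      refine ⟨[], ?_, ?_, ?_, ?_⟩
      · intro w
        rw [him]; simp
      · simp
      · rw [him]
        rintro w' ⟨a, δ, ⟨⟨-, d, hd, -⟩, -⟩, -⟩
        simpa using hd.mem
      · exact List.isChain_singleton _
  | n + 1, D, hD, c, R, hR => by
    obtain ⟨R', hR', h⟩ := hR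
    obtain ⟨ih1, ih2⟩ := existsUnique_and_hasRun (isRail.restrict c) hR'
    rcases h with ⟨h0, h1, h2, h3⟩ | ⟨h0, rfl⟩
    · exact ⟨existsUnique_of_rails c ih1 h1 h3, hasRun_of_rails c ih2 h0 h1 h2 h3⟩
    · refine ⟨existsUnique_of_trivial_rails c ih1 ?_, hasRun_of_trivial_rails c ih2⟩
      -- One rail with related extremes forces this on all rails, and by convexity each rail lies in
      -- a single class.
      obtain ⟨E, hE⟩ := not_forall_not.1 h0
      have key : ∀ F : AcyclicReorientation D, c.r F F.deleteLast.addSame := fun F =>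
        rel_of_between c (isRail.lo_le F) (isRail.le_hi F)
          (c.symm (isRail.rel_lo_hi c hE F.deleteLast))
      exact fun E F hEF => c.trans (key E) (by rw [hEF]; exact c.symm (key F))

end AcyclicReorientation

namespace AcyclicReorientation

theorem peoLabeled_algorithmJ {n : ℕ} {D : Digraph (Fin n)} [Fact D.IsPeoLabeled]
    (c : LatticeCon (AcyclicReorientation D)) {R : Set (AcyclicReorientation D)}
    (hR : IsRepresentativeSelection c.r R) :
    (∃ out, AlgorithmJ (encode '' R) (List.range n) out) ∧
      ∀ out, AlgorithmJ (encode '' R) (List.range n) out →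
        out.Nodup ∧ (∀ w, w ∈ out ↔ w ∈ encode '' R) ∧
        ∃ Es : List (AcyclicReorientation D), (∀ E ∈ Es, E ∈ R) ∧ Es.map encode = out ∧
          c.coverGraph.IsHamiltonPath (Es.map c.classOf) := by
  obtain ⟨hex, t, hmem, hnd, hrun, hch⟩ := existsUnique_and_hasRun c hR
  refine ⟨⟨_, hrun.algorithmJ ((hmem _).1 List.mem_cons_self)⟩, fun out hout => ?_⟩
  have hn : ∀ w ∈ List.range n :: t, w.Nodup := by
    intro w hw
    obtain ⟨E, -, rfl⟩ := (hmem w).1 hw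
    exact E.encode_nodup
  obtain rfl := hrun.algorithmJ_unique hn hout
  refine ⟨hnd, hmem, ?_⟩
  obtain ⟨Es, hEs⟩ : ∃ Es : List (AcyclicReorientation D), Es.map encode = List.range n :: t := by
    rw [← Set.mem_range, Set.range_list_map]
    intro w hw
    obtain ⟨E, -, h⟩ := (hmem w).1 hw
    exact ⟨E, h⟩
  have hmemR : ∀ E, E ∈ Es ↔ E ∈ R := by
    intro E
    rw [← List.mem_map_of_injective encode_injective, hEs, hmem,
      encode_injective.mem_set_image]
  refine ⟨Es, fun E => (hmemR E).1, hEs, SimpleGraph.isHamiltonPath_of_isChain ?_ ?_ ?_ ?_⟩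
  · rintro h
    rw [List.map_eq_nil_iff.1 h] at hEs
    simp at hEs
  · have hnd' : Es.Nodup := List.Nodup.of_map encode (hEs ▸ hnd)
    refine hnd'.map_on fun E hE F hF h => ?_
    exact (hex (c.classOf F)).unique ⟨(hmemR E).1 hE, h⟩ ⟨(hmemR F).1 hF, rfl⟩
  · intro X
    obtain ⟨E, ⟨hE, rfl⟩, -⟩ := hex X
    exact List.mem_map_of_mem ((hmemR E).2 hE)
  · rw [← hEs, List.isChain_map] at hch
    rw [List.isChain_map]
    exact hch.imp fun E F h => h E F rfl rfl

/-! ### Transport along a relabeling of the vertices. -/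

/-- Rename the vertices. -/
def relabel {V W : Type*} {D : Digraph V} (e : V ≃ W) (E : AcyclicReorientation D) :
    AcyclicReorientation (D.relabel e) where
  toDigraph := E.toDigraph.relabel e
  acyclic v h := E.acyclic (e.symm v) (h.lift e.symm fun _ _ h => h)
  sameEdges := by
    ext u v
    have h := congrArg (fun G => G.Adj (e.symm u) (e.symm v)) E.sameEdges
    simpa [Digraph.toSimpleGraphInclusive, Digraph.relabel] using h

/-- Undo a renaming of the vertices. -/
def unrelabel {V W : Type*} {D : Digraph V} (e : V ≃ W)
    (E : AcyclicReorientation (D.relabel e)) : AcyclicReorientation D where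
  toDigraph := E.toDigraph.relabel e.symm
  acyclic v h := E.acyclic (e v) (h.lift e fun _ _ h => h)
  sameEdges := by
    ext u v
    have h := congrArg (fun G => G.Adj (e u) (e v)) E.sameEdges
    simpa [Digraph.toSimpleGraphInclusive, Digraph.relabel] using h

/-- Renaming the vertices is a bijection. -/
def relabelEquiv {V W : Type*} (D : Digraph V) (e : V ≃ W) :
    AcyclicReorientation D ≃ AcyclicReorientation (D.relabel e) where
  toFun := relabel e
  invFun := unrelabel e
  left_inv E := ext' fun u v => by simp [relabel, unrelabel, Digraph.relabel]
  right_inv E := ext' fun u v => by simp [relabel, unrelabel, Digraph.relabel]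

theorem flipped_relabel_subset_iff {V W : Type*} {D : Digraph V} (e : V ≃ W)
    {E F : AcyclicReorientation D} :
    (relabel e E).flipped ⊆ (relabel e F).flipped ↔ E.flipped ⊆ F.flipped := by
  constructor
  · rintro h ⟨u, v⟩ huv
    have := @h (e u, e v) (by simpa [flipped, relabel, Digraph.relabel] using huv)
    simpa [flipped, relabel, Digraph.relabel] using this
  · rintro h ⟨u, v⟩ huv
    exact @h (e.symm u, e.symm v) huv

end AcyclicReorientation

section Transport

variable {α β : Type*} [Lattice α] [Lattice β]

/-- Transport a congruence along an isomorphism. -/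
def LatticeCon.transport (c : LatticeCon α) (e : α ≃o β) : LatticeCon β where
  r x y := c.r (e.symm x) (e.symm y)
  iseqv := ⟨fun _ => c.refl _, fun h => c.symm h, fun h h' => c.trans h h'⟩
  inf h h' := by simpa using c.inf h h'
  sup h h' := by simpa using c.sup h h'

/-- The quotient lattices by corresponding congruences are isomorphic. -/
def LatticeCon.classesTransport (c : LatticeCon α) (e : α ≃o β) :
    (c.transport e).Classes ≃o c.Classes where
  toEquiv := Quotient.congr e.symm.toEquiv fun _ _ => Iff.rfl
  map_rel_iff' := by
    intro X Y
    obtain ⟨x, rfl⟩ := LatticeCon.classOf_surjective _ X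
    obtain ⟨y, rfl⟩ := LatticeCon.classOf_surjective _ Y
    change c.classOf (e.symm x) ≤ c.classOf (e.symm y) ↔ _
    rw [LatticeCon.classOf_le_iff, LatticeCon.classOf_le_iff, ← map_inf]
    rfl

theorem SimpleGraph.IsHamiltonPath.map {V W : Type*} {G : SimpleGraph V} {H : SimpleGraph W}
    (f : G →g H) (hf : Function.Bijective f) {l : List V} (h : G.IsHamiltonPath l) :
    H.IsHamiltonPath (l.map f) := by
  classical
  obtain ⟨a, b, p, hp, rfl⟩ := h
  refine ⟨f a, f b, p.map f, ?_, Walk.support_map _ _⟩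
  convert Walk.IsHamiltonian.map f hf (p := p) ?_
  convert hp

theorem LatticeCon.exists_isHamiltonPath_of_orderIso (c : LatticeCon α) (e : α ≃o β)
    (h : ∃ l, (c.transport e).coverGraph.IsHamiltonPath l) :
    ∃ l, c.coverGraph.IsHamiltonPath l := by
  obtain ⟨l, hl⟩ := h
  refine ⟨_, hl.map (H := c.coverGraph) ⟨c.classesTransport e, fun {X Y} h => ?_⟩
    (c.classesTransport e).bijective⟩
  rw [LatticeCon.coverGraph_adj] at *
  simpa using h

end Transport

theorem Digraph.IsPeoConsistent.exists_isHamiltonPath {V : Type*} {D : Digraph V}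
    (h : D.IsPeoConsistent) :
    ∃ _ : Lattice (AcyclicReorientation D),
      (∀ E F : AcyclicReorientation D, E ≤ F ↔ E.flipped ⊆ F.flipped) ∧
      ∀ c : LatticeCon (AcyclicReorientation D), ∃ l, c.coverGraph.IsHamiltonPath l := by
  obtain ⟨n, e, h⟩ := h
  have : Fact (D.relabel e).IsPeoLabeled := ⟨h⟩
  have hD : Fact D.IsAcyclic := ⟨fun v hv => h.isAcyclic (e v) (hv.lift e fun u v huv => by
    change D.Adj (e.symm (e u)) (e.symm (e v))
    simpa using huv)⟩
  let φ : AcyclicReorientation D ≃o AcyclicReorientation (D.relabel e) :=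
    ⟨AcyclicReorientation.relabelEquiv D e, AcyclicReorientation.flipped_relabel_subset_iff e⟩
  -- Only the existence of joins is transported; the lattice is then built on the given order, which
  -- is containment of flip sets by definition.
  have hlub : ∀ E F : AcyclicReorientation D, ∃ G, IsLUB {E, F} G := by
    intro E F
    refine ⟨φ.symm (φ E ⊔ φ F), ?_⟩
    rw [← φ.isLUB_image', Set.image_pair, φ.apply_symm_apply]
    exact isLUB_pair
  let := AcyclicReorientation.latticeOfLUB hlub
  refine ⟨inferInstance, fun _ _ => Iff.rfl, fun c => ?_⟩
  refine c.exists_isHamiltonPath_of_orderIso φ ?_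
  obtain ⟨R, hR⟩ := exists_isRepresentativeSelection (c.transport φ).iseqv
  obtain ⟨⟨out, hout⟩, h⟩ := AcyclicReorientation.peoLabeled_algorithmJ _ hR
  obtain ⟨-, -, Es, -, -, hEs⟩ := h out hout
  exact ⟨_, hEs⟩

/-! ### Skeletal digraphs: excluded induced cycles. -/

namespace Digraph

variable {V : Type*} {D : Digraph V}

theorem exists_isChain_of_transGen {r : V → V → Prop} {u v : V} (h : Relation.TransGen r u v) :
    ∃ p : List V, (u :: p ++ [v]).IsChain r := by
  induction h with
  | single h => exact ⟨[], by simpa using h⟩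
  | @tail b c _ h ih =>
    obtain ⟨p, hp⟩ := ih
    refine ⟨p ++ [b], ?_⟩
    have e : u :: (p ++ [b]) ++ [c] = (u :: p) ++ b :: [c] := by simp
    rw [e, List.isChain_split]
    exact ⟨hp, List.isChain_pair.2 h⟩

theorem IsFilled.adj_of_transGen (h : D.IsFilled) {u v w : V} (huv : D.Adj u v)
    (huw : Relation.TransGen D.Adj u w) (hwv : Relation.TransGen D.Adj w v) :
    D.Adj u w ∧ D.Adj w v := by
  obtain ⟨p, hp⟩ := exists_isChain_of_transGen huw
  obtain ⟨q, hq⟩ := exists_isChain_of_transGen hwv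
  have hc : (u :: (p ++ w :: q) ++ [v]).IsChain D.Adj := by
    have : u :: (p ++ w :: q) ++ [v] = (u :: p) ++ w :: (q ++ [v]) := by simp
    rw [this, List.isChain_split]
    exact ⟨by simpa using hp, by simpa using hq⟩
  have := h u v _ hc huv
  rw [List.cons_append, List.pairwise_cons, List.append_assoc, List.pairwise_append,
    List.cons_append, List.pairwise_cons] at this
  exact ⟨this.1 w (by simp), this.2.2.1.1 v (by simp)⟩

/-- If a longer path bypasses an arc, filledness provides a bypass of length two through any of its
inner vertices. So an arc survives the reduction unless a triangle inside `Z` makes it transitive.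
-/
theorem IsFilled.transitiveReduction_adj (h : D.IsFilled) {Z : Set V} {u v : Z}
    (huv : D.Adj u v) (hno : ∀ w ∈ Z, D.Adj u w → ¬ D.Adj w v) :
    (D.induce Z).transitiveReduction.Adj u v := by
  refine ⟨huv, ?_⟩
  rintro ⟨w, huw, hwv⟩
  obtain ⟨h1, h2⟩ := h.adj_of_transGen huv (huw.lift Subtype.val fun _ _ h => h)
    (hwv.lift Subtype.val fun _ _ h => h)
  exact hno w w.2 h1 h2

variable (D) in
/-- The vertex `v` is a source or a sink, and simplicial, in the subdigraph induced by `W`. -/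
structure IsPeoVertex (W : Set V) (v : V) : Prop where
  source_or_sink : (∀ u ∈ W, ¬ D.Adj u v) ∨ ∀ u ∈ W, ¬ D.Adj v u
  simplicial : ∀ a ∈ W, ∀ b ∈ W, D.toSimpleGraphInclusive.Adj v a →
    D.toSimpleGraphInclusive.Adj v b → a ≠ b → D.toSimpleGraphInclusive.Adj a b

theorem _root_.SimpleGraph.eq_of_dist_eq {G : SimpleGraph V} {a b : V} {p : G.Walk a b}
    (hp : p.length = G.dist a b) {u v : V} (hu : u ∈ p.support) (hv : v ∈ p.support)
    (h : G.dist a u = G.dist a v) : u = v := by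
  classical
  have key : ∀ u (hu : u ∈ p.support), (p.takeUntil u hu).length = G.dist a u := by
    intro u hu
    have h1 := SimpleGraph.dist_le (p.takeUntil u hu)
    obtain ⟨q, hq⟩ := (p.takeUntil u hu).reachable.exists_walk_length_eq_dist
    have h2 := SimpleGraph.dist_le (q.append (p.dropUntil u hu))
    have h3 := congrArg SimpleGraph.Walk.length (p.take_spec hu)
    rw [SimpleGraph.Walk.length_append] at h2 h3
    omega
  rw [← SimpleGraph.Walk.getVert_length_takeUntil hu,
    ← SimpleGraph.Walk.getVert_length_takeUntil hv, key u hu, key v hv, h]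

theorem _root_.SimpleGraph.dist_le_of_adj {G : SimpleGraph V} {a u v : V} (h : G.Reachable a u)
    (huv : G.Adj u v) : G.dist a v ≤ G.dist a u + 1 := by
  obtain ⟨q, hq⟩ := h.exists_walk_length_eq_dist
  have := SimpleGraph.dist_le (q.concat huv)
  rwa [SimpleGraph.Walk.length_concat, hq] at this

/-- A skeletal digraph has no induced cycles of length at least four: two nonadjacent neighbors of
`x` cannot be connected through nonneighbors of `x`. -/
theorem IsSkeletal.not_reachable (hD : D.IsSkeletal) {x a b : V} {U : Set V}
    (hab : a ≠ b) (hnab : ¬ D.toSimpleGraphInclusive.Adj a b)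
    (hxa : D.toSimpleGraphInclusive.Adj x a) (hxb : D.toSimpleGraphInclusive.Adj x b)
    (hxU : x ∉ U) (hU : ∀ u ∈ U, D.toSimpleGraphInclusive.Adj x u → u = a ∨ u = b)
    {H : SimpleGraph V}
    (hH : ∀ u v, H.Adj u v ↔ D.toSimpleGraphInclusive.Adj u v ∧ u ∈ U ∧ v ∈ U) :
    ¬ H.Reachable a b := by
  intro hr
  obtain ⟨p, hp⟩ := hr.exists_walk_length_eq_dist
  have hpU : ∀ z ∈ p.support, z ∈ U := by
    intro z hz
    obtain ⟨e, he, hze⟩ := p.mem_support_iff_exists_mem_edges_of_not_nil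
      (fun hn => hab hn.eq) |>.1 hz
    have := p.edges_subset_edgeSet he
    induction e with
    | _ u v =>
      have := (hH u v).1 this
      rcases Sym2.mem_iff.1 hze with rfl | rfl
      exacts [this.2.1, this.2.2]
  let Z : Set V := {z | z = x ∨ z ∈ p.support}
  -- Adjacent vertices of the shortest path `p` have distances from `a` that differ by exactly one,
  -- which is impossible for three pairwise adjacent vertices.
  have htri' : ∀ u ∈ p.support, ∀ v ∈ p.support, ∀ w ∈ p.support,
      D.toSimpleGraphInclusive.Adj u v → D.toSimpleGraphInclusive.Adj v w →
      ¬ D.toSimpleGraphInclusive.Adj u w := by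
    intro u hu v hv w hw h1 h2 h3
    classical
    have key : ∀ u ∈ p.support, ∀ v ∈ p.support, D.toSimpleGraphInclusive.Adj u v →
        H.dist a v ≤ H.dist a u + 1 ∧ H.dist a u ≤ H.dist a v + 1 ∧ H.dist a u ≠ H.dist a v := by
      intro u hu v hv h
      have huv := (hH u v).2 ⟨h, hpU u hu, hpU v hv⟩
      exact ⟨SimpleGraph.dist_le_of_adj (p.takeUntil u hu).reachable huv,
        SimpleGraph.dist_le_of_adj (p.takeUntil v hv).reachable huv.symm,
        fun he => h.ne (SimpleGraph.eq_of_dist_eq hp hu hv he)⟩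
    have k1 := key u hu v hv h1
    have k2 := key v hv w hw h2
    have k3 := key u hu w hw h3
    omega
  have hx : ∀ u ∈ p.support, ∀ v ∈ p.support, D.toSimpleGraphInclusive.Adj x u →
      D.toSimpleGraphInclusive.Adj x v → ¬ D.toSimpleGraphInclusive.Adj u v := by
    intro u hu v hv h1 h2 h3
    rcases hU u (hpU u hu) h1 with rfl | rfl <;> rcases hU v (hpU v hv) h2 with rfl | rfl
    exacts [h3.ne rfl, hnab h3, hnab h3.symm, h3.ne rfl]
  have htri : ∀ u ∈ Z, ∀ v ∈ Z, ∀ w ∈ Z, D.toSimpleGraphInclusive.Adj u v →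
      D.toSimpleGraphInclusive.Adj v w → ¬ D.toSimpleGraphInclusive.Adj u w := by
    rintro u (rfl | hu) v (rfl | hv) w (rfl | hw) h1 h2 h3
    · exact h1.ne rfl
    · exact h1.ne rfl
    · exact h3.ne rfl
    · exact hx v hv w hw h1 h3 h2
    · exact h2.ne rfl
    · exact hx u hu w hw h1.symm h2 h3
    · exact hx u hu v hv h3.symm h2.symm h1
    · exact htri' u hu v hv w hw h1 h2 h3
  have hac := hD.1.1
  set T := (D.induce Z).transitiveReduction.toSimpleGraphInclusive with hT
  have hTZ : ∀ u v : Z, D.toSimpleGraphInclusive.Adj u v → T.Adj u v := by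
    intro u v h
    refine ⟨fun he => h.ne (congrArg _ he), ?_⟩
    refine (hac.toSimpleGraphInclusive_adj.1 h).imp (fun h' => ?_) (fun h' => ?_)
    · exact hD.2.transitiveReduction_adj h' fun w hw h1 h2 => htri u u.2 w hw v v.2
        (hac.toSimpleGraphInclusive_adj.2 (.inl h1)) (hac.toSimpleGraphInclusive_adj.2 (.inl h2)) h
    · exact hD.2.transitiveReduction_adj h' fun w hw h1 h2 => htri v v.2 w hw u u.2
        (hac.toSimpleGraphInclusive_adj.2 (.inl h1)) (hac.toSimpleGraphInclusive_adj.2 (.inl h2))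
        h.symm
  have hpZ : ∀ z ∈ p.support, z ∈ Z := fun z hz => .inr hz
  have hle : H.induce Z ≤ T := fun u v h => hTZ u v ((hH u v).1 h).1
  let q := ((p.induce Z hpZ).mapLe hle).reverse
  have hxZ : x ∈ Z := .inl rfl
  have hq : (⟨x, hxZ⟩ : Z) ∉ q.support := by
    intro h
    rw [SimpleGraph.Walk.support_reverse, List.mem_reverse, SimpleGraph.Walk.support_map,
      SimpleGraph.Walk.support_induce] at h
    have : x ∈ p.support := by simpa using h
    exact hxU (hpU x this)
  -- As `Z` spans no triangle, all its edges survive in the reduction, a forest. The edge from `x`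
  -- to `a` would be a bridge, but going from `x` to `b` and back along `p` avoids it.
  have hbr := SimpleGraph.isAcyclic_iff_forall_adj_isBridge.1 (hD.1.2 Z)
    (hTZ ⟨x, hxZ⟩ ⟨a, hpZ a p.start_mem_support⟩ hxa)
  rw [SimpleGraph.isBridge_iff_forall_walk_mem_edges] at hbr
  have := hbr (.cons (hTZ ⟨x, hxZ⟩ ⟨b, hpZ b p.end_mem_support⟩ hxb) q)
  rw [SimpleGraph.Walk.edges_cons, List.mem_cons] at this
  rcases this with h | h
  · rw [Sym2.eq_iff] at h
    rcases h with ⟨-, h⟩ | ⟨h, -⟩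
    · exact hab (congrArg Subtype.val h)
    · exact hxb.ne (congrArg Subtype.val h)
  · exact hq (SimpleGraph.Walk.fst_mem_support_of_mem_edges _ h)

/-- Two vertices on paths from `s` to `t` of length two are adjacent. -/
theorem IsSkeletal.adj_of_diamond (hD : D.IsSkeletal) {s t x y : V} (hsx : D.Adj s x)
    (hxt : D.Adj x t) (hsy : D.Adj s y) (hyt : D.Adj y t) (hxy : x ≠ y) :
    D.toSimpleGraphInclusive.Adj x y := by
  by_contra hn
  have hac := hD.1.1
  rw [hac.toSimpleGraphInclusive_adj, not_or] at hn
  let Z : Set V := {s, t, x, y}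
  have hs : s ∈ Z := by simp [Z]
  have ht : t ∈ Z := by simp [Z]
  have hx : x ∈ Z := by simp [Z]
  have hy : y ∈ Z := by simp [Z]
  set T := (D.induce Z).transitiveReduction.toSimpleGraphInclusive with hT
  have key : ∀ u v : Z, D.Adj u v → (∀ w ∈ Z, D.Adj u w → ¬ D.Adj w v) → T.Adj u v :=
    fun u v h h' => ⟨fun he => hac.ne h (congrArg _ he), .inl (hD.2.transitiveReduction_adj h h')⟩
  have h1 : T.Adj ⟨s, hs⟩ ⟨x, hx⟩ := key _ _ hsx (by
    rintro w (rfl | rfl | rfl | rfl) h h'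
    exacts [hac.irrefl h, hac.asymm hxt h', hac.irrefl h', hn.2 h'])
  have h2 : T.Adj ⟨s, hs⟩ ⟨y, hy⟩ := key _ _ hsy (by
    rintro w (rfl | rfl | rfl | rfl) h h'
    exacts [hac.irrefl h, hac.asymm hyt h', hn.1 h', hac.irrefl h'])
  have h3 : T.Adj ⟨x, hx⟩ ⟨t, ht⟩ := key _ _ hxt (by
    rintro w (rfl | rfl | rfl | rfl) h h'
    exacts [hac.asymm hsx h, hac.irrefl h', hac.irrefl h, hn.1 h])
  have h4 : T.Adj ⟨y, hy⟩ ⟨t, ht⟩ := key _ _ hyt (by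
    rintro w (rfl | rfl | rfl | rfl) h h'
    exacts [hac.asymm hsy h, hac.irrefl h', hn.2 h, hac.irrefl h])
  have hbr := SimpleGraph.isAcyclic_iff_forall_adj_isBridge.1 (hD.1.2 Z) h1
  rw [SimpleGraph.isBridge_iff_forall_walk_mem_edges] at hbr
  -- The walk `s, y, t, x` avoids the edge from `s` to `x`, so the surviving edges contain a cycle
  -- of length four.
  have := hbr (.cons h2 (.cons h4 (.cons h3.symm .nil)))
  have e1 := hac.ne hsx
  have e2 := hac.ne hxt
  have e3 := hac.ne hsy
  have e5 : s ≠ t := by rintro rfl; exact hac.asymm hsx hxt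
  simp [e1, e2, e3, e5, hxy, e1.symm] at this

theorem IsAcyclic.exists_source [Finite V] (h : D.IsAcyclic) {W : Set V} (hW : W.Nonempty) :
    ∃ v ∈ W, ∀ u ∈ W, ¬ D.Adj u v := by
  have hirr : Std.Irrefl (Relation.TransGen D.Adj) := ⟨h⟩
  obtain ⟨w, hw, hmin⟩ :=
    (Finite.wellFounded_of_trans_of_irrefl (Relation.TransGen D.Adj)).has_min W hW
  exact ⟨w, hw, fun u hu h' => hmin u hu (.single h')⟩

theorem IsAcyclic.exists_sink [Finite V] (h : D.IsAcyclic) {W : Set V} (hW : W.Nonempty) :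
    ∃ v ∈ W, ∀ u ∈ W, ¬ D.Adj v u :=
  h.reverse.exists_source hW

end Digraph

/-! ### Skeletal digraphs are peo-consistent. -/

namespace Digraph

variable {V : Type*} {D : Digraph V}

theorem IsPeoVertex.mono {H W : Set V} {g : V} (hg : D.IsPeoVertex H g)
    (hW : ∀ w ∈ W, D.toSimpleGraphInclusive.Adj g w → w ∈ H) (hD : D.IsAcyclic) :
    D.IsPeoVertex W g := by
  refine ⟨hg.1.imp (fun h u hu hug => ?_) (fun h u hu hug => ?_), fun a ha b hb hga hgb => ?_⟩
  · exact h u (hW u hu (hD.toSimpleGraphInclusive_adj.2 (.inr hug))) hug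
  · exact h u (hW u hu (hD.toSimpleGraphInclusive_adj.2 (.inl hug))) hug
  · exact hg.2 a (hW a ha hga) b (hW b hb hgb) hga hgb

/-- Dirac's argument. Let `C` be the component of `y` among the nonneighbors of `x` in `W`, and `S`
its boundary. Then `S` consists of neighbors of `x`, and it is a clique, since two nonadjacent
members would be connected through `C`. Neighbors in `W` of a vertex of `C` lie in `C ∪ S`, so it
suffices to find in `C` a suitable vertex for the smaller set `C ∪ S`. Prescribing a nonneighbor of
the new vertex strengthens the claim enough to keep that vertex out of `S`. -/
theorem IsSkeletal.exists_isPeoVertex_not_adj [Finite V] (hD : D.IsSkeletal) (W : Set V) :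
    ∀ x ∈ W, ∀ y ∈ W, x ≠ y → ¬ D.toSimpleGraphInclusive.Adj x y →
    ∃ g ∈ W, g ≠ x ∧ ¬ D.toSimpleGraphInclusive.Adj x g ∧ D.IsPeoVertex W g := by
  induction W using WellFoundedLT.induction with
  | ind W ih =>
  intro x hx y hy hxy hnxy
  set G := D.toSimpleGraphInclusive with hG
  have hac := hD.1.1
  have hadj : ∀ {u v}, G.Adj u v ↔ D.Adj u v ∨ D.Adj v u := hac.toSimpleGraphInclusive_adj
  let N : Set V := {u | u ∈ W ∧ u ≠ x ∧ ¬ G.Adj x u}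
  let K : SimpleGraph V :=
    { Adj := fun u v => G.Adj u v ∧ u ∈ N ∧ v ∈ N
      symm := ⟨fun _ _ h => ⟨h.1.symm, h.2.2, h.2.1⟩⟩
      loopless := ⟨fun _ h => h.1.ne rfl⟩ }
  let C : Set V := {z | K.Reachable y z}
  have hyC : y ∈ C := SimpleGraph.Reachable.refl y
  have hCN : C ⊆ N := by
    rintro z ⟨p⟩
    cases hp : p.reverse with
    | nil => exact ⟨hy, hxy.symm, hnxy⟩
    | cons h _ => exact h.2.1
  let S : Set V := {s | s ∈ W ∧ s ∉ C ∧ ∃ c ∈ C, G.Adj c s}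
  have hSx : ∀ s ∈ S, G.Adj x s := by
    rintro s ⟨hsW, hsC, c, hc, hcs⟩
    by_contra hn
    have hsx : s ≠ x := by
      rintro rfl
      exact (hCN hc).2.2 hcs.symm
    exact hsC (SimpleGraph.Reachable.trans hc
      (SimpleGraph.Adj.reachable (G := K) ⟨hcs, hCN hc, hsW, hsx, hn⟩))
  have hnbr : ∀ c ∈ C, ∀ w ∈ W, G.Adj c w → w ∈ C ∪ S := fun c hc w hw h => by
    by_cases hwC : w ∈ C
    · exact .inl hwC
    · exact .inr ⟨hw, hwC, c, hc, h⟩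
  have hSclique : ∀ a ∈ S, ∀ b ∈ S, a ≠ b → G.Adj a b := by
    intro a ha b hb hab
    by_contra hnab
    let U : Set V := {u | u ∈ C ∨ u = a ∨ u = b}
    let H : SimpleGraph V :=
      { Adj := fun u v => G.Adj u v ∧ u ∈ U ∧ v ∈ U
        symm := ⟨fun _ _ h => ⟨h.1.symm, h.2.2, h.2.1⟩⟩
        loopless := ⟨fun _ h => h.1.ne rfl⟩ }
    have hxU : x ∉ U := by
      rintro (h | rfl | rfl)
      · exact (hCN h).2.1 rfl
      · exact (hSx _ ha).ne rfl
      · exact (hSx _ hb).ne rfl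
    refine hD.not_reachable hab hnab (hSx a ha) (hSx b hb) hxU ?_ (H := H) (fun _ _ => Iff.rfl) ?_
    · rintro u (h | h) hxu
      · exact absurd hxu (hCN h).2.2
      · exact h
    · have hwalk : ∀ {u v : V}, K.Walk u v → u ∈ C → H.Reachable u v := by
        intro u v p
        induction p with
        | nil => exact fun _ => .refl _
        | @cons u v w h p ih =>
          intro hu
          have hv : v ∈ C := SimpleGraph.Reachable.trans hu h.reachable
          exact (SimpleGraph.Adj.reachable (G := H) ⟨h.1, .inl hu, .inl hv⟩).trans (ih hv)
      obtain ⟨-, -, c, hc, hca⟩ := ha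
      obtain ⟨-, -, c', hc', hcb⟩ := hb
      obtain ⟨p⟩ := SimpleGraph.Reachable.trans (SimpleGraph.Reachable.symm hc) hc'
      have h1 : H.Adj a c := ⟨hca.symm, .inr (.inl rfl), .inl hc⟩
      have h2 : H.Adj c' b := ⟨hcb, .inl hc', .inr (.inr rfl)⟩
      exact (h1.reachable.trans (hwalk p hc)).trans h2.reachable
  have hHW : C ∪ S ⊆ W := by
    rintro z (h | h)
    exacts [(hCN h).1, h.1]
  have hxH : x ∉ C ∪ S := by
    rintro (h | h)
    · exact (hCN h).2.1 rfl
    · exact (hSx x h).ne rfl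
  have hlt : C ∪ S < W := lt_of_le_of_ne hHW fun h => hxH (h ▸ hx)
  have done : ∀ g ∈ C, D.IsPeoVertex (C ∪ S) g →
      ∃ g ∈ W, g ≠ x ∧ ¬ G.Adj x g ∧ D.IsPeoVertex W g := fun g hg h =>
    ⟨g, (hCN hg).1, (hCN hg).2.1, (hCN hg).2.2, h.mono (hnbr g hg) hac⟩
  -- If some `s ∈ S` has a nonneighbor in `C ∪ S`, the induction yields a vertex nonadjacent to `s`,
  -- hence not in the clique `S`. Otherwise members of `S` are adjacent to everything else, and any
  -- nonadjacent pair serves. What remains is the case of a clique.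
  by_cases h1 : ∃ s ∈ S, ∃ h ∈ C ∪ S, s ≠ h ∧ ¬ G.Adj s h
  · obtain ⟨s, hs, h, hh, hsh, hnsh⟩ := h1
    obtain ⟨g, hg, hgs, hngs, hpeo⟩ := ih _ hlt s (.inr hs) h hh hsh hnsh
    refine done g (hg.resolve_right fun hgS => hngs (hSclique s hs g hgS hgs.symm)) hpeo
  by_cases h2 : ∃ u ∈ C ∪ S, ∃ v ∈ C ∪ S, u ≠ v ∧ ¬ G.Adj u v
  · obtain ⟨u, hu, v, hv, huv, hnuv⟩ := h2
    obtain ⟨g, hg, hgu, hngu, hpeo⟩ := ih _ hlt u hu v hv huv hnuv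
    exact done g (hg.resolve_right fun hgS =>
      h1 ⟨g, hgS, u, hu, hgu, fun h => hngu h.symm⟩) hpeo
  push Not at h2
  obtain ⟨s, hs, hsrc⟩ := hac.exists_source (W := C ∪ S) ⟨y, .inl hyC⟩
  obtain ⟨t, ht, hsnk⟩ := hac.exists_sink (W := C ∪ S) ⟨y, .inl hyC⟩
  by_cases hsC : s ∈ C
  · exact done s hsC ⟨.inl hsrc, fun a ha b hb _ _ hab => h2 a ha b hb hab⟩
  by_cases htC : t ∈ C
  · exact done t htC ⟨.inr hsnk, fun a ha b hb _ _ hab => h2 a ha b hb hab⟩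
  -- In the clique `C ∪ S` source and sink are simplicial, so the only obstruction is that both lie
  -- in `S`. Then `s → y → t`, and both ends are adjacent to `x`. Whether `x` comes before `s`,
  -- between `s` and `t`, or after `t`, filledness or the diamond lemma makes `x` and `y` adjacent.
  exfalso
  have hsS := hs.resolve_left hsC
  have htS := ht.resolve_left htC
  have hyH : y ∈ C ∪ S := .inl hyC
  have hsy : D.Adj s y := (hadj.1 (h2 s hs y hyH (by rintro rfl; exact hsC hyC))).resolve_right
    (hsrc y hyH)
  have hyt : D.Adj y t := (hadj.1 (h2 y hyH t ht (by rintro rfl; exact htC hyC))).resolve_right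
    (hsnk y hyH)
  have hst : D.Adj s t := (hadj.1 (h2 s hs t ht
    (by rintro rfl; exact hac.asymm hsy hyt))).resolve_right (hsrc t ht)
  rcases hadj.1 (hSx s hsS) with hxs | hsx
  · have hxt : D.Adj x t := (hadj.1 (hSx t htS)).resolve_right fun h =>
      hac x (.tail (.tail (.single hxs) hst) h)
    exact hnxy (hadj.2 (.inl (hD.2.adj_of_transGen hxt (.tail (.single hxs) hsy) (.single hyt)).1))
  · rcases hadj.1 (hSx t htS) with hxt | htx
    · exact hnxy (hD.adj_of_diamond hsx hxt hsy hyt hxy)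
    · exact hnxy (hadj.2 (.inr
        (hD.2.adj_of_transGen hsx (.single hsy) (.tail (.single hyt) htx)).2))

theorem IsSkeletal.exists_isPeoVertex [Finite V] (hD : D.IsSkeletal) {W : Set V}
    (hW : W.Nonempty) : ∃ g ∈ W, D.IsPeoVertex W g := by
  by_cases h : ∃ x ∈ W, ∃ y ∈ W, x ≠ y ∧ ¬ D.toSimpleGraphInclusive.Adj x y
  · obtain ⟨x, hx, y, hy, hxy, hn⟩ := h
    obtain ⟨g, hg, -, -, h⟩ := hD.exists_isPeoVertex_not_adj W x hx y hy hxy hn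
    exact ⟨g, hg, h⟩
  · push Not at h
    obtain ⟨s, hs, hsrc⟩ := hD.1.1.exists_source hW
    exact ⟨s, hs, .inl hsrc, fun a ha b hb _ _ hab => h a ha b hb hab⟩

/-- The vertex found in `W` receives the largest label, and `W` without it is labeled recursively;
every such set is again covered because the vertex lemma holds for all induced subdigraphs. -/
theorem IsSkeletal.exists_labeling [Finite V] (hD : D.IsSkeletal) : ∀ (n : ℕ) (W : Set V),
    W.ncard = n → ∃ f : Fin n → V, Function.Injective f ∧ Set.range f = W ∧
      (Digraph.mk fun i j => D.Adj (f i) (f j)).IsPeoLabeled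
  | 0, W, hW => by
    refine ⟨fun i => i.elim0, fun i => i.elim0, ?_, trivial⟩
    rw [(Set.ncard_eq_zero).1 hW, Set.range_eq_empty]
  | n + 1, W, hW => by
    obtain ⟨g, hgW, hg⟩ := hD.exists_isPeoVertex (Set.nonempty_of_ncard_ne_zero
      (s := W) (by omega))
    obtain ⟨f, hf, hfW, hpeo⟩ := hD.exists_labeling n (W \ {g}) (by
      rw [Set.ncard_sdiff_singleton_of_mem hgW, hW]; rfl)
    have hgf : g ∉ Set.range f := by rw [hfW]; simp
    have hmem : ∀ i : Fin (n + 1), (Fin.snoc f g : Fin (n + 1) → V) i ∈ W := by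
      intro i
      induction i using Fin.lastCases with
      | last => simpa
      | cast i =>
        rw [Fin.snoc_castSucc]
        exact (hfW.subset ⟨i, rfl⟩).1
    have hinj : Function.Injective (Fin.snoc f g : Fin (n + 1) → V) :=
      Fin.snoc_injective_iff.2 ⟨hf, hgf⟩
    have hGadj : ∀ i j : Fin (n + 1), (Digraph.mk fun i j => D.Adj
        ((Fin.snoc f g : Fin (n + 1) → V) i)
        ((Fin.snoc f g : Fin (n + 1) → V) j)).toSimpleGraphInclusive.Adj i j ↔
        D.toSimpleGraphInclusive.Adj ((Fin.snoc f g : Fin (n + 1) → V) i)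
        ((Fin.snoc f g : Fin (n + 1) → V) j) := by
      intro i j
      rw [toSimpleGraphInclusive_adj, toSimpleGraphInclusive_adj, hinj.ne_iff]
    refine ⟨Fin.snoc f g, hinj, ?_, ?_, ?_, ?_⟩
    · rw [Fin.range_snoc, hfW, Set.insert_sdiff_singleton, Set.insert_eq_of_mem hgW]
    · refine hg.1.imp (fun h i hi => ?_) (fun h i hi => ?_)
      · exact h _ (hmem i) (by simpa using hi)
      · exact h _ (hmem i) (by simpa using hi)
    · intro a ha b hb hab
      have ha := (hGadj _ _).1 ha
      have hb := (hGadj _ _).1 hb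
      rw [Fin.snoc_last] at ha hb
      exact (hGadj _ _).2 (hg.2 _ (hmem a) _ (hmem b) ha hb (hinj.ne hab))
    · have : (Digraph.mk fun i j => D.Adj ((Fin.snoc f g : Fin (n + 1) → V) i)
          ((Fin.snoc f g : Fin (n + 1) → V) j)).deleteLast =
          Digraph.mk fun i j => D.Adj (f i) (f j) := by
        ext i j
        simp [Digraph.deleteLast]
      rw [this]
      exact hpeo

theorem IsSkeletal.isPeoConsistent [Finite V] (hD : D.IsSkeletal) : D.IsPeoConsistent := by
  obtain ⟨f, hf, hfu, h⟩ := hD.exists_labeling _ Set.univ rfl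
  exact ⟨_, (Equiv.ofBijective f ⟨hf, Set.range_eq_univ.1 hfu⟩).symm, h⟩

end Digraph

theorem mainTheorem2 :
    (∀ (n : ℕ) (D : Digraph (Fin n)), D.IsPeoLabeled →
      ∃ _ : Lattice (AcyclicReorientation D),
        (∀ E F : AcyclicReorientation D, E ≤ F ↔ E.flipped ⊆ F.flipped) ∧
        ∀ c : LatticeCon (AcyclicReorientation D),
          (∃ R, IsRepresentativeSelection c.r R) ∧
          ∀ R, IsRepresentativeSelection c.r R →
            (∀ X : c.Classes, ∃! E, E ∈ R ∧ c.classOf E = X) ∧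
            (∃ out, AlgorithmJ (AcyclicReorientation.encode '' R) (List.range n) out) ∧
            ∀ out, AlgorithmJ (AcyclicReorientation.encode '' R) (List.range n) out →
              out.Nodup ∧
              (∀ w, w ∈ out ↔ w ∈ AcyclicReorientation.encode '' R) ∧
              ∃ Es : List (AcyclicReorientation D),
                (∀ E ∈ Es, E ∈ R) ∧
                Es.map AcyclicReorientation.encode = out ∧
                c.coverGraph.IsHamiltonPath (Es.map c.classOf)) ∧
    (∀ (V : Type*) (D : Digraph V), D.IsPeoConsistent →
      ∃ _ : Lattice (AcyclicReorientation D),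
        (∀ E F : AcyclicReorientation D, E ≤ F ↔ E.flipped ⊆ F.flipped) ∧
        ∀ c : LatticeCon (AcyclicReorientation D), ∃ l, c.coverGraph.IsHamiltonPath l) ∧
    (∀ (V : Type*) [Finite V] (D : Digraph V), D.IsSkeletal →
      ∃ _ : Lattice (AcyclicReorientation D),
        (∀ E F : AcyclicReorientation D, E ≤ F ↔ E.flipped ⊆ F.flipped) ∧
        ∀ c : LatticeCon (AcyclicReorientation D), ∃ l, c.coverGraph.IsHamiltonPath l) := by
  refine ⟨fun n D hD => ?_, fun V D hD => hD.exists_isHamiltonPath,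
    fun V _ D hD => hD.isPeoConsistent.exists_isHamiltonPath⟩
  have : Fact D.IsPeoLabeled := ⟨hD⟩
  refine ⟨inferInstance, fun _ _ => Iff.rfl, fun c =>
    ⟨exists_isRepresentativeSelection c.iseqv, fun R hR => ?_⟩⟩
  exact ⟨(AcyclicReorientation.existsUnique_and_hasRun c hR).1,
    AcyclicReorientation.peoLabeled_algorithmJ c hR⟩
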